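/- Let $n\ge 2$, let $(M^{2n},\omega)$ be a closed (compact, without boundary) symplectic manifold with a Riemannian metric $g$ compatible with $\omega$, oriented (for instance by $\omega^n$; any orientation is allowed), and let $*$ be the Hodge star. Let $G$ be a Lie group whose Lie algebra $\mathfrak g$ carries an $\mathrm{Ad}$-invariant inner product, let $P\to M$ be a smooth principal $G$-bundle, and let $\langle\cdot,\cdot\rangle$ be the induced $L^2$ inner product on $\Omega^*(M,\mathrm{Ad}\,P)$. For a connection $A$ on $P$ let $F=dA+\tfrac12[A\wedge A]$ be its curvature, $\Pi$ the projection of $2$-forms to their primitive component, so that $F=F_p+\Phi\,\omega$ with $F_p=\Pi F$, and put $\partial_{+A}\eta=\Pi(d_A\eta)$ for $\eta\in\Omega^1(M,\mathrm{Ad}\,P)$ and $d_A^*=-*d_A*$. The primitive Yang–Mills functional is $S(A)=\|F_p(A)\|^2=\langle F_p(A),F_p(A)\rangle$, and $A$ is a primitive Yang–Mills connection if it is a critical point of $S$, i.e. $\frac{d}{ds}\big|_{s=0}S(A+s\zeta)=0$ for all $\zeta\in\Omega^1(M,\mathrm{Ad}\,P)$. Let $A$ be a primitive Yang–Mills connection.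 A form $\eta\in\Omega^1(M,\mathrm{Ad}\,P)$ is called tangent at $A$ to the space of primitive Yang–Mills connections (in the infinitesimal, or Zariski, sense) if there is a smooth path $A_t=A+t\eta+o(t)$ of connections with $A_0=A$ that satisfies the critical point equations to first order in $t$: for every $\zeta\in\Omega^1(M,\mathrm{Ad}\,P)$, $\frac{d}{ds}\big|_{s=0}S(A_t+s\zeta)=o(t)$ as $t\to0$. Let $$(L_p)_A\eta=d_A^*\partial_{+A}\eta+*[*F_p\wedge\eta],\qquad \eta\in\Omega^1(M,\mathrm{Ad}\,P).$$ Then: 1. $(L_p)_A$ maps $\Omega^1(M,\mathrm{Ad}\,P)$ to itself and is the operator induced by the Hessian of $S$ at $A$: for all $\eta,\zeta\in\Omega^1(M,\mathrm{Ad}\,P)$, $$\frac{d}{dt}\Big|_{t=0}\frac{d}{ds}\Big|_{s=0}S(A+t\eta+s\zeta)=2\,\langle (L_p)_A\eta,\zeta\rangle .$$ In particular the quadratic form $Q_p(\eta,\eta)=\tfrac12\frac{d^2}{dt^2}\big|_{t=0}S(A+t\eta)$ equals $\langle (L_p)_A\eta,\eta\rangle$. 2. $\eta\in\Omega^1(M,\mathrm{Ad}\,P)$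 is tangent at $A$ to the space of primitive Yang–Mills connections if and only if $(L_p)_A\eta=0$. -/

import Mathlib

open scoped Manifold ContDiff

noncomputable section

namespace PYM

/-! ### Differential forms on a manifold

`M` is a manifold modelled on `ℝ²ⁿ`.  In Mathlib the tangent space `TangentSpace (𝓡 (2 * n)) x` is
by definition the model space, via the preferred chart at `x`; so a `V`-valued `k`-form on `M` is a
function `M → Model n [⋀^Fin k]→L[ℝ] V`. -/

/-- The model vector space `ℝ²ⁿ`. -/
abbrev Model (n : ℕ) : Type := EuclideanSpace ℝ (Fin (2 * n))

section Forms

variable {n : ℕ} {M : Type*} [TopologicalSpace M] [ChartedSpace (Model n) M]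
  [IsManifold (𝓡 (2 * n)) ∞ M]
  {V : Type*} [NormedAddCommGroup V] [NormedSpace ℝ V] {k : ℕ}

/-- The coordinate expression of a form in the chart centred at `c`, i.e. its pullback under the
inverse chart.  At `p = φ_c⁻¹ y`, the map `tangentCoordChange c p p` is the derivative of `φ_c⁻¹`
at `y`, as a map from chart coordinates to `T_p M`. -/
def inChart (c : M) (η : M → Model n [⋀^Fin k]→L[ℝ] V) (y : Model n) :
    Model n [⋀^Fin k]→L[ℝ] V :=
  let p : M := (extChartAt (𝓡 (2 * n)) c).symm y
  (η p).compContinuousLinearMap (tangentCoordChange (𝓡 (2 * n)) c p p)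

/-- The part of the image of the chart centred at `c` that corresponds to `U ⊆ M`. -/
def chartDomain (c : M) (U : Set M) : Set (Model n) :=
  (extChartAt (𝓡 (2 * n)) c).target ∩ (extChartAt (𝓡 (2 * n)) c).symm ⁻¹' U

/-- Smoothness of a form on a set `U` (used for open `U`), in all charts. -/
def IsSmoothFormOn (U : Set M) (η : M → Model n [⋀^Fin k]→L[ℝ] V) : Prop :=
  ∀ c : M, ContDiffOn ℝ ∞ (inChart c η) (chartDomain c U)

/-- The exterior derivative, computed at `x` in the preferred chart at `x`. -/
def extDer (η : M → Model n [⋀^Fin k]→L[ℝ] V) (x : M) : Model n [⋀^Fin (k + 1)]→L[ℝ] V :=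
  extDeriv (inChart x η) (extChartAt (𝓡 (2 * n)) x x)

end Forms

/-! ### Oriented symplectic manifolds with a compatible metric -/

section Symplectic

variable (n : ℕ) (M : Type*) [TopologicalSpace M] [ChartedSpace (Model n) M]
  [IsManifold (𝓡 (2 * n)) ∞ M]

/-- A symplectic form on a `2n`-manifold: a smooth closed nondegenerate 2-form. -/
structure SymplecticForm where
  toForm : M → Model n [⋀^Fin 2]→L[ℝ] ℝ
  smooth : IsSmoothFormOn Set.univ toForm
  closed : ∀ x, extDer toForm x = 0
  nondegenerate : ∀ x u, (∀ v, toForm x ![u, v] = 0) → u = 0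

/-- An orientation of a `2n`-manifold, represented by a nowhere vanishing smooth form of top
degree; `ωⁿ` is an example on a symplectic manifold. -/
structure OrientationForm where
  toForm : M → Model n [⋀^Fin (2 * n)]→L[ℝ] ℝ
  smooth : IsSmoothFormOn Set.univ toForm
  ne_zero : ∀ x, toForm x ≠ 0

/-- A smooth Riemannian metric on a `2n`-manifold. -/
abbrev Metric : Type _ :=
  Bundle.ContMDiffRiemannianMetric (𝓡 (2 * n)) ∞ (Model n) (TangentSpace (𝓡 (2 * n)) : M → Type _)

variable {n M}

/-- The inner product `g_x` of the metric on `T_x M`. -/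
def metricAt (g : Metric n M) (x : M) : Model n →L[ℝ] Model n →L[ℝ] ℝ := g.inner x

/-- The metric `g` is compatible with `ω`: `g(u, v) = ω(u, J v)` for an almost complex structure
`J` preserving `ω`. -/
def IsCompatible (w : SymplecticForm n M) (g : Metric n M) : Prop :=
  ∀ x, ∃ J : Model n →L[ℝ] Model n, (∀ v, J (J v) = -v) ∧
    (∀ u v, w.toForm x ![J u, J v] = w.toForm x ![u, v]) ∧
    ∀ u v, metricAt g x u v = w.toForm x ![u, J v]

variable (n M)

/-- An oriented symplectic manifold with a compatible Riemannian metric. -/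
structure SymplecticRiemannian where
  symp : SymplecticForm n M
  metric : Metric n M
  compatible : IsCompatible symp metric
  orientation : OrientationForm n M

end Symplectic

section PointwiseAlgebra

variable {n : ℕ} {M : Type*} [TopologicalSpace M] [ChartedSpace (Model n) M]
  [IsManifold (𝓡 (2 * n)) ∞ M] {V : Type*} [NormedAddCommGroup V] [NormedSpace ℝ V]
  {k l : ℕ}

/-- The coordinate basis `e_i` of `T_x M`. -/
def frame (i : Fin (2 * n)) : Model n := EuclideanSpace.single i 1

/-- The Gram matrix `g_ij = g_x(e_i, e_j)`. -/
def gram (g : Metric n M) (x : M) : Matrix (Fin (2 * n)) (Fin (2 * n)) ℝ :=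
  Matrix.of fun i j => metricAt g x (frame (n := n) i) (frame (n := n) j)

/-- The dual basis `e^i = ∑ⱼ g^ij e_j` of `T_x M`, so that `g_x(e^i, e_j) = δ_ij`. -/
def coframe (g : Metric n M) (x : M) (i : Fin (2 * n)) : Model n :=
  ∑ j, (gram g x)⁻¹ i j • frame (n := n) j

/-- The Riemannian volume form `√(det g_ij) e¹ ∧ ⋯ ∧ e²ⁿ` of the given orientation, i.e. the
positive multiple of the orientation form with value `± √(det g_ij)` on the coordinate basis. -/
def volForm (S : SymplecticRiemannian n M) (x : M) : Model n [⋀^Fin (2 * n)]→L[ℝ] ℝ :=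
  (√(gram S.metric x).det / |S.orientation.toForm x (frame (n := n))|) • S.orientation.toForm x

/-- For a `(k+l)`-form `μ` at a point and `u = (u_1, …, u_k)`, the `l`-form
`v ↦ μ(u_1, …, u_k, v_1, …, v_l)`. -/
def contractFirst (h : k + l = 2 * n) (μ : Model n [⋀^Fin (2 * n)]→L[ℝ] ℝ) (u : Fin k → Model n) :
    Model n [⋀^Fin l]→L[ℝ] ℝ :=
  let e : Fin (2 * n) ≃ Fin k ⊕ Fin l := (finSumFinEquiv.trans (finCongr h)).symm
  { toFun := fun v => μ (Sum.elim u v ∘ e)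
    map_update_add' := by
      intro _ v i a b
      have key : ∀ w, Sum.elim u (Function.update v i w) ∘ e =
          Function.update (Sum.elim u v ∘ e) (e.symm (Sum.inr i)) w := by
        intro w
        classical
        rw [← Function.update_comp_equiv, Sum.update_elim_inr]
      simp only [key, ContinuousAlternatingMap.map_update_add]
    map_update_smul' := by
      intro _ v i a b
      have key : ∀ w, Sum.elim u (Function.update v i w) ∘ e =
          Function.update (Sum.elim u v ∘ e) (e.symm (Sum.inr i)) w := by
        intro w
        classical
        rw [← Function.update_comp_equiv, Sum.update_elim_inr]
      simp only [key, ContinuousAlternatingMap.map_update_smul]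
    cont := by
      refine μ.cont.comp (continuous_pi fun a => ?_)
      rcases h' : e a with b | b
      · simpa [h'] using continuous_const
      · simpa [h'] using continuous_apply b
    map_eq_zero_of_eq' := by
      intro v i j hij hne
      refine μ.map_eq_zero_of_eq _ (i := e.symm (Sum.inr i)) (j := e.symm (Sum.inr j)) ?_ ?_
      · simpa using hij
      · simpa using hne }

/-- The `V`-valued form `α ⊗ v`. -/
def tensor (α : Model n [⋀^Fin k]→L[ℝ] ℝ) (v : V) : Model n [⋀^Fin k]→L[ℝ] V :=
  (ContinuousLinearMap.toSpanSingleton ℝ v).compContinuousAlternatingMap α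

/-- The Hodge star `* : Λᵏ → Λˡ`, `k + l = 2n`, with the convention `α ∧ *β = ⟨α, β⟩ vol`:
`(*β)(v) = (1/k!) ∑_I β(e_I) vol(e^I, v)`, the sum running over all multi-indices
`I = (i_1, …, i_k)`. -/
def hodgeStar (S : SymplecticRiemannian n M) (h : k + l = 2 * n) (x : M)
    (β : Model n [⋀^Fin k]→L[ℝ] V) : Model n [⋀^Fin l]→L[ℝ] V :=
  ((k.factorial : ℝ)⁻¹) • ∑ I : Fin k → Fin (2 * n),
    tensor (contractFirst h (volForm S x) fun a => coframe S.metric x (I a))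
      (β fun a => frame (n := n) (I a))

/-- The metric pairing of a real 2-form with the symplectic form, `V`-valued version: this is
`Λ = L^*`, the adjoint of `L = ω ∧ -`, on 2-forms:
`Λα = (1/2) ∑_{i,j} ω(e_i, e_j) α(e^i, e^j)`. -/
def dualLefschetz (S : SymplecticRiemannian n M) (x : M) (α : Model n [⋀^Fin 2]→L[ℝ] V) : V :=
  (2 : ℝ)⁻¹ • ∑ i, ∑ j, S.symp.toForm x ![frame (n := n) i, frame (n := n) j] •
    α ![coframe S.metric x i, coframe S.metric x j]

/-- The projection `Π` of a 2-form to its primitive component.  In the Lefschetz decomposition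
`α = α_p + Φ ω` with `Λ α_p = 0`, one has `Φ = Λα / Λω` (and `Λω = n`). -/
def primitivePart (S : SymplecticRiemannian n M) (x : M) (α : Model n [⋀^Fin 2]→L[ℝ] V) :
    Model n [⋀^Fin 2]→L[ℝ] V :=
  α - tensor (S.symp.toForm x) ((dualLefschetz S x (S.symp.toForm x))⁻¹ • dualLefschetz S x α)

end PointwiseAlgebra

/-! ### Integration -/

section Integration

variable {n : ℕ} {M : Type*} [TopologicalSpace M] [ChartedSpace (Model n) M]
  [IsManifold (𝓡 (2 * n)) ∞ M]

/-- The density `√(det g_ij)` of the metric in the coordinates of the chart centred at `c`. -/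
def chartDensity (g : Metric n M) (c : M) (y : Model n) : ℝ :=
  let p : M := (extChartAt (𝓡 (2 * n)) c).symm y
  let T : Model n →L[ℝ] Model n := tangentCoordChange (𝓡 (2 * n)) c p p
  √(Matrix.det (Matrix.of fun i j => metricAt g p (T (frame (n := n) i)) (T (frame (n := n) j))))

variable [T2Space M] [CompactSpace M]

variable (n M) in
/-- A smooth partition of unity subordinate to the cover by the domains of the charts. -/
def chartPartition : SmoothPartitionOfUnity M (𝓡 (2 * n)) M Set.univ :=
  Classical.choose (SmoothPartitionOfUnity.exists_isSubordinate_chartAt_source (𝓡 (2 * n)) M)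

/-- The integral `∫_M f dvol_g` against the Riemannian volume on a compact manifold, by a
partition of unity (its value on continuous functions does not depend on the partition). -/
def integral (g : Metric n M) (f : M → ℝ) : ℝ :=
  ∑ᶠ c : M, ∫ y in (extChartAt (𝓡 (2 * n)) c).target,
    chartPartition n M c ((extChartAt (𝓡 (2 * n)) c).symm y) *
      f ((extChartAt (𝓡 (2 * n)) c).symm y) * chartDensity g c y

end Integration

/-! ### The structure group

The Lie algebra `𝔤 = T_1 G` of `G` is by definition the model space `EG` of `G`, with Mathlib's
bracket of left-invariant vector fields. -/

section LieGroup

variable {EG : Type*} [NormedAddCommGroup EG] [NormedSpace ℝ EG] [FiniteDimensional ℝ EG]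
  {G : Type*} [TopologicalSpace G] [ChartedSpace EG G] [Group G]

variable (G) in
/-- The Lie bracket of `𝔤`, as a continuous bilinear map. -/
def bracket [LieGroup 𝓘(ℝ, EG) ∞ G] : EG →L[ℝ] EG →L[ℝ] EG :=
  haveI : CompleteSpace EG := FiniteDimensional.complete ℝ EG
  haveI : LieGroup 𝓘(ℝ, EG) (minSmoothness ℝ 3) G :=
    LieGroup.of_le (n := ∞) (by simpa using WithTop.coe_le_coe.2 (le_top : (3 : ℕ∞) ≤ ⊤))
  let br : GroupLieAlgebra 𝓘(ℝ, EG) G →ₗ[ℝ] GroupLieAlgebra 𝓘(ℝ, EG) G →ₗ[ℝ]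
      GroupLieAlgebra 𝓘(ℝ, EG) G :=
    LinearMap.mk₂ ℝ (fun u v => ⁅u, v⁆) add_lie smul_lie lie_add (fun c u v => lie_smul c u v)
  let br' : EG →ₗ[ℝ] EG →ₗ[ℝ] EG := br
  LinearMap.toContinuousLinearMap
    ((LinearMap.toContinuousLinearMap : (EG →ₗ[ℝ] EG) ≃ₗ[ℝ] (EG →L[ℝ] EG)).toLinearMap ∘ₗ br')

/-- The adjoint representation: the derivative at `1` of `h ↦ g h g⁻¹`. -/
def Ad (g : G) : EG →L[ℝ] EG :=
  mfderiv 𝓘(ℝ, EG) 𝓘(ℝ, EG) (fun h : G => g * h * g⁻¹) 1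

/-- The left logarithmic derivative `g⁻¹ dg` at `x` of a `G`-valued function `g`: the derivative at
`x` of `y ↦ g(x)⁻¹ g(y)`. -/
def leftLogDeriv {n : ℕ} {M : Type*} [TopologicalSpace M] [ChartedSpace (Model n) M]
    (g : M → G) (x : M) : Model n →L[ℝ] EG :=
  mfderiv (𝓡 (2 * n)) 𝓘(ℝ, EG) (fun y => (g x)⁻¹ * g y) x

variable (EG G) in
/-- An `Ad`-invariant inner product on `𝔤`. -/
structure AdInvariantInner where
  form : EG →L[ℝ] EG →L[ℝ] ℝ
  symm : ∀ u v, form u v = form v u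
  pos : ∀ u, u ≠ 0 → 0 < form u u
  ad_invariant : ∀ (g : G) (u v : EG), form (Ad g u) (Ad g v) = form u v

end LieGroup

/-! ### Principal bundles, connections, and forms with values in the adjoint bundle -/

section Bundles

variable (n : ℕ) (M : Type*) [TopologicalSpace M] [ChartedSpace (Model n) M]
  [IsManifold (𝓡 (2 * n)) ∞ M]
  (EG : Type*) [NormedAddCommGroup EG] [NormedSpace ℝ EG]
  (G : Type*) [TopologicalSpace G] [ChartedSpace EG G] [Group G]

/-- A smooth principal `G`-bundle over `M`, given (as in Mathlib's `FiberBundleCore`) by an open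
cover `U_i` and a smooth cocycle `g_ij : U_i ∩ U_j → G`; the bundle has local sections `s_i` over
`U_i` with `s_j = s_i g_ij`. -/
structure PrincipalBundle where
  ι : Type*
  baseSet : ι → Set M
  isOpen_baseSet : ∀ i, IsOpen (baseSet i)
  indexAt : M → ι
  mem_baseSet_at : ∀ x, x ∈ baseSet (indexAt x)
  transition : ι → ι → M → G
  smooth_transition : ∀ i j, ContMDiffOn (𝓡 (2 * n)) 𝓘(ℝ, EG) ∞ (transition i j)
    (baseSet i ∩ baseSet j)
  cocycle : ∀ i j k, ∀ x ∈ baseSet i ∩ baseSet j ∩ baseSet k,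
    transition i j x * transition j k x = transition i k x

variable {n M EG G}

/-- A family of local `𝔤`-valued `k`-forms `η_i`, one for each trivialising set `U_i`.  Only the
values of `η_i` on `U_i` are meaningful. -/
abbrev PrincipalBundle.LocalForms (P : PrincipalBundle n M EG G) (k : ℕ) : Type _ :=
  P.ι → M → Model n [⋀^Fin k]→L[ℝ] EG

variable {P : PrincipalBundle n M EG G} {k l : ℕ}

/-- The local expressions of a smooth `k`-form on `M` with values in `Ad P`: smooth `𝔤`-valued
forms with `η_j = Ad(g_ij⁻¹) η_i` on overlaps. -/
structure IsAdForm (η : P.LocalForms k) : Prop where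
  smooth : ∀ i, IsSmoothFormOn (P.baseSet i) (η i)
  gauge : ∀ i j, ∀ x ∈ P.baseSet i ∩ P.baseSet j, ∀ v,
    η j x v = Ad (P.transition i j x)⁻¹ (η i x v)

variable (P k) in
/-- `Ωᵏ(M, Ad P)`. -/
structure AdForm where
  form : P.LocalForms k
  isAdForm : IsAdForm form

variable (P) in
/-- A smooth connection on `P`, by its local connection 1-forms `A_i = s_i^* A`, which satisfy
`A_j = Ad(g_ij⁻¹) A_i + g_ij⁻¹ dg_ij` on overlaps. -/
structure Connection where
  form : P.LocalForms 1
  smooth : ∀ i, IsSmoothFormOn (P.baseSet i) (form i)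
  gauge : ∀ i j, ∀ x ∈ P.baseSet i ∩ P.baseSet j, ∀ v : Model n,
    form j x (fun _ => v) = Ad (P.transition i j x)⁻¹ (form i x (fun _ => v)) +
      leftLogDeriv (P.transition i j) x v

theorem inChart_add {c : M} (η ζ : M → Model n [⋀^Fin k]→L[ℝ] EG) :
    inChart c (η + ζ) = inChart c η + inChart c ζ := by
  ext y v
  simp [inChart]

theorem inChart_smul {c : M} (t : ℝ) (η : M → Model n [⋀^Fin k]→L[ℝ] EG) :
    inChart c (t • η) = t • inChart c η := by
  ext y v
  simp [inChart]

/-- The form `t η`. -/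
def AdForm.scale (t : ℝ) (η : AdForm P k) : AdForm P k where
  form := t • η.form
  isAdForm :=
    { smooth := fun i c => by
        rw [Pi.smul_apply, inChart_smul]
        exact (η.isAdForm.smooth i c).const_smul t
      gauge := fun i j x hx v => by
        rw [Pi.smul_apply, Pi.smul_apply, Pi.smul_apply, Pi.smul_apply,
          ContinuousAlternatingMap.smul_apply, ContinuousAlternatingMap.smul_apply,
          η.isAdForm.gauge i j x hx v, map_smul] }

/-- The connection `A + η`, for `η ∈ Ω¹(M, Ad P)`. -/
def Connection.translate (A : Connection P) (η : AdForm P 1) : Connection P where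
  form := A.form + η.form
  smooth i c := by
    rw [Pi.add_apply, inChart_add]
    exact (A.smooth i c).add (η.isAdForm.smooth i c)
  gauge i j x hx v := by
    have h1 := A.gauge i j x hx v
    have h2 := η.isAdForm.gauge i j x hx (fun _ => v)
    rw [Pi.add_apply, Pi.add_apply, Pi.add_apply, Pi.add_apply,
      ContinuousAlternatingMap.add_apply, ContinuousAlternatingMap.add_apply, map_add]
    calc _ = _ + _ := congrArg₂ (· + ·) h1 h2
      _ = _ := by abel

variable [FiniteDimensional ℝ EG] [LieGroup 𝓘(ℝ, EG) ∞ G]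

variable (G) in
/-- `[a ∧ β]` for a `𝔤`-valued 1-form `a` and `k`-form `β`:
`[a ∧ β](v_0, …, v_k) = ∑ᵢ (-1)ⁱ [a(v_i), β(v_0, …, v̂_i, …, v_k)]`. -/
def wedgeBracket (a : Model n [⋀^Fin 1]→L[ℝ] EG) (β : Model n [⋀^Fin k]→L[ℝ] EG) :
    Model n [⋀^Fin (k + 1)]→L[ℝ] EG :=
  let adβ : EG →L[ℝ] Model n [⋀^Fin k]→L[ℝ] EG :=
    ((ContinuousLinearMap.compContinuousAlternatingMapCLM ℝ (Model n) EG EG (Fin k)).flip β) ∘L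
      bracket G
  let a' : Model n →L[ℝ] EG :=
    (ContinuousAlternatingMap.ofSubsingleton ℝ (Model n) EG (0 : Fin 1)).symm a
  ContinuousAlternatingMap.alternatizeUncurryFin (adβ ∘L a')

variable (G) in
/-- `[β ∧ a]` for a `k`-form `β` and a 1-form `a`, by graded antisymmetry:
`[β ∧ a] = (-1)ᵏ⁺¹ [a ∧ β]`. -/
def wedgeBracketRight (β : Model n [⋀^Fin k]→L[ℝ] EG) (a : Model n [⋀^Fin 1]→L[ℝ] EG) :
    Model n [⋀^Fin (k + 1)]→L[ℝ] EG :=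
  (-1 : ℝ) ^ (k + 1) • wedgeBracket G a β

/-- The covariant exterior derivative `d_A η = dη + [A ∧ η]`. -/
def covDer (A : Connection P) (η : P.LocalForms k) : P.LocalForms (k + 1) := fun i x =>
  extDer (η i) x + wedgeBracket G (A.form i x) (η i x)

/-- The curvature `F = dA + (1/2) [A ∧ A]`. -/
def curvature (A : Connection P) : P.LocalForms 2 := fun i x =>
  extDer (A.form i) x + (2 : ℝ)⁻¹ • wedgeBracket G (A.form i x) (A.form i x)

variable (S : SymplecticRiemannian n M)

/-- The Hodge star on forms with values in `Ad P`. -/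
def star (h : k + l = 2 * n) (η : P.LocalForms k) : P.LocalForms l := fun i x =>
  hodgeStar S h x (η i x)

/-- `d_A^* = - * d_A *` on `(k+1)`-forms with values in `Ad P`. -/
def covCoder (h : k + 1 + l = 2 * n) (A : Connection P) (η : P.LocalForms (k + 1)) :
    P.LocalForms k :=
  -star S (show l + 1 + k = 2 * n by omega) (covDer A (star S h η))

/-- The projection `Π` to primitive 2-forms with values in `Ad P`. -/
def primitive (η : P.LocalForms 2) : P.LocalForms 2 := fun i x => primitivePart S x (η i x)

/-- The primitive component `F_p` of the curvature. -/
def primitiveCurvature (A : Connection P) : P.LocalForms 2 := primitive S (curvature A)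

/-- `∂_{+A}` on 1-forms: the primitive component of `d_A η`. -/
def partialPlus (A : Connection P) (η : P.LocalForms 1) : P.LocalForms 2 :=
  primitive S (covDer A η)

/-- The operator `(L_p)_A η = d_A^* ∂_{+A} η + *[*F_p ∧ η]` on 1-forms with values in `Ad P`. -/
def Lp (hn : 2 ≤ n) (A : Connection P) (η : P.LocalForms 1) : P.LocalForms 1 :=
  covCoder S (show 1 + 1 + (2 * n - 2) = 2 * n by omega) A (partialPlus S A η) +
  star S (show 2 * n - 2 + 1 + 1 = 2 * n by omega) (fun i x =>
    wedgeBracketRight G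
      (star S (show 2 + (2 * n - 2) = 2 * n by omega) (primitiveCurvature S A) i x) (η i x))

/-! ### The primitive Yang–Mills functional -/

/-- The pointwise inner product `⟨α, β⟩ = (1/k!) ∑_I ⟨α(e_I), β(e^I)⟩` of `𝔤`-valued `k`-forms. -/
def pointInner (B : AdInvariantInner EG G) (x : M) (α β : Model n [⋀^Fin k]→L[ℝ] EG) : ℝ :=
  ((k.factorial : ℝ)⁻¹) * ∑ I : Fin k → Fin (2 * n),
    B.form (α fun a => frame (n := n) (I a)) (β fun a => coframe S.metric x (I a))

variable [T2Space M] [CompactSpace M] (B : AdInvariantInner EG G)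

/-- The `L²` inner product on `Ωᵏ(M, Ad P)`.  By `Ad`-invariance, the integrand does not depend on
the trivialisation in which it is computed. -/
def innerL2 (α β : P.LocalForms k) : ℝ :=
  integral S.metric fun x => pointInner S B x (α (P.indexAt x) x) (β (P.indexAt x) x)

/-- The primitive Yang–Mills functional `‖F_p(A)‖²`. -/
def functional (A : Connection P) : ℝ :=
  innerL2 S B (primitiveCurvature S A) (primitiveCurvature S A)

/-- The first variation of the functional at `A` in direction `ζ` is `c`:
`d/ds ‖F_p(A + s ζ)‖² = c` at `s = 0`. -/
def HasFirstVariation (A : Connection P) (ζ : AdForm P 1) (c : ℝ) : Prop :=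
  HasDerivAt (fun s : ℝ => functional S B (A.translate (ζ.scale s))) c 0

/-- Primitive Yang–Mills connections: the critical points of the functional. -/
def IsPrimitiveYangMills (A : Connection P) : Prop :=
  ∀ ζ : AdForm P 1, HasFirstVariation S B A ζ 0

/-- The second variation at `A` in the directions `η`, `ζ` is `q`:
`d/dt d/ds ‖F_p(A + t η + s ζ)‖² = q` at `s = t = 0`. -/
def HasSecondVariation (A : Connection P) (η ζ : AdForm P 1) (q : ℝ) : Prop :=
  ∃ f : ℝ → ℝ, (∀ t, HasFirstVariation S B (A.translate (η.scale t)) ζ (f t)) ∧ HasDerivAt f q 0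

/-- A path `A_t` of connections that is smooth in `(t, x)`. -/
def IsSmoothPath (𝒜 : ℝ → Connection P) : Prop :=
  ∀ i (c : M), ContDiffOn ℝ ∞ (fun p : ℝ × Model n => inChart c ((𝒜 p.1).form i) p.2)
    (Set.univ ×ˢ chartDomain c (P.baseSet i))

/-- `η` is a (Zariski) tangent vector at `A` to the space of primitive Yang–Mills connections, the
space of solutions of the equations "the first variation in each direction `ζ` vanishes": there is
a smooth path `A_t = A + t η + o(t)` of connections that solves these equations to first order,
i.e. up to `o(t)`. -/
def IsTangent (A : Connection P) (η : AdForm P 1) : Prop :=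
  ∃ 𝒜 : ℝ → Connection P, IsSmoothPath 𝒜 ∧ 𝒜 0 = A ∧
    (∀ i, ∀ x ∈ P.baseSet i, HasDerivAt (fun t => (𝒜 t).form i x) (η.form i x) 0) ∧
    ∀ ζ : AdForm P 1, ∃ f : ℝ → ℝ, (∀ t, HasFirstVariation S B (𝒜 t) ζ (f t)) ∧
      f =o[nhds 0] (fun t : ℝ => t)

end Bundles

end PYM

end

/-!
# The Hessian of the primitive Yang–Mills functional

**First and second variation.** Let `𝒜_t` be a smooth path of connections through `A` with
velocity `η`. At `t = 0` the curvature has derivative `d_A η`, hence `F_p` has derivative `∂₊η`,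
and, for a fixed 1-form `ζ`, `∂₊ζ = Π(d_{𝒜_t} ζ)` has derivative `Π[η ∧ ζ]`. Differentiating
`‖F_p‖²` under the integral sign gives the first variation `2⟨F_p, ∂₊ζ⟩` (`hasFirstVariation`), and
differentiating that along `𝒜_t` gives
`2(⟨∂₊η, ∂₊ζ⟩ + ⟨F_p, Π[η ∧ ζ]⟩) = 2⟨L_p η, ζ⟩` (`HasVelocity.hasDerivAt_firstVariation`,
`innerL2_Lp`). The last equality uses three facts: `Π` is an orthogonal projection
(`pairAt_primAt_right`); `d_A^*` is the formal adjoint of `d_A` (`innerL2_covDer`); and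
`⟨F_p, [η ∧ ζ]⟩ = ⟨*[*F_p ∧ η], ζ⟩` pointwise (`pointInner_wedgeBracket`), because `ad` is skew for an
`Ad`-invariant inner product (`AdInvariantInner.bracket_left`).

**Tangency.** The derivative of the first variation along a path through `A` depends only on the
velocity `η`, and at the critical point `A` the first variation itself is zero. So the first
variation in the direction `ζ` is `o(t)` along the path exactly when `⟨L_p η, ζ⟩ = 0`. Taking
`ζ = L_p η` and using nondegeneracy of the `L²` inner product (`eq_zero_of_innerL2_self`) gives
`L_p η = 0`; conversely, if `L_p η = 0`, the path `A + tη` shows that `η` is tangent.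

**Analysis.** Integrals over `M` are defined by charts and a partition of unity.
The adjointness of `d_A` and `d_A^*` is the divergence theorem (`integral_divergence`) for the
globally defined form `⟨α ∧ *β⟩`, whose exterior derivative is computed by the covariant Leibniz
rule (`extDer_wedgeForm_hodgeStar`). The pointwise identities behind that rule, `κ ∧ *β = ⟨κ, β⟩ vol`
and `α ∧ δ = -⟨α, *δ⟩ vol` (`wedgeTwo_starAt`, `wedgeOne_eq_neg_pairAt`), follow by expanding in dual
frames: forms of top degree are determined by one value, and forms beyond top degree vanish.

**Gauge covariance.** That `F`, `d_A` and therefore `L_p` produce forms with values in `Ad P`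
(`isAdForm_curvature`, `IsAdForm.covDer`, `IsAdForm.Lp`) rests on the Maurer–Cartan equation for
`γ⁻¹ dγ` (`fderiv_logDeriv_sub`), on the formula `d(Ad(γ⁻¹)) = -ad(γ⁻¹ dγ) ∘ Ad(γ⁻¹)`
(`fderiv_Ad_inv_comp`) and on `Ad` being an automorphism of the bracket (`Ad_bracket`). All three are
derived from the Maurer–Cartan form in the chart at the identity.
-/

noncomputable section

namespace PYM

/-! ### Alternating maps and wedge products with a 1-form -/

section Wedge

open ContinuousAlternatingMap

variable {E : Type*} [NormedAddCommGroup E] [NormedSpace ℝ E]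
  {U V W X : Type*} [NormedAddCommGroup U] [NormedSpace ℝ U]
  [NormedAddCommGroup V] [NormedSpace ℝ V]
  [NormedAddCommGroup W] [NormedSpace ℝ W] [NormedAddCommGroup X] [NormedSpace ℝ X] {k l : ℕ}

/-- The bilinear map `(x, γ) ↦ b(x, γ(·))` from vectors and forms to forms. -/
def pairForm (b : V →L[ℝ] W →L[ℝ] X) (k : ℕ) : V →L[ℝ] E [⋀^Fin k]→L[ℝ] W →L[ℝ] E [⋀^Fin k]→L[ℝ] X :=
  (ContinuousLinearMap.compContinuousAlternatingMapCLM ℝ E W X (Fin k)) ∘L b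

/-- The wedge product `b(α ∧ γ)` of a 1-form and a `k`-form along a bilinear pairing `b`. -/
def wedgeOne (b : V →L[ℝ] W →L[ℝ] X) (α : E →L[ℝ] V) (γ : E [⋀^Fin k]→L[ℝ] W) :
    E [⋀^Fin (k + 1)]→L[ℝ] X :=
  alternatizeUncurryFin ((pairForm b k).flip γ ∘L α)

theorem wedgeOne_apply (b : V →L[ℝ] W →L[ℝ] X) (α : E →L[ℝ] V) (γ : E [⋀^Fin k]→L[ℝ] W)
    (v : Fin (k + 1) → E) :
    wedgeOne b α γ v = ∑ i : Fin (k + 1), (-1 : ℝ) ^ (i : ℕ) • b (α (v i)) (γ (i.removeNth v)) := by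
  rw [wedgeOne, alternatizeUncurryFin_apply]
  refine Finset.sum_congr rfl fun i _ => ?_
  rw [← Int.cast_smul_eq_zsmul ℝ]
  push_cast
  rfl

/-- The `(k+2)`-form `b(κ ∧ γ)` for a bilinear form `κ` (only the antisymmetric part matters),
namely the double alternatization of `b(κ(v, w), γ)`. -/
def wedgeTwo (b : V →L[ℝ] W →L[ℝ] X) (κ : E →L[ℝ] E →L[ℝ] V) (γ : E [⋀^Fin k]→L[ℝ] W) :
    E [⋀^Fin (k + 1 + 1)]→L[ℝ] X :=
  alternatizeUncurryFin (alternatizeUncurryFinCLM ℝ E X ∘L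
    ((ContinuousLinearMap.compL ℝ E V (E [⋀^Fin k]→L[ℝ] X)) ((pairForm b k).flip γ) ∘L κ))

theorem wedgeTwo_apply (b : V →L[ℝ] W →L[ℝ] X) (κ : E →L[ℝ] E →L[ℝ] V) (γ : E [⋀^Fin k]→L[ℝ] W)
    (v : Fin (k + 1 + 1) → E) :
    wedgeTwo b κ γ v = ∑ i : Fin (k + 1 + 1), (-1 : ℝ) ^ (i : ℕ) •
      wedgeOne b (κ (v i)) γ (i.removeNth v) := by
  rw [wedgeTwo, alternatizeUncurryFin_apply]
  refine Finset.sum_congr rfl fun i _ => ?_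
  rw [← Int.cast_smul_eq_zsmul ℝ]
  push_cast
  rfl

/-- Double alternatization is antisymmetric in the two alternated arguments. -/
theorem alternatize_twice_flip (f : E →L[ℝ] E →L[ℝ] E [⋀^Fin k]→L[ℝ] X) :
    alternatizeUncurryFin (alternatizeUncurryFinCLM ℝ E X ∘L f) =
      -alternatizeUncurryFin (alternatizeUncurryFinCLM ℝ E X ∘L f.flip) := by
  rw [eq_neg_iff_add_eq_zero, ← alternatizeUncurryFin_add, ← ContinuousLinearMap.comp_add]
  refine alternatizeUncurryFin_alternatizeUncurryFinCLM_comp_of_symmetric fun x y => ?_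
  simp [add_comm]

/-- Evaluation of a form whose degree has been cast along an equation of natural numbers. -/
theorem map_comp_castForm {a b : ℕ} (h : a = b) (μ : E [⋀^Fin a]→L[ℝ] V) (v : Fin b → E) :
    (h ▸ μ : E [⋀^Fin b]→L[ℝ] V) v = μ (v ∘ Fin.cast h) := by
  subst h; rfl

/-- The expansion of `ψ ∧ μ = 0` for a 1-form `ψ` and a form `μ` of top degree `d`. -/
theorem sum_removeNth_smul_eq_zero [FiniteDimensional ℝ E] {d : ℕ} (hd : Module.finrank ℝ E = d)
    (μ : E [⋀^Fin d]→L[ℝ] ℝ) (ψ : E →L[ℝ] X) (v : Fin (d + 1) → E) :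
    ∑ i : Fin (d + 1), (-1 : ℝ) ^ (i : ℕ) • μ (i.removeNth v) • ψ (v i) = 0 := by
  let b : X →L[ℝ] ℝ →L[ℝ] X := (ContinuousLinearMap.lsmul ℝ ℝ).flip
  have h : wedgeOne b ψ μ v = 0 := by
    refine (wedgeOne b ψ μ).toAlternatingMap.map_linearDependent v fun hv => ?_
    have := hv.fintype_card_le_finrank
    simp [hd] at this
  rw [wedgeOne_apply] at h
  exact h

end Wedge

/-! ### Metrics and the Hodge star at a point -/

section Pointwise

variable {n : ℕ} {U V W X : Type*} [NormedAddCommGroup U] [NormedSpace ℝ U]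
  [NormedAddCommGroup V] [NormedSpace ℝ V]
  [NormedAddCommGroup W] [NormedSpace ℝ W] [NormedAddCommGroup X] [NormedSpace ℝ X] {k l : ℕ}

/-- `g` is an inner product on the model space. -/
structure IsInner (g : Model n →L[ℝ] Model n →L[ℝ] ℝ) : Prop where
  symm : ∀ u v, g u v = g v u
  pos : ∀ u, u ≠ 0 → 0 < g u u

/-- The pullback of a bilinear form under a linear map. -/
def pullInner (T : Model n →L[ℝ] Model n) (g : Model n →L[ℝ] Model n →L[ℝ] ℝ) :
    Model n →L[ℝ] Model n →L[ℝ] ℝ :=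
  (ContinuousLinearMap.compL ℝ (Model n) (Model n) ℝ).flip T ∘L g ∘L T

@[simp] theorem pullInner_apply (T : Model n →L[ℝ] Model n) (g : Model n →L[ℝ] Model n →L[ℝ] ℝ)
    (u v : Model n) : pullInner T g u v = g (T u) (T v) := rfl

theorem IsInner.pull {g : Model n →L[ℝ] Model n →L[ℝ] ℝ} (hg : IsInner g)
    {T : Model n →L[ℝ] Model n} (hT : Function.Injective T) : IsInner (pullInner T g) where
  symm u v := hg.symm _ _
  pos u hu := hg.pos _ fun h => hu (hT (by simpa using h))

/-- The Gram matrix of `g` in the coordinate basis. -/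
def gramAt (g : Model n →L[ℝ] Model n →L[ℝ] ℝ) : Matrix (Fin (2 * n)) (Fin (2 * n)) ℝ :=
  Matrix.of fun i j => g (frame (n := n) i) (frame (n := n) j)

/-- The `g`-dual basis of the coordinate basis. -/
def coframeAt (g : Model n →L[ℝ] Model n →L[ℝ] ℝ) (i : Fin (2 * n)) : Model n :=
  ∑ j, (gramAt g)⁻¹ i j • frame (n := n) j

/-- The volume form of `g` with the orientation of the top form `o`. -/
def volAt (g : Model n →L[ℝ] Model n →L[ℝ] ℝ) (o : Model n [⋀^Fin (2 * n)]→L[ℝ] ℝ) :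
    Model n [⋀^Fin (2 * n)]→L[ℝ] ℝ :=
  (√(gramAt g).det / |o (frame (n := n))|) • o

/-- The Hodge star of the volume form `m` and the metric `g`. -/
def starAt (g : Model n →L[ℝ] Model n →L[ℝ] ℝ) (m : Model n [⋀^Fin (2 * n)]→L[ℝ] ℝ)
    (h : k + l = 2 * n) (β : Model n [⋀^Fin k]→L[ℝ] V) : Model n [⋀^Fin l]→L[ℝ] V :=
  ((k.factorial : ℝ)⁻¹) • ∑ I : Fin k → Fin (2 * n),
    tensor (contractFirst h m fun a => coframeAt g (I a)) (β fun a => frame (n := n) (I a))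

/-- The pairing of forms induced by the metric `g` and a pairing `b` of the coefficients. -/
def pairAt (g : Model n →L[ℝ] Model n →L[ℝ] ℝ) (b : V →L[ℝ] W →L[ℝ] X)
    (α : Model n [⋀^Fin k]→L[ℝ] V) (β : Model n [⋀^Fin k]→L[ℝ] W) : X :=
  ((k.factorial : ℝ)⁻¹) • ∑ I : Fin k → Fin (2 * n),
    b (α fun a => frame (n := n) (I a)) (β fun a => coframeAt g (I a))

theorem sum_apply_smul_frame (v : Model n) : ∑ i, v i • frame (n := n) i = v := by
  ext j
  simp [frame, Finset.sum_apply, Pi.single_apply]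

theorem posDef_gramAt {g : Model n →L[ℝ] Model n →L[ℝ] ℝ} (hg : IsInner g) :
    (gramAt g).PosDef := by
  refine Matrix.PosDef.of_dotProduct_mulVec_pos ?_ fun x hx => ?_
  · ext i j
    simp [gramAt, hg.symm]
  · have : Star.star x ⬝ᵥ (gramAt g).mulVec x =
        g (∑ i, x i • frame (n := n) i) (∑ i, x i • frame (n := n) i) := by
      simp [gramAt, dotProduct, Matrix.mulVec, Finset.mul_sum]
      refine Finset.sum_comm.trans (Finset.sum_congr rfl fun i _ => Finset.sum_congr rfl fun j _ => ?_)
      rw [hg.symm]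
      ring
    rw [this]
    refine hg.pos _ fun h => hx ?_
    have h2 := sum_apply_smul_frame (WithLp.toLp 2 x : Model n)
    simp only [] at h2
    rw [h] at h2
    ext i
    have := congrArg (fun v : Model n => v i) h2
    simpa using this.symm

theorem det_gramAt_pos {g : Model n →L[ℝ] Model n →L[ℝ] ℝ} (hg : IsInner g) :
    0 < (gramAt g).det := (posDef_gramAt hg).det_pos

theorem coframeAt_frame {g : Model n →L[ℝ] Model n →L[ℝ] ℝ} (hg : IsInner g)
    (i j : Fin (2 * n)) : g (coframeAt g i) (frame j) = if i = j then 1 else 0 := by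
  have h : ((gramAt g)⁻¹ * gramAt g) i j = (1 : Matrix _ _ ℝ) i j := by
    rw [Matrix.nonsing_inv_mul _ (det_gramAt_pos hg).ne'.isUnit]
  rw [Matrix.mul_apply, Matrix.one_apply] at h
  rw [← h]
  simp [coframeAt, gramAt]

/-- `f` and `f'` are `g`-dual bases, in the form of the expansion of vectors. -/
def IsDualFrame (g : Model n →L[ℝ] Model n →L[ℝ] ℝ) (f f' : Fin (2 * n) → Model n) : Prop :=
  ∀ v, ∑ i, g (f' i) v • f i = v

theorem isDualFrame_frame {g : Model n →L[ℝ] Model n →L[ℝ] ℝ} (hg : IsInner g) :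
    IsDualFrame g frame (coframeAt g) := by
  intro v
  conv_rhs => rw [← sum_apply_smul_frame v]
  refine Finset.sum_congr rfl fun i _ => ?_
  congr 1
  conv_lhs => rw [← sum_apply_smul_frame v]
  simp [coframeAt_frame hg]

theorem IsDualFrame.expand {g : Model n →L[ℝ] Model n →L[ℝ] ℝ} (hg : IsInner g)
    {f f' : Fin (2 * n) → Model n} (hf : IsDualFrame g f f') (v : Model n) :
    ∑ i, g v (f i) • f' i = v := by
  by_contra hne
  have hpos := hg.pos _ (sub_ne_zero.2 hne)
  refine hpos.ne' ?_
  set u := ∑ i, g v (f i) • f' i - v with hu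
  have key : ∀ w, g u w = 0 := fun w => by
    have : g v w = ∑ i, g (f' i) w * g v (f i) := by
      conv_lhs => rw [← hf w]
      simp
    rw [hu, map_sub, sub_apply, this]
    simp [mul_comm]
  exact key u

theorem IsDualFrame.map {g : Model n →L[ℝ] Model n →L[ℝ] ℝ} {T : Model n →L[ℝ] Model n}
    (hT : Function.Surjective T) {f f' : Fin (2 * n) → Model n}
    (hf : IsDualFrame (pullInner T g) f f') : IsDualFrame g (fun i => T (f i)) (fun i => T (f' i)) := by
  intro v
  obtain ⟨w, rfl⟩ := hT v
  conv_rhs => rw [← hf w]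
  simp

/-- A metric contraction does not depend on the pair of dual bases used to compute it. -/
theorem IsDualFrame.sum_eq {g : Model n →L[ℝ] Model n →L[ℝ] ℝ} (hg : IsInner g)
    {e e' f f' : Fin (2 * n) → Model n} (he : IsDualFrame g e e') (hf : IsDualFrame g f f')
    (b : Model n →ₗ[ℝ] Model n →ₗ[ℝ] X) : ∑ i, b (f i) (f' i) = ∑ i, b (e i) (e' i) := by
  have h1 : ∀ i, b (f i) (f' i) = ∑ k, g (f' i) (e k) • b (f i) (e' k) := fun i => by
    conv_lhs => rw [← he.expand hg (f' i)]
    simp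
  have h2 : ∀ k, b (e k) (e' k) = ∑ i, g (f' i) (e k) • b (f i) (e' k) := fun k => by
    conv_lhs => rw [← hf (e k)]
    simp [LinearMap.sum_apply]
  simp_rw [h1, h2]
  exact Finset.sum_comm

/-- The version of `IsDualFrame.sum_eq` for contractions over `k` indices at once. It makes the Hodge
star and the inner product of forms independent of the frame. -/
theorem IsDualFrame.sum_multi_eq {g : Model n →L[ℝ] Model n →L[ℝ] ℝ} (hg : IsInner g)
    {e e' f f' : Fin (2 * n) → Model n} (he : IsDualFrame g e e') (hf : IsDualFrame g f f')
    (b : V →ₗ[ℝ] W →ₗ[ℝ] X) (k : ℕ) (Φ : MultilinearMap ℝ (fun _ : Fin k => Model n) V)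
    (Ψ : MultilinearMap ℝ (fun _ : Fin k => Model n) W) :
    ∑ I : Fin k → Fin (2 * n), b (Φ fun a => f (I a)) (Ψ fun a => f' (I a)) =
      ∑ I : Fin k → Fin (2 * n), b (Φ fun a => e (I a)) (Ψ fun a => e' (I a)) := by
  induction k with
  | zero =>
    refine Finset.sum_congr rfl fun I _ => ?_
    congr 2 <;> congr 1 <;> exact Subsingleton.elim (α := Fin 0 → Model n) _ _
  | succ k ih =>
    have split : ∀ u u' : Fin (2 * n) → Model n,
        ∑ I : Fin (k + 1) → Fin (2 * n), b (Φ fun a => u (I a)) (Ψ fun a => u' (I a)) =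
        ∑ i, ∑ I : Fin k → Fin (2 * n),
          b (Φ.curryLeft (u i) fun a => u (I a)) (Ψ.curryLeft (u' i) fun a => u' (I a)) := by
      intro u u'
      rw [← Fintype.sum_prod_type', ← (Fin.consEquiv fun _ => Fin (2 * n)).sum_comp]
      refine Finset.sum_congr rfl fun p _ => ?_
      simp only [MultilinearMap.curryLeft_apply, Fin.consEquiv_apply]
      congr 2 <;> congr 1 <;> funext a <;> refine Fin.cases ?_ (fun a => ?_) a <;> simp
    rw [split, split]
    simp_rw [ih]
    rw [Finset.sum_comm, Finset.sum_comm (s := Finset.univ (α := Fin (2 * n)))]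
    refine Finset.sum_congr rfl fun I _ => ?_
    exact he.sum_eq hg hf (LinearMap.mk₂ ℝ (fun x y =>
        b (Φ.curryLeft x fun a => e (I a)) (Ψ.curryLeft y fun a => e' (I a)))
      (by simp) (by simp) (by simp) (by simp))

end Pointwise

/-! ### Contraction of top-degree forms -/

section Wedge

open ContinuousAlternatingMap
variable {E : Type*} [NormedAddCommGroup E] [NormedSpace ℝ E]
  {U V W X : Type*} [NormedAddCommGroup U] [NormedSpace ℝ U]
  [NormedAddCommGroup V] [NormedSpace ℝ V]
  [NormedAddCommGroup W] [NormedSpace ℝ W] [NormedAddCommGroup X] [NormedSpace ℝ X] {k l : ℕ}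

theorem removeNth_zero_vecCons (a : E) (v : Fin (k + 1) → E) :
    (0 : Fin (k + 2)).removeNth (Matrix.vecCons a v) = v := by
  funext i; simp [Fin.removeNth]

theorem removeNth_succ_vecCons (a : E) (v : Fin (k + 1) → E) (i : Fin (k + 1)) :
    i.succ.removeNth (Matrix.vecCons a v) = Matrix.vecCons a (i.removeNth v) := by
  funext j
  refine Fin.cases ?_ (fun j => ?_) j <;> simp [Fin.removeNth]

/-- The expansion of `ψ ∧ μ = 0` for a top degree form `μ`, with one argument singled out. -/
theorem sum_removeNth_smul_eq [FiniteDimensional ℝ E] (hd : Module.finrank ℝ E = k + 1)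
    (μ : E [⋀^Fin (k + 1)]→L[ℝ] ℝ) (ψ : E →L[ℝ] X) (a : E) (v : Fin (k + 1) → E) :
    ∑ i : Fin (k + 1), (-1 : ℝ) ^ (i : ℕ) • μ (Matrix.vecCons a (i.removeNth v)) • ψ (v i) =
      μ v • ψ a := by
  have h := sum_removeNth_smul_eq_zero hd μ ψ (Matrix.vecCons a v)
  rw [Fin.sum_univ_succ] at h
  simp only [removeNth_zero_vecCons, removeNth_succ_vecCons, Matrix.cons_val_zero,
    Matrix.cons_val_succ, Fin.val_succ, pow_succ, Fin.val_zero, pow_zero, one_smul, mul_neg,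
    mul_one, neg_smul, Finset.sum_neg_distrib] at h
  exact (add_neg_eq_zero.1 h).symm

/-- In a sum over all maps of indices only the permutations contribute, and the signs of the two
alternating factors cancel. -/
theorem sum_functions_eq_factorial_smul {ι : Type*} [Fintype ι] [DecidableEq ι]
    (μ : E [⋀^ι]→L[ℝ] ℝ) (ν : E [⋀^ι]→L[ℝ] X) (e c : ι → E) :
    ∑ J : ι → ι, μ (fun a => c (J a)) • ν (fun a => e (J a)) =
      ((Fintype.card ι).factorial : ℝ) • μ c • ν e := by
  have h : ∑ _σ : Equiv.Perm ι, μ c • ν e =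
      ∑ J : ι → ι, μ (fun a => c (J a)) • ν (fun a => e (J a)) := by
    refine Finset.sum_of_injOn (fun σ : Equiv.Perm ι => (σ : ι → ι)) (fun _ _ _ _ h => DFunLike.coe_injective h)
      (fun _ _ => Finset.mem_coe.2 (Finset.mem_univ _)) (fun J _ hJ => ?_) (fun σ _ => ?_)
    · have : ν (fun a => e (J a)) = 0 := by
        refine ν.toAlternatingMap.map_eq_zero_of_not_injective _ fun hinj => hJ ?_
        have hJ' : Function.Injective J := fun a b hab => hinj (by simp [hab])
        exact ⟨Equiv.ofBijective J (Finite.injective_iff_bijective.1 hJ'), by simp, rfl⟩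
      rw [this, smul_zero]
    · have h1 := μ.toAlternatingMap.map_perm c σ
      have h2 := ν.toAlternatingMap.map_perm e σ
      change μ (fun a => c (σ a)) = _ at h1
      change ν (fun a => e (σ a)) = _ at h2
      simp only [h1, h2]
      rcases Int.units_eq_one_or (Equiv.Perm.sign σ) with hs | hs <;> simp [hs]
  rw [← h]
  simp [Fintype.card_perm, Nat.cast_smul_eq_nsmul]

/-- `α ∧ δ` in top degree, as a multiple of a nonzero top-degree form `μ`. The coefficient is the
contraction of `α` and `δ` against `μ`; when `c` is the metric dual of `e` and `μ` the volume form,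
it is `-⟨α, *δ⟩`. -/
theorem wedgeOne_eq_of_top (hl : Even l) (b : V →L[ℝ] W →L[ℝ] X) (α : E →L[ℝ] V)
    (δ : E [⋀^Fin (l + 1)]→L[ℝ] W) (e : Module.Basis (Fin (l + 1 + 1)) ℝ E)
    (c : Fin (l + 1 + 1) → E) (μ : E [⋀^Fin (l + 1 + 1)]→L[ℝ] ℝ) (hμ : μ e * μ c = 1)
    (v : Fin (l + 1 + 1) → E) :
    wedgeOne b α δ v = -(μ v • (((l + 1).factorial : ℝ)⁻¹ • ∑ i, ∑ I : Fin (l + 1) → Fin (l + 1 + 1),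
      μ (Fin.snoc (α := fun _ => E) (fun a => c (I a)) (c i)) • b (α (e i)) (δ fun a => e (I a)))) := by
  set ν := wedgeOne b α δ with hν
  -- both sides are of top degree, so they agree once they agree on the basis `e`
  have hd : ν v = μ v • μ c • ν e := by
    let ν' : E [⋀^Fin (l + 1 + 1)]→L[ℝ] X :=
      ((ContinuousLinearMap.toSpanSingleton ℝ (μ c • ν e)).compContinuousAlternatingMap μ)
    have : ν.toAlternatingMap = ν'.toAlternatingMap := by
      refine e.ext_alternating fun s hs => ?_
      let σ := Equiv.ofBijective s (Finite.injective_iff_bijective.1 hs)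
      have h1 := μ.toAlternatingMap.map_perm e σ
      have h2 := ν.toAlternatingMap.map_perm e σ
      change μ (fun a => e (s a)) = _ • μ e at h1
      change ν (fun a => e (s a)) = _ • ν e at h2
      change ν (fun a => e (s a)) = μ (fun a => e (s a)) • μ c • ν e
      rw [h1, h2, smul_assoc, smul_smul, hμ, one_smul]
    exact congrArg (fun f => f v) this
  -- `μ c • ν e` is an average over all maps of indices; expanding `ν` there gives `l + 2` equal terms
  have hJ := sum_functions_eq_factorial_smul μ ν e c
  have hj : ∀ j : Fin (l + 1 + 1), ∑ J : Fin (l + 1 + 1) → Fin (l + 1 + 1),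
      μ (fun a => c (J a)) • (-1 : ℝ) ^ (j : ℕ) • b (α (e (J j))) (δ (j.removeNth fun a => e (J a))) =
      ∑ i, ∑ I : Fin (l + 1) → Fin (l + 1 + 1), μ (Matrix.vecCons (c i) fun a => c (I a)) •
        b (α (e i)) (δ fun a => e (I a)) := by
    intro j
    rw [← Fintype.sum_prod_type', ← (Fin.insertNthEquiv (fun _ => Fin (l + 1 + 1)) j).sum_comp]
    refine Finset.sum_congr rfl fun p _ => ?_
    have h1 : (fun a => c ((Fin.insertNthEquiv (fun _ => Fin (l + 1 + 1)) j) p a)) =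
        j.insertNth (α := fun _ => E) (c p.1) (fun a => c (p.2 a)) := by
      funext a
      refine Fin.succAboveCases j ?_ (fun a => ?_) a <;> simp [Fin.insertNthEquiv]
    have h2 : (j.removeNth fun a => e ((Fin.insertNthEquiv (fun _ => Fin (l + 1 + 1)) j) p a)) =
        fun a => e (p.2 a) := by
      funext a
      simp [Fin.removeNth, Fin.insertNthEquiv]
    have h3 := μ.map_insertNth j (c p.1) (fun a => c (p.2 a))
    rw [h1, h2, h3]
    simp only [Fin.insertNthEquiv, Equiv.coe_fn_mk, Fin.insertNth_apply_same]
    rcases neg_one_pow_eq_or ℤ (j : ℕ) with hs | hs <;>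
      rcases Nat.even_or_odd (j : ℕ) with hs' | hs' <;> simp [hs'.neg_one_pow]
  have hsum : (∑ J : Fin (l + 1 + 1) → Fin (l + 1 + 1), μ (fun a => c (J a)) • ν (fun a => e (J a))) =
      ((l + 1 + 1 : ℕ) : ℝ) • ∑ i, ∑ I : Fin (l + 1) → Fin (l + 1 + 1),
        μ (Matrix.vecCons (c i) fun a => c (I a)) • b (α (e i)) (δ fun a => e (I a)) := by
    simp only [hν, wedgeOne_apply, Finset.smul_sum (r := μ _)]
    rw [Finset.sum_comm]
    simp_rw [hj]
    rw [Finset.sum_const, Finset.card_univ, Fintype.card_fin, Nat.cast_smul_eq_nsmul]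
  -- moving the last argument past an odd number `l + 1` of others changes the sign
  have hsnoc : ∀ (i : Fin (l + 1 + 1)) (I : Fin (l + 1) → Fin (l + 1 + 1)),
      μ (Fin.snoc (α := fun _ => E) (fun a => c (I a)) (c i)) =
        -μ (Matrix.vecCons (c i) fun a => c (I a)) := by
    intro i I
    have h3 := μ.map_insertNth (Fin.last _) (c i) (fun a => c (I a))
    rw [Fin.insertNth_last'] at h3
    rw [h3]
    simp [pow_succ, hl.neg_one_pow]
  rw [hd]
  rw [hsum, Fintype.card_fin, Nat.factorial_succ, Nat.cast_mul, ← smul_smul] at hJ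
  have hne : ((l + 1 + 1 : ℕ) : ℝ) ≠ 0 := by positivity
  have hJ' := smul_right_injective _ hne hJ
  have hf : ((l + 1).factorial : ℝ) ≠ 0 := by positivity
  simp only [hsnoc, neg_smul, Finset.sum_neg_distrib, smul_neg, neg_neg]
  rw [hJ', smul_smul ((_ : ℝ)⁻¹), inv_mul_cancel₀ hf, one_smul]

end Wedge

/-! ### Volume form, Hodge star and frame changes -/

section Pointwise
open ContinuousAlternatingMap (compContinuousLinearMap_apply ofSubsingleton)
variable {n : ℕ} {U V W X : Type*} [NormedAddCommGroup U] [NormedSpace ℝ U]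
  [NormedAddCommGroup V] [NormedSpace ℝ V]
  [NormedAddCommGroup W] [NormedSpace ℝ W] [NormedAddCommGroup X] [NormedSpace ℝ X] {k l : ℕ}

@[simp] theorem finrank_model : Module.finrank ℝ (Model n) = 2 * n := by simp [Model]

/-- The standard basis of the model space. -/
def frameBasis (n : ℕ) : Module.Basis (Fin (2 * n)) ℝ (Model n) :=
  (EuclideanSpace.basisFun (Fin (2 * n)) ℝ).toBasis

theorem coe_frameBasis : ⇑(frameBasis n) = frame := by
  funext i
  simp [frameBasis, frame]

theorem map_comp_eq_det_smul (o : Model n [⋀^Fin (2 * n)]→L[ℝ] ℝ) (T : Model n →L[ℝ] Model n)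
    (v : Fin (2 * n) → Model n) :
    o (fun i => T (v i)) = LinearMap.det (T : Model n →ₗ[ℝ] Model n) * o v := by
  have h := o.toAlternatingMap.eq_smul_basis_det (frameBasis n)
  have h1 := congrArg (fun f => f (fun i => T (v i))) h
  have h2 := congrArg (fun f => f v) h
  have h3 := (frameBasis n).det_comp (T : Model n →ₗ[ℝ] Model n) v
  simp only [AlternatingMap.smul_apply, smul_eq_mul] at h1 h2
  change o _ = _ * (frameBasis n).det ((T : Model n →ₗ[ℝ] Model n) ∘ v) at h1
  change o _ = _ at h2
  rw [h1, h2, h3]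
  ring

theorem map_frame_ne_zero {o : Model n [⋀^Fin (2 * n)]→L[ℝ] ℝ} (ho : o ≠ 0) :
    o (frame (n := n)) ≠ 0 := by
  intro h0
  apply ho
  have h := o.toAlternatingMap.eq_smul_basis_det (frameBasis n)
  ext v
  have h1 := congrArg (fun f => f v) h
  have h2 : o.toAlternatingMap (frameBasis n) = 0 := by rw [coe_frameBasis]; exact h0
  rw [h2, zero_smul] at h1
  exact h1

theorem det_gramAt_pull (g : Model n →L[ℝ] Model n →L[ℝ] ℝ) (T : Model n →L[ℝ] Model n) :
    (gramAt (pullInner T g)).det = LinearMap.det (T : Model n →ₗ[ℝ] Model n) ^ 2 * (gramAt g).det := by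
  let A := LinearMap.toMatrix (frameBasis n) (frameBasis n) (T : Model n →ₗ[ℝ] Model n)
  have hA : ∀ j, T (frame j) = ∑ i, A i j • frame (n := n) i := by
    intro j
    rw [← sum_apply_smul_frame (T (frame j))]
    refine Finset.sum_congr rfl fun i _ => ?_
    simp [A, LinearMap.toMatrix_apply, frameBasis, frame]
  have : gramAt (pullInner T g) = A.transpose * gramAt g * A := by
    ext i j
    simp only [gramAt, Matrix.of_apply, pullInner_apply, hA, Matrix.mul_apply, Matrix.transpose_apply]
    simp only [map_sum, map_smul, sum_apply, smul_apply,
      smul_eq_mul, Finset.sum_mul, Finset.mul_sum]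
    refine Finset.sum_congr rfl fun _ _ => Finset.sum_congr rfl fun _ _ => by ring
  rw [this, Matrix.det_mul, Matrix.det_mul, Matrix.det_transpose]
  simp only [A, LinearMap.det_toMatrix]
  ring

theorem det_ne_zero_of_bijective {T : Model n →L[ℝ] Model n} (hT : Function.Bijective T) :
    LinearMap.det (T : Model n →ₗ[ℝ] Model n) ≠ 0 :=
  (LinearEquiv.ofBijective (T : Model n →ₗ[ℝ] Model n) hT).isUnit_det'.ne_zero

theorem volAt_pull {g : Model n →L[ℝ] Model n →L[ℝ] ℝ}
    (o : Model n [⋀^Fin (2 * n)]→L[ℝ] ℝ) {T : Model n →L[ℝ] Model n} (hT : Function.Bijective T) :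
    volAt (pullInner T g) (o.compContinuousLinearMap T) = (volAt g o).compContinuousLinearMap T := by
  ext v
  have h1 := map_comp_eq_det_smul o T (frame (n := n))
  have hT' := det_ne_zero_of_bijective hT
  simp only [volAt, det_gramAt_pull, ContinuousAlternatingMap.smul_apply,
    compContinuousLinearMap_apply]
  change (_ / |o (fun i => T (frame i))|) • _ = _
  rw [h1, abs_mul, Real.sqrt_mul (sq_nonneg _), Real.sqrt_sq_eq_abs,
    mul_div_mul_left _ _ (abs_ne_zero.2 hT')]

/-- The volume form takes inverse values on a basis and on its metric dual. -/
theorem volAt_frame_mul_coframe {g : Model n →L[ℝ] Model n →L[ℝ] ℝ} (hg : IsInner g)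
    {o : Model n [⋀^Fin (2 * n)]→L[ℝ] ℝ} (ho : o ≠ 0) :
    volAt g o frame * volAt g o (coframeAt g) = 1 := by
  have h0 := map_frame_ne_zero ho
  have hpos := det_gramAt_pos hg
  have h := o.toAlternatingMap.eq_smul_basis_det (frameBasis n)
  have h1 : o (coframeAt g) = o frame * (gramAt g).det⁻¹ := by
    have h1 := congrArg (fun f => f (coframeAt g)) h
    simp only [AlternatingMap.smul_apply, smul_eq_mul, coe_frameBasis] at h1
    change o _ = o _ * _ at h1
    rw [h1, Module.Basis.det_apply]
    have : (frameBasis n).toMatrix (coframeAt g) = ((gramAt g)⁻¹).transpose := by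
      ext i j
      simp only [Module.Basis.toMatrix_apply, coframeAt, map_sum, map_smul, ← coe_frameBasis,
        Matrix.transpose_apply]
      simp [Finsupp.single_apply]
    rw [this, Matrix.det_transpose, Matrix.det_nonsing_inv, Ring.inverse_eq_inv']
  simp only [volAt, ContinuousAlternatingMap.smul_apply, smul_eq_mul, h1]
  have h2 : |o frame| ^ 2 = o frame ^ 2 := sq_abs _
  have h3 := Real.sq_sqrt hpos.le
  have h4 : |o (frame (n := n))| ≠ 0 := abs_ne_zero.2 h0
  field_simp
  rw [h3, h2, mul_comm]

/-- The first slots of a top form, as a multilinear map, with the last slots fixed. -/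
def contractMulti (h : k + l = 2 * n) (m : Model n [⋀^Fin (2 * n)]→L[ℝ] ℝ) (w : Fin l → Model n) :
    MultilinearMap ℝ (fun _ : Fin k => Model n) ℝ :=
  MultilinearMap.mk' (fun u => contractFirst h m u w)
    (by
      intro u i a b
      have key : ∀ x, contractFirst h m (Function.update u i x) w =
          m (Function.update (Sum.elim u w ∘ (finSumFinEquiv.trans (finCongr h)).symm)
            ((finSumFinEquiv.trans (finCongr h)) (Sum.inl i)) x) := by
        intro x
        change m _ = _
        rw [← Sum.update_elim_inl, Function.update_comp_equiv, Equiv.symm_symm]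
      simp only [key, ContinuousAlternatingMap.map_update_add])
    (by
      intro u i a b
      have key : ∀ x, contractFirst h m (Function.update u i x) w =
          m (Function.update (Sum.elim u w ∘ (finSumFinEquiv.trans (finCongr h)).symm)
            ((finSumFinEquiv.trans (finCongr h)) (Sum.inl i)) x) := by
        intro x
        change m _ = _
        rw [← Sum.update_elim_inl, Function.update_comp_equiv, Equiv.symm_symm]
      simp only [key, ContinuousAlternatingMap.map_update_smul])

theorem starAt_apply (g : Model n →L[ℝ] Model n →L[ℝ] ℝ) (m : Model n [⋀^Fin (2 * n)]→L[ℝ] ℝ)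
    (h : k + l = 2 * n) (β : Model n [⋀^Fin k]→L[ℝ] V) (v : Fin l → Model n) :
    starAt g m h β v = ((k.factorial : ℝ)⁻¹) • ∑ I : Fin k → Fin (2 * n),
      contractFirst h m (fun a => coframeAt g (I a)) v • β fun a => frame (n := n) (I a) := by
  simp [starAt, tensor, ContinuousAlternatingMap.sum_apply]

theorem starAt_pull {g : Model n →L[ℝ] Model n →L[ℝ] ℝ} (hg : IsInner g)
    (m : Model n [⋀^Fin (2 * n)]→L[ℝ] ℝ) {T : Model n →L[ℝ] Model n} (hT : Function.Bijective T)
    (h : k + l = 2 * n) (β : Model n [⋀^Fin k]→L[ℝ] V) :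
    starAt (pullInner T g) (m.compContinuousLinearMap T) h (β.compContinuousLinearMap T) =
      (starAt g m h β).compContinuousLinearMap T := by
  ext v
  rw [compContinuousLinearMap_apply, starAt_apply, starAt_apply]
  congr 1
  have key := (isDualFrame_frame hg).sum_multi_eq hg ((isDualFrame_frame (hg.pull hT.1)).map hT.2)
    (LinearMap.lsmul ℝ V).flip k β.toMultilinearMap (contractMulti h m (T ∘ v))
  simp only [LinearMap.flip_apply] at key
  refine Eq.trans (Finset.sum_congr rfl fun I _ => ?_) key
  refine congrArg₂ (fun (a : ℝ) (x : V) => a • x) (congrArg m ?_) rfl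
  funext i
  simp only [Function.comp]
  rcases ((finSumFinEquiv.trans (finCongr h)).symm i) with a | a <;> rfl

theorem pairAt_pull {g : Model n →L[ℝ] Model n →L[ℝ] ℝ} (hg : IsInner g)
    {T : Model n →L[ℝ] Model n} (hT : Function.Bijective T) (b : V →L[ℝ] W →L[ℝ] X)
    (α : Model n [⋀^Fin k]→L[ℝ] V) (β : Model n [⋀^Fin k]→L[ℝ] W) :
    pairAt (pullInner T g) b (α.compContinuousLinearMap T) (β.compContinuousLinearMap T) =
      pairAt g b α β := by
  rw [pairAt, pairAt]
  congr 1
  exact (isDualFrame_frame hg).sum_multi_eq hg ((isDualFrame_frame (hg.pull hT.1)).map hT.2)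
    (b.toLinearMap₁₂) k α.toMultilinearMap β.toMultilinearMap

theorem IsDualFrame.swap {g : Model n →L[ℝ] Model n →L[ℝ] ℝ} (hg : IsInner g)
    {f f' : Fin (2 * n) → Model n} (hf : IsDualFrame g f f') : IsDualFrame g f' f := by
  intro v
  conv_rhs => rw [← hf.expand hg v]
  simp_rw [hg.symm]

theorem pairAt_swap {g : Model n →L[ℝ] Model n →L[ℝ] ℝ} (hg : IsInner g)
    (b : V →L[ℝ] W →L[ℝ] X)
    (α : Model n [⋀^Fin k]→L[ℝ] V) (β : Model n [⋀^Fin k]→L[ℝ] W) :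
    pairAt g b α β = ((k.factorial : ℝ)⁻¹) • ∑ I : Fin k → Fin (2 * n),
      b (α fun a => coframeAt g (I a)) (β fun a => frame (n := n) (I a)) := by
  rw [pairAt]
  congr 1
  exact ((isDualFrame_frame hg).swap hg).sum_multi_eq hg (isDualFrame_frame hg)
    (b.toLinearMap₁₂) k α.toMultilinearMap β.toMultilinearMap

theorem pairAt_flip {g : Model n →L[ℝ] Model n →L[ℝ] ℝ} (hg : IsInner g)
    (b : V →L[ℝ] W →L[ℝ] X)
    (α : Model n [⋀^Fin k]→L[ℝ] V) (β : Model n [⋀^Fin k]→L[ℝ] W) :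
    pairAt g b α β = pairAt g b.flip β α := by
  rw [pairAt_swap hg, pairAt]
  rfl

theorem pairAt_one (g : Model n →L[ℝ] Model n →L[ℝ] ℝ) (b : V →L[ℝ] W →L[ℝ] X)
    (α : Model n [⋀^Fin 1]→L[ℝ] V) (β : Model n [⋀^Fin 1]→L[ℝ] W) :
    pairAt g b α β = ∑ i, b (α fun _ => frame i) (β fun _ => coframeAt g i) := by
  rw [pairAt, ← (Equiv.funUnique (Fin 1) (Fin (2 * n))).symm.sum_comp]
  simp [Equiv.funUnique]

theorem sum_fin_two {ι : Type*} [Fintype ι] {M : Type*} [AddCommMonoid M] (F : (Fin 2 → ι) → M) :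
    ∑ I, F I = ∑ p, ∑ q, F ![p, q] := by
  rw [← (finTwoArrowEquiv ι).symm.sum_comp, Fintype.sum_prod_type]
  rfl

theorem comp_vec_two {ι E : Type*} (e : ι → E) (p q : ι) :
    (fun a => e (![p, q] a)) = ![e p, e q] := by
  funext a; fin_cases a <;> rfl

theorem pairAt_two_swap {g : Model n →L[ℝ] Model n →L[ℝ] ℝ} (hg : IsInner g) (b : V →L[ℝ] W →L[ℝ] X)
    (α : Model n [⋀^Fin 2]→L[ℝ] V) (β : Model n [⋀^Fin 2]→L[ℝ] W) :
    pairAt g b α β = (2 : ℝ)⁻¹ • ∑ p, ∑ q, b (α ![coframeAt g p, coframeAt g q])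
      (β ![frame p, frame q]) := by
  rw [pairAt_swap hg, sum_fin_two]
  simp only [comp_vec_two]
  simp

/-- Casting turns `contractFirst` of two vectors into evaluation with those vectors first. -/
theorem contractFirst_two (h : 2 + l = 2 * n) (m : Model n [⋀^Fin (2 * n)]→L[ℝ] ℝ)
    (u u' : Model n) (v : Fin l → Model n) :
    contractFirst h m ![u, u'] v = ((show 2 * n = l + 1 + 1 by omega) ▸ m :
      Model n [⋀^Fin (l + 1 + 1)]→L[ℝ] ℝ) (Matrix.vecCons u (Matrix.vecCons u' v)) := by
  rw [map_comp_castForm]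
  change m _ = _
  congr 1
  funext i
  obtain ⟨s, rfl⟩ := (finSumFinEquiv.trans (finCongr h)).surjective i
  rcases s with a | a
  · simp only [Function.comp, Equiv.symm_apply_apply, Sum.elim_inl]
    fin_cases a <;> rfl
  · simp only [Function.comp, Equiv.symm_apply_apply, Sum.elim_inr]
    have : Fin.cast (show 2 * n = l + 1 + 1 by omega) ((finSumFinEquiv.trans (finCongr h)) (Sum.inr a)) =
      a.succ.succ := by
      ext; simp
    rw [this]
    simp

/-- Casting turns `contractFirst` with a single free slot into evaluation with that vector last. -/
theorem contractFirst_last (h : l + 1 + 1 = 2 * n) (m : Model n [⋀^Fin (2 * n)]→L[ℝ] ℝ)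
    (u : Fin (l + 1) → Model n) (x : Model n) :
    contractFirst h m u (fun _ => x) = (h.symm ▸ m :
      Model n [⋀^Fin (l + 1 + 1)]→L[ℝ] ℝ) (Fin.snoc (α := fun _ => Model n) u x) := by
  rw [map_comp_castForm]
  change m _ = _
  congr 1
  funext i
  obtain ⟨s, rfl⟩ := (finSumFinEquiv.trans (finCongr h)).surjective i
  rcases s with a | a
  · simp only [Function.comp, Equiv.symm_apply_apply, Sum.elim_inl]
    have : Fin.cast h.symm ((finSumFinEquiv.trans (finCongr h)) (Sum.inl a)) =
      a.castSucc := by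
      ext; simp
    rw [this, Fin.snoc_castSucc]
  · simp only [Function.comp, Equiv.symm_apply_apply, Sum.elim_inr]
    have : Fin.cast h.symm ((finSumFinEquiv.trans (finCongr h)) (Sum.inr a)) =
      Fin.last (l + 1) := by
      ext; simp
    rw [this, Fin.snoc_last]

/-- `φ ∧ *β` for a 1-form `φ` and a 2-form `β`: up to sign, the star of the contraction of `β`
with `φ`. -/
theorem wedgeOne_starAt (g : Model n →L[ℝ] Model n →L[ℝ] ℝ) (m : Model n [⋀^Fin (2 * n)]→L[ℝ] ℝ)
    (h : 2 + l = 2 * n) (b : V →L[ℝ] W →L[ℝ] X) (φ : Model n →L[ℝ] V)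
    (β : Model n [⋀^Fin 2]→L[ℝ] W) (v : Fin (l + 1) → Model n) :
    wedgeOne b φ (starAt g m h β) v = -∑ p, ∑ q, ((show 2 * n = l + 1 + 1 by omega) ▸ m :
      Model n [⋀^Fin (l + 1 + 1)]→L[ℝ] ℝ) (Matrix.vecCons (coframeAt g q) v) •
        b (φ (coframeAt g p)) (β ![frame p, frame q]) := by
  set μ : Model n [⋀^Fin (l + 1 + 1)]→L[ℝ] ℝ := (show 2 * n = l + 1 + 1 by omega) ▸ m with hμ
  have hfin : Module.finrank ℝ (Model n) = l + 1 + 1 := by rw [finrank_model]; omega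
  have hstar : ∀ w, starAt g m h β w = (2 : ℝ)⁻¹ • ∑ p, ∑ q,
      μ (Matrix.vecCons (coframeAt g p) (Matrix.vecCons (coframeAt g q) w)) •
        β ![frame p, frame q] := by
    intro w
    rw [starAt_apply, sum_fin_two]
    simp only [comp_vec_two, contractFirst_two]
    simp [hμ]
  have hanti : ∀ p q, β ![frame (n := n) q, frame p] = -β ![frame p, frame q] := by
    intro p q
    have := β.toAlternatingMap.map_swap ![frame (n := n) p, frame q] (show (0 : Fin 2) ≠ 1 by simp)
    change β _ = -β _ at this
    rw [← this]
    congr 1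
    funext a; fin_cases a <;> rfl
  have hpq : ∀ p q, ∑ i : Fin (l + 1), (-1 : ℝ) ^ (i : ℕ) •
      μ (Matrix.vecCons (coframeAt g p) (Matrix.vecCons (coframeAt g q) (i.removeNth v))) •
        b (φ (v i)) (β ![frame p, frame q]) =
      μ (Matrix.vecCons (coframeAt g p) v) • b (φ (coframeAt g q)) (β ![frame p, frame q]) -
      μ (Matrix.vecCons (coframeAt g q) v) • b (φ (coframeAt g p)) (β ![frame p, frame q]) := by
    intro p q
    have h1 := sum_removeNth_smul_eq hfin μ (b.flip (β ![frame p, frame q]) ∘L φ) (coframeAt g p)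
      (Matrix.vecCons (coframeAt g q) v)
    rw [Fin.sum_univ_succ] at h1
    simp only [removeNth_zero_vecCons, removeNth_succ_vecCons, Matrix.cons_val_zero,
      Matrix.cons_val_succ, Fin.val_succ, pow_succ, Fin.val_zero, pow_zero, one_smul, mul_neg,
      mul_one, neg_smul, Finset.sum_neg_distrib, ContinuousLinearMap.comp_apply,
      ContinuousLinearMap.flip_apply] at h1
    rw [← h1]
    abel
  have hsum : wedgeOne b φ (starAt g m h β) v = (2 : ℝ)⁻¹ • ∑ p, ∑ q,
      (μ (Matrix.vecCons (coframeAt g p) v) • b (φ (coframeAt g q)) (β ![frame p, frame q]) -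
      μ (Matrix.vecCons (coframeAt g q) v) • b (φ (coframeAt g p)) (β ![frame p, frame q])) := by
    simp only [← hpq]
    simp only [wedgeOne_apply, hstar, map_smul, map_sum, Finset.smul_sum]
    rw [Finset.sum_comm]
    refine Finset.sum_congr rfl fun p _ => ?_
    rw [Finset.sum_comm]
    refine Finset.sum_congr rfl fun q _ => Finset.sum_congr rfl fun i _ => ?_
    simp only [smul_comm (2 : ℝ)⁻¹]
  rw [hsum]
  simp only [Finset.sum_sub_distrib]
  rw [Finset.sum_comm]
  conv_lhs =>
    enter [2, 1, 2, q, 2, p]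
    rw [hanti, map_neg, smul_neg]
  simp only [Finset.sum_neg_distrib]
  rw [← neg_add', ← two_smul ℝ, smul_neg, smul_smul]
  norm_num

/-- `κ ∧ *β = ⟨κ, β⟩ vol` for 2-forms, in which `κ` enters through an unantisymmetrized bilinear
form. -/
theorem wedgeTwo_starAt (g : Model n →L[ℝ] Model n →L[ℝ] ℝ) (m : Model n [⋀^Fin (2 * n)]→L[ℝ] ℝ)
    (h : 2 + l = 2 * n) (b : V →L[ℝ] W →L[ℝ] X) (κ : Model n →L[ℝ] Model n →L[ℝ] V)
    (β : Model n [⋀^Fin 2]→L[ℝ] W) (v : Fin (l + 1 + 1) → Model n) :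
    wedgeTwo b κ (starAt g m h β) v = ((show 2 * n = l + 1 + 1 by omega) ▸ m :
      Model n [⋀^Fin (l + 1 + 1)]→L[ℝ] ℝ) v •
        ∑ p, ∑ q, b (κ (coframeAt g p) (coframeAt g q)) (β ![frame p, frame q]) := by
  set μ : Model n [⋀^Fin (l + 1 + 1)]→L[ℝ] ℝ := (show 2 * n = l + 1 + 1 by omega) ▸ m with hμ
  have hfin : Module.finrank ℝ (Model n) = l + 1 + 1 := by rw [finrank_model]; omega
  have hanti : ∀ p q, β ![frame (n := n) q, frame p] = -β ![frame p, frame q] := by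
    intro p q
    have := β.toAlternatingMap.map_swap ![frame (n := n) p, frame q] (show (0 : Fin 2) ≠ 1 by simp)
    change β _ = -β _ at this
    rw [← this]
    congr 1
    funext a; fin_cases a <;> rfl
  have hpq : ∀ p q, ∑ i : Fin (l + 1 + 1), (-1 : ℝ) ^ (i : ℕ) •
      μ (Matrix.vecCons (coframeAt g q) (i.removeNth v)) •
        b (κ (v i) (coframeAt g p)) (β ![frame p, frame q]) =
      μ v • b (κ (coframeAt g q) (coframeAt g p)) (β ![frame p, frame q]) := fun p q =>
    sum_removeNth_smul_eq hfin μ (b.flip (β ![frame p, frame q]) ∘L κ.flip (coframeAt g p))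
      (coframeAt g q) v
  rw [wedgeTwo_apply]
  simp only [wedgeOne_starAt, ← hμ, smul_neg, Finset.sum_neg_distrib, Finset.smul_sum]
  rw [Finset.sum_comm]
  conv_lhs =>
    enter [1, 2, p]
    rw [Finset.sum_comm]
    enter [2, q]
    rw [hpq]
  rw [Finset.sum_comm, ← Finset.sum_neg_distrib]
  refine Finset.sum_congr rfl fun p _ => ?_
  rw [← Finset.sum_neg_distrib]
  refine Finset.sum_congr rfl fun q _ => ?_
  rw [hanti, map_neg, smul_neg, neg_neg]

/-- `α ∧ δ = -⟨α, *δ⟩ vol` for a 1-form `α` and a form `δ` of degree `2n - 1`. -/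
theorem wedgeOne_eq_neg_pairAt {g : Model n →L[ℝ] Model n →L[ℝ] ℝ} (hg : IsInner g)
    {o : Model n [⋀^Fin (2 * n)]→L[ℝ] ℝ} (ho : o ≠ 0)
    (h : l + 1 + 1 = 2 * n) (b : V →L[ℝ] W →L[ℝ] X) (α : Model n [⋀^Fin 1]→L[ℝ] V)
    (δ : Model n [⋀^Fin (l + 1)]→L[ℝ] W) (v : Fin (l + 1 + 1) → Model n) :
    wedgeOne b ((ofSubsingleton ℝ (Model n) V (0 : Fin 1)).symm α) δ v =
      -((h.symm ▸ volAt g o : Model n [⋀^Fin (l + 1 + 1)]→L[ℝ] ℝ) v •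
        pairAt g b α (starAt g (volAt g o) h δ)) := by
  have hl : Even l := by
    rw [Nat.even_iff]; omega
  have hvol := volAt_frame_mul_coframe hg ho
  -- the number `2 * n` is generalized to `d` so that the equation of degrees can be substituted
  have key : ∀ (d : ℕ) (hd : l + 1 + 1 = d) (m : Model n [⋀^Fin d]→L[ℝ] ℝ)
      (e : Module.Basis (Fin d) ℝ (Model n)) (c : Fin d → Model n), m e * m c = 1 →
      wedgeOne b ((ofSubsingleton ℝ (Model n) V (0 : Fin 1)).symm α) δ v =
      -((hd.symm ▸ m : Model n [⋀^Fin (l + 1 + 1)]→L[ℝ] ℝ) v •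
        (((l + 1).factorial : ℝ)⁻¹ • ∑ i, ∑ I : Fin (l + 1) → Fin d,
          (hd.symm ▸ m : Model n [⋀^Fin (l + 1 + 1)]→L[ℝ] ℝ)
            (Fin.snoc (α := fun _ => Model n) (fun a => c (I a)) (c i)) •
          b (α fun _ => e i) (δ fun a => e (I a)))) := by
    rintro d rfl m e c hm
    exact wedgeOne_eq_of_top hl b _ δ e c m hm v
  rw [key _ h (volAt g o) (frameBasis n) (coframeAt g) (by rw [coe_frameBasis]; exact hvol)]
  congr 2
  rw [pairAt_one, Finset.smul_sum]
  refine Finset.sum_congr rfl fun i _ => ?_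
  rw [starAt_apply, map_smul, map_sum, coe_frameBasis]
  simp only [map_smul, contractFirst_last]

end Pointwise

/-! ### Inner products of forms and the primitive projection -/

section Pointwise

open ContinuousAlternatingMap (compContinuousLinearMap_apply ofSubsingleton)
variable {n : ℕ} {U V W X : Type*} [NormedAddCommGroup U] [NormedSpace ℝ U]
  [NormedAddCommGroup V] [NormedSpace ℝ V]
  [NormedAddCommGroup W] [NormedSpace ℝ W] [NormedAddCommGroup X] [NormedSpace ℝ X] {k l : ℕ}

theorem pairAt_add_left (g : Model n →L[ℝ] Model n →L[ℝ] ℝ) (b : V →L[ℝ] W →L[ℝ] X)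
    (α α' : Model n [⋀^Fin k]→L[ℝ] V) (β : Model n [⋀^Fin k]→L[ℝ] W) :
    pairAt g b (α + α') β = pairAt g b α β + pairAt g b α' β := by
  simp [pairAt, Finset.sum_add_distrib]

theorem pairAt_smul_left (g : Model n →L[ℝ] Model n →L[ℝ] ℝ) (b : V →L[ℝ] W →L[ℝ] X) (t : ℝ)
    (α : Model n [⋀^Fin k]→L[ℝ] V) (β : Model n [⋀^Fin k]→L[ℝ] W) :
    pairAt g b (t • α) β = t • pairAt g b α β := by
  simp [pairAt, ← Finset.smul_sum, smul_comm t]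

theorem pairAt_add_right (g : Model n →L[ℝ] Model n →L[ℝ] ℝ) (b : V →L[ℝ] W →L[ℝ] X)
    (α : Model n [⋀^Fin k]→L[ℝ] V) (β β' : Model n [⋀^Fin k]→L[ℝ] W) :
    pairAt g b α (β + β') = pairAt g b α β + pairAt g b α β' := by
  simp [pairAt, Finset.sum_add_distrib]

theorem pairAt_smul_right (g : Model n →L[ℝ] Model n →L[ℝ] ℝ) (b : V →L[ℝ] W →L[ℝ] X) (t : ℝ)
    (α : Model n [⋀^Fin k]→L[ℝ] V) (β : Model n [⋀^Fin k]→L[ℝ] W) :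
    pairAt g b α (t • β) = t • pairAt g b α β := by
  simp [pairAt, ← Finset.smul_sum, smul_comm t]

open scoped MatrixOrder Matrix.Norms.L2Operator in
/-- Orthonormal bases exist: the rows of a square root of the inverse Gram matrix. -/
theorem exists_orthonormal_frame {g : Model n →L[ℝ] Model n →L[ℝ] ℝ} (hg : IsInner g) :
    ∃ o : Fin (2 * n) → Model n, IsDualFrame g o o := by
  obtain ⟨B, hB⟩ := CStarAlgebra.nonneg_iff_eq_star_mul_self.1
    (posDef_gramAt hg).inv.posSemidef.nonneg
  -- `B` satisfies `Bᵀ B = Gram⁻¹`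
  refine ⟨fun i => ∑ j, B i j • frame (n := n) j, fun v => ?_⟩
  have hG : ∀ j k, (gramAt g)⁻¹ j k = ∑ i, B i j * B i k := fun j k => by
    rw [hB, Matrix.mul_apply]
    simp [Matrix.star_apply]
  have hsymm : ∀ j k, (gramAt g)⁻¹ j k = (gramAt g)⁻¹ k j := fun j k => by
    rw [hG, hG]; exact Finset.sum_congr rfl fun i _ => mul_comm _ _
  conv_rhs => rw [← isDualFrame_frame hg v]
  simp only [map_sum, map_smul, sum_apply, smul_apply, smul_eq_mul, coframeAt, Finset.smul_sum,
    Finset.sum_smul, hG, smul_smul]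
  rw [Finset.sum_comm]
  refine Finset.sum_congr rfl fun j _ => ?_
  rw [Finset.sum_comm]
  refine Finset.sum_congr rfl fun p _ => ?_
  rw [← Finset.sum_smul, Finset.sum_mul]
  congr 1
  exact Finset.sum_congr rfl fun i _ => by ring

theorem pairAt_eq_of_orthonormal {g : Model n →L[ℝ] Model n →L[ℝ] ℝ} (hg : IsInner g)
    {o : Fin (2 * n) → Model n} (ho : IsDualFrame g o o) (b : V →L[ℝ] W →L[ℝ] X)
    (α : Model n [⋀^Fin k]→L[ℝ] V) (β : Model n [⋀^Fin k]→L[ℝ] W) :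
    pairAt g b α β = ((k.factorial : ℝ)⁻¹) • ∑ I : Fin k → Fin (2 * n),
      b (α fun a => o (I a)) (β fun a => o (I a)) := by
  rw [pairAt]
  congr 1
  exact ho.sum_multi_eq hg (isDualFrame_frame hg) (b.toLinearMap₁₂) k α.toMultilinearMap
    β.toMultilinearMap

/-- A form that vanishes on all tuples from a frame is zero. -/
theorem IsDualFrame.form_ext {g : Model n →L[ℝ] Model n →L[ℝ] ℝ}
    {o o' : Fin (2 * n) → Model n} (ho : IsDualFrame g o o') {α : Model n [⋀^Fin k]→L[ℝ] V}
    (h : ∀ I : Fin k → Fin (2 * n), α (fun a => o (I a)) = 0) : α = 0 := by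
  ext v
  have hv : v = fun a => ∑ i, g (o' i) (v a) • o i := funext fun a => (ho (v a)).symm
  rw [hv, α.map_sum]
  refine Finset.sum_eq_zero fun I _ => ?_
  have := α.toMultilinearMap.map_smul_univ (fun a => g (o' (I a)) (v a)) (fun a => o (I a))
  change α _ = _ • α _ at this
  rw [this, h, smul_zero]

theorem pairAt_self_nonneg {g : Model n →L[ℝ] Model n →L[ℝ] ℝ} (hg : IsInner g)
    {b : V →L[ℝ] V →L[ℝ] ℝ} (hb : ∀ u, u ≠ 0 → 0 < b u u) (α : Model n [⋀^Fin k]→L[ℝ] V) :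
    0 ≤ pairAt g b α α := by
  obtain ⟨o, ho⟩ := exists_orthonormal_frame hg
  rw [pairAt_eq_of_orthonormal hg ho, smul_eq_mul]
  refine mul_nonneg (by positivity) (Finset.sum_nonneg fun I _ => ?_)
  by_cases h : α (fun a => o (I a)) = 0
  · simp [h]
  · exact (hb _ h).le

theorem eq_zero_of_pairAt_self {g : Model n →L[ℝ] Model n →L[ℝ] ℝ} (hg : IsInner g)
    {b : V →L[ℝ] V →L[ℝ] ℝ} (hb : ∀ u, u ≠ 0 → 0 < b u u) {α : Model n [⋀^Fin k]→L[ℝ] V}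
    (h : pairAt g b α α = 0) : α = 0 := by
  obtain ⟨o, ho⟩ := exists_orthonormal_frame hg
  rw [pairAt_eq_of_orthonormal hg ho, smul_eq_zero] at h
  have hk : ((k.factorial : ℝ)⁻¹) ≠ 0 := by positivity
  have h := h.resolve_left hk
  have hnn : ∀ u, 0 ≤ b u u := fun u => by
    by_cases hu : u = 0
    · simp [hu]
    · exact (hb u hu).le
  rw [Finset.sum_eq_zero_iff_of_nonneg fun _ _ => hnn _] at h
  refine ho.form_ext fun I => ?_
  by_contra hne
  exact (hb _ hne).ne' (h I (Finset.mem_univ _))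

/-- The primitive part of a 2-form with respect to the metric `g` and the 2-form `w`. -/
def primAt (g : Model n →L[ℝ] Model n →L[ℝ] ℝ) (w : Model n [⋀^Fin 2]→L[ℝ] ℝ)
    (α : Model n [⋀^Fin 2]→L[ℝ] V) : Model n [⋀^Fin 2]→L[ℝ] V :=
  α - tensor w ((pairAt g (ContinuousLinearMap.lsmul ℝ ℝ) w w)⁻¹ •
    pairAt g (ContinuousLinearMap.lsmul ℝ ℝ) w α)

theorem tensor_apply (w : Model n [⋀^Fin k]→L[ℝ] ℝ) (ξ : V) (v : Fin k → Model n) :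
    tensor w ξ v = w v • ξ := rfl

theorem primAt_pull {g : Model n →L[ℝ] Model n →L[ℝ] ℝ} (hg : IsInner g)
    {T : Model n →L[ℝ] Model n} (hT : Function.Bijective T) (w : Model n [⋀^Fin 2]→L[ℝ] ℝ)
    (α : Model n [⋀^Fin 2]→L[ℝ] V) :
    primAt (pullInner T g) (w.compContinuousLinearMap T) (α.compContinuousLinearMap T) =
      (primAt g w α).compContinuousLinearMap T := by
  rw [primAt, primAt, pairAt_pull hg hT, pairAt_pull hg hT]
  rfl

theorem pairAt_tensor_right {g : Model n →L[ℝ] Model n →L[ℝ] ℝ} (hg : IsInner g)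
    (b : V →L[ℝ] W →L[ℝ] X) (w : Model n [⋀^Fin k]→L[ℝ] ℝ) (α : Model n [⋀^Fin k]→L[ℝ] V) (ξ : W) :
    pairAt g b α (tensor w ξ) = b (pairAt g (ContinuousLinearMap.lsmul ℝ ℝ) w α) ξ := by
  rw [pairAt_swap hg, pairAt]
  simp only [map_smul, map_sum, sum_apply, smul_apply, tensor_apply, ContinuousLinearMap.lsmul_apply]

theorem pairAt_lsmul_tensor (g : Model n →L[ℝ] Model n →L[ℝ] ℝ)
    (w : Model n [⋀^Fin k]→L[ℝ] ℝ) (ξ : W) :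
    pairAt g (ContinuousLinearMap.lsmul ℝ ℝ) w (tensor w ξ) =
      pairAt g (ContinuousLinearMap.lsmul ℝ ℝ) w w • ξ := by
  simp only [pairAt, tensor_apply, ContinuousLinearMap.lsmul_apply, smul_smul, smul_eq_mul,
    Finset.sum_smul, Finset.smul_sum, Finset.mul_sum]

theorem pairAt_lsmul_primAt {g : Model n →L[ℝ] Model n →L[ℝ] ℝ} (hg : IsInner g)
    {w : Model n [⋀^Fin 2]→L[ℝ] ℝ} (hw : w ≠ 0) (α : Model n [⋀^Fin 2]→L[ℝ] V) :
    pairAt g (ContinuousLinearMap.lsmul ℝ ℝ) w (primAt g w α) = 0 := by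
  have h0 : pairAt g (ContinuousLinearMap.lsmul ℝ ℝ) w w ≠ 0 := fun h =>
    hw (eq_zero_of_pairAt_self hg (fun u hu => by simpa using hu) h)
  rw [primAt, sub_eq_add_neg, ← neg_one_smul ℝ, pairAt_add_right, pairAt_smul_right,
    pairAt_lsmul_tensor, smul_smul (pairAt g _ w w), mul_inv_cancel₀ h0]
  simp

/-- The primitive projection is orthogonal. -/
theorem pairAt_primAt_right {g : Model n →L[ℝ] Model n →L[ℝ] ℝ} (hg : IsInner g)
    {w : Model n [⋀^Fin 2]→L[ℝ] ℝ} (hw : w ≠ 0) (b : V →L[ℝ] W →L[ℝ] X)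
    (α : Model n [⋀^Fin 2]→L[ℝ] V) (β : Model n [⋀^Fin 2]→L[ℝ] W) :
    pairAt g b (primAt g w α) (primAt g w β) = pairAt g b (primAt g w α) β := by
  conv_lhs => rw [primAt.eq_def g w β]
  rw [sub_eq_add_neg, ← neg_one_smul ℝ, pairAt_add_right, pairAt_smul_right,
    pairAt_tensor_right hg, pairAt_lsmul_primAt hg hw]
  simp

end Pointwise

/-! ### Pointwise operations of a symplectic manifold with compatible metric -/

section GlobalToPointwise

variable {n : ℕ} {M : Type*} [TopologicalSpace M] [ChartedSpace (Model n) M]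
  [IsManifold (𝓡 (2 * n)) ∞ M] {V : Type*} [NormedAddCommGroup V] [NormedSpace ℝ V]
  {EG G : Type*} [NormedAddCommGroup EG] [NormedSpace ℝ EG] [TopologicalSpace G] [ChartedSpace EG G] [Group G]
  {k l : ℕ}

theorem isInner_metricAt (g : Metric n M) (x : M) : IsInner (metricAt g x) where
  symm u v := g.symm x u v
  pos u hu := g.pos x u hu

/-- The Hodge star at `x` depends only on the values of the metric and of the orientation form at `x`. -/
theorem hodgeStar_eq (S : SymplecticRiemannian n M) (h : k + l = 2 * n) (x : M)
    (β : Model n [⋀^Fin k]→L[ℝ] V) : hodgeStar S h x β =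
      starAt (metricAt S.metric x) (volAt (metricAt S.metric x) (S.orientation.toForm x)) h β := rfl

theorem dualLefschetz_eq (S : SymplecticRiemannian n M) (x : M) (α : Model n [⋀^Fin 2]→L[ℝ] V) :
    dualLefschetz S x α =
      pairAt (metricAt S.metric x) (ContinuousLinearMap.lsmul ℝ ℝ) (S.symp.toForm x) α := by
  rw [pairAt, sum_fin_two]
  simp only [comp_vec_two]
  simp [dualLefschetz]
  rfl

/-- The projection `α - (Λα / Λω) ω`, where `Λα = ⟨ω, α⟩`. -/
theorem primitivePart_eq (S : SymplecticRiemannian n M) (x : M) (α : Model n [⋀^Fin 2]→L[ℝ] V) :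
    primitivePart S x α = primAt (metricAt S.metric x) (S.symp.toForm x) α := by
  rw [primitivePart, primAt, dualLefschetz_eq, dualLefschetz_eq]

theorem pointInner_eq [LieGroup 𝓘(ℝ, EG) ∞ G] (S : SymplecticRiemannian n M)
    (B : AdInvariantInner EG G) (x : M) (α β : Model n [⋀^Fin k]→L[ℝ] EG) :
    pointInner S B x α β = pairAt (metricAt S.metric x) B.form α β := rfl

theorem SymplecticForm.toForm_ne_zero (hn : 2 ≤ n) (w : SymplecticForm n M) (x : M) :
    w.toForm x ≠ 0 := by
  intro h
  -- a nonzero vector exists because `n` is positive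
  have := w.nondegenerate x (frame ⟨0, by omega⟩) (fun v => by simp [h])
  simp [frame] at this

end GlobalToPointwise

/-! ### Smooth dependence of the pointwise operations -/

section Smooth
open ContinuousAlternatingMap (compContinuousLinearMap_apply ofSubsingleton)
variable {n : ℕ} {U V W X : Type*} [NormedAddCommGroup U] [NormedSpace ℝ U]
  [NormedAddCommGroup V] [NormedSpace ℝ V]
  [NormedAddCommGroup W] [NormedSpace ℝ W] [NormedAddCommGroup X] [NormedSpace ℝ X] {k l : ℕ}
  {Y : Type*} [NormedAddCommGroup Y] [NormedSpace ℝ Y] {s : Set Y} {r : WithTop ℕ∞}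

instance finiteDimensional_form [FiniteDimensional ℝ V] :
    FiniteDimensional ℝ (Model n [⋀^Fin k]→L[ℝ] V) :=
  haveI : FiniteDimensional ℝ (Model n [⋀^Fin k]→ₗ[ℝ] V) :=
    Module.Finite.of_injective (AlternatingMap.toMultilinearMapLM (S := ℝ))
      AlternatingMap.coe_multilinearMap_injective
  Module.Finite.of_injective (ContinuousAlternatingMap.toAlternatingMapLinear (R := ℝ))
    ContinuousAlternatingMap.toAlternatingMap_injective

/-- Smoothness of a family of forms is tested on values, because the space of forms is finite-dimensional. -/
theorem contDiffOn_form [FiniteDimensional ℝ V] {f : Y → Model n [⋀^Fin k]→L[ℝ] V}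
    (h : ∀ v, ContDiffOn ℝ r (fun y => f y v) s) : ContDiffOn ℝ r f s := by
  let L : (Model n [⋀^Fin k]→L[ℝ] V) →ₗ[ℝ] ((Fin k → Fin (2 * n)) → V) :=
    LinearMap.pi fun I =>
      { toFun := fun α => α fun a => frame (I a)
        map_add' := fun _ _ => rfl
        map_smul' := fun _ _ => rfl }
  have hL : LinearMap.ker L = ⊥ := by
    refine LinearMap.ker_eq_bot'.2 fun α hα => ?_
    have hid : IsDualFrame (innerSL ℝ) (frame (n := n)) frame := fun v => by
      conv_rhs => rw [← sum_apply_smul_frame v]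
      refine Finset.sum_congr rfl fun i _ => ?_
      rw [innerSL_apply_apply, frame, EuclideanSpace.inner_single_left]
      simp
    exact hid.form_ext fun I => congrFun hα I
  -- evaluation on the frame is injective, so it has a linear left inverse
  obtain ⟨R, hR⟩ := L.exists_leftInverse_of_injective hL
  have : f = fun y => R.toContinuousLinearMap (L (f y)) := by
    funext y
    exact (congrArg (fun F => F (f y)) hR).symm
  rw [this]
  exact R.toContinuousLinearMap.contDiff.comp_contDiffOn (contDiffOn_pi.2 fun I => h _)

theorem contDiffOn_form_iff [FiniteDimensional ℝ V] {f : Y → Model n [⋀^Fin k]→L[ℝ] V} :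
    ContDiffOn ℝ r f s ↔ ∀ v, ContDiffOn ℝ r (fun y => f y v) s := by
  refine ⟨fun h v => ?_, contDiffOn_form⟩
  let ev : (Model n [⋀^Fin k]→L[ℝ] V) →ₗ[ℝ] V :=
    { toFun := fun α => α v
      map_add' := fun _ _ => rfl
      map_smul' := fun _ _ => rfl }
  exact (LinearMap.toContinuousLinearMap ev).contDiff.comp_contDiffOn h

theorem contDiffOn_form_apply [FiniteDimensional ℝ V] {f : Y → Model n [⋀^Fin k]→L[ℝ] V}
    {u : Y → Fin k → Model n} (hf : ContDiffOn ℝ r f s)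
    (hu : ∀ a, ContDiffOn ℝ r (fun y => u y a) s) : ContDiffOn ℝ r (fun y => f y (u y)) s := by
  -- expand the arguments in the coordinate basis
  have : (fun y => f y (u y)) = fun y => ∑ I : Fin k → Fin (2 * n),
      (∏ a, u y a (I a)) • f y fun a => frame (I a) := by
    funext y
    have hv : u y = fun a => ∑ i, u y a i • frame (n := n) i :=
      funext fun a => (sum_apply_smul_frame _).symm
    conv_lhs => rw [hv]
    rw [(f y).map_sum]
    refine Finset.sum_congr rfl fun I _ => ?_
    exact (f y).toMultilinearMap.map_smul_univ (fun a => u y a (I a)) (fun a => frame (I a))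
  rw [this]
  refine ContDiffOn.sum fun I _ => ContDiffOn.smul (contDiffOn_prod fun a _ => ?_)
    (contDiffOn_form_iff.1 hf _)
  exact ((EuclideanSpace.proj (I a) : Model n →L[ℝ] ℝ).contDiff).comp_contDiffOn (hu a)

theorem contDiffOn_det {A : Y → Matrix (Fin (2 * n)) (Fin (2 * n)) ℝ}
    (h : ∀ i j, ContDiffOn ℝ r (fun y => A y i j) s) : ContDiffOn ℝ r (fun y => (A y).det) s := by
  simp only [Matrix.det_apply]
  exact ContDiffOn.sum fun σ _ => (contDiffOn_prod fun i _ => h _ _).const_smul _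

theorem contDiffOn_inv {A : Y → Matrix (Fin (2 * n)) (Fin (2 * n)) ℝ}
    (h : ∀ i j, ContDiffOn ℝ r (fun y => A y i j) s) (h0 : ∀ y ∈ s, (A y).det ≠ 0)
    (i j : Fin (2 * n)) : ContDiffOn ℝ r (fun y => (A y)⁻¹ i j) s := by
  simp only [Matrix.inv_def, Matrix.smul_apply, Ring.inverse_eq_inv', smul_eq_mul,
    Matrix.adjugate_apply]
  refine ((contDiffOn_det h).inv h0).mul (contDiffOn_det fun p q => ?_)
  by_cases hp : p = j
  · subst hp
    simp only [Matrix.updateRow_self]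
    exact contDiffOn_const
  · simp only [Matrix.updateRow_ne hp]
    exact h _ _

variable {g : Y → Model n →L[ℝ] Model n →L[ℝ] ℝ} {m o : Y → Model n [⋀^Fin (2 * n)]→L[ℝ] ℝ}
  {w : Y → Model n [⋀^Fin 2]→L[ℝ] ℝ}

theorem contDiffOn_gramAt (hg : ContDiffOn ℝ r g s) (i j : Fin (2 * n)) :
    ContDiffOn ℝ r (fun y => gramAt (g y) i j) s :=
  (hg.clm_apply contDiffOn_const).clm_apply contDiffOn_const

theorem contDiffOn_coframeAt (hg : ContDiffOn ℝ r g s) (hi : ∀ y ∈ s, IsInner (g y))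
    (i : Fin (2 * n)) : ContDiffOn ℝ r (fun y => coframeAt (g y) i) s :=
  ContDiffOn.sum fun j _ => (contDiffOn_inv (contDiffOn_gramAt hg)
    (fun y hy => (det_gramAt_pos (hi y hy)).ne') i j).smul contDiffOn_const

theorem contDiffOn_volAt (hg : ContDiffOn ℝ r g s) (hi : ∀ y ∈ s, IsInner (g y))
    (ho : ContDiffOn ℝ r o s) (ho' : ∀ y ∈ s, o y ≠ 0) :
    ContDiffOn ℝ r (fun y => volAt (g y) (o y)) s := by
  have h0 : ∀ y ∈ s, o y (frame (n := n)) ≠ 0 := fun y hy => map_frame_ne_zero (ho' y hy)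
  -- `|x| = √(x ^ 2)` is smooth away from `x = 0`
  simp only [volAt, ← Real.sqrt_sq_eq_abs]
  have h1 := contDiffOn_form_iff.1 ho (frame (n := n))
  refine ContDiffOn.smul (ContDiffOn.div ?_ ?_ ?_) ho
  · exact (contDiffOn_det (contDiffOn_gramAt hg)).sqrt fun y hy => (det_gramAt_pos (hi y hy)).ne'
  · exact (h1.pow 2).sqrt fun y hy => pow_ne_zero _ (h0 y hy)
  · intro y hy
    rw [Real.sqrt_sq_eq_abs]
    exact abs_ne_zero.2 (h0 y hy)

variable [FiniteDimensional ℝ V]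

theorem contDiffOn_starAt (hg : ContDiffOn ℝ r g s) (hi : ∀ y ∈ s, IsInner (g y))
    (hm : ContDiffOn ℝ r m s) (h : k + l = 2 * n) {β : Y → Model n [⋀^Fin k]→L[ℝ] V}
    (hβ : ContDiffOn ℝ r β s) : ContDiffOn ℝ r (fun y => starAt (g y) (m y) h (β y)) s := by
  refine contDiffOn_form fun v => ?_
  simp only [starAt_apply]
  refine (ContDiffOn.sum fun I _ => ContDiffOn.smul ?_ (contDiffOn_form_iff.1 hβ _)).const_smul _
  refine contDiffOn_form_apply (u := fun y => Sum.elim (fun a => coframeAt (g y) (I a)) v ∘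
    (finSumFinEquiv.trans (finCongr h)).symm) hm fun i => ?_
  simp only [Function.comp]
  rcases ((finSumFinEquiv.trans (finCongr h)).symm i) with a | a
  · exact contDiffOn_coframeAt hg hi _
  · exact contDiffOn_const

theorem contDiffOn_pairAt [FiniteDimensional ℝ W] (hg : ContDiffOn ℝ r g s)
    (hi : ∀ y ∈ s, IsInner (g y)) (b : V →L[ℝ] W →L[ℝ] X) {α : Y → Model n [⋀^Fin k]→L[ℝ] V}
    {β : Y → Model n [⋀^Fin k]→L[ℝ] W} (hα : ContDiffOn ℝ r α s) (hβ : ContDiffOn ℝ r β s) :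
    ContDiffOn ℝ r (fun y => pairAt (g y) b (α y) (β y)) s := by
  refine (ContDiffOn.sum fun I _ => ?_).const_smul _
  exact (b.contDiff.comp_contDiffOn (contDiffOn_form_iff.1 hα _)).clm_apply
    (contDiffOn_form_apply hβ fun a => contDiffOn_coframeAt hg hi _)

theorem contDiffOn_primAt (hg : ContDiffOn ℝ r g s) (hi : ∀ y ∈ s, IsInner (g y))
    (hw : ContDiffOn ℝ r w s) (hw' : ∀ y ∈ s, w y ≠ 0) {α : Y → Model n [⋀^Fin 2]→L[ℝ] V}
    (hα : ContDiffOn ℝ r α s) : ContDiffOn ℝ r (fun y => primAt (g y) (w y) (α y)) s := by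
  refine contDiffOn_form fun v => ?_
  refine (contDiffOn_form_iff.1 hα v).sub ((contDiffOn_form_iff.1 hw v).smul (ContDiffOn.smul ?_ ?_))
  · refine (contDiffOn_pairAt hg hi _ hw hw).inv fun y hy h => hw' y hy ?_
    exact eq_zero_of_pairAt_self (hi y hy) (fun u hu => by simpa using hu) h
  · exact contDiffOn_pairAt hg hi _ hw hα

theorem contDiffOn_wedgeOne [FiniteDimensional ℝ W] [FiniteDimensional ℝ X]
    (b : V →L[ℝ] W →L[ℝ] X) {α : Y → Model n →L[ℝ] V}
    {γ : Y → Model n [⋀^Fin k]→L[ℝ] W} (hα : ContDiffOn ℝ r α s) (hγ : ContDiffOn ℝ r γ s) :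
    ContDiffOn ℝ r (fun y => wedgeOne b (α y) (γ y)) s := by
  refine contDiffOn_form fun v => ?_
  simp only [wedgeOne_apply]
  exact ContDiffOn.sum fun i _ => ((b.contDiff.comp_contDiffOn
    (hα.clm_apply contDiffOn_const)).clm_apply (contDiffOn_form_iff.1 hγ _)).const_smul _

end Smooth

/-! ### The Maurer–Cartan form -/

section Lie
open Filter Topology VectorField

/-- Mixed partial derivatives of a `C²` function agree. -/
theorem fderiv_fderiv_swap {E F H : Type*} [NormedAddCommGroup E] [NormedSpace ℝ E]
    [NormedAddCommGroup F] [NormedSpace ℝ F] [NormedAddCommGroup H] [NormedSpace ℝ H]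
    {f : E × F → H} {a : E} {b : F} (hf : ContDiffAt ℝ 2 f (a, b)) (ξ : E) (η : F) :
    fderiv ℝ (fun y => fderiv ℝ (fun x => f (x, y)) a ξ) b η =
      fderiv ℝ (fun x => fderiv ℝ (fun y => f (x, y)) b η) a ξ := by
  have hd : ∀ᶠ p in 𝓝 (a, b), DifferentiableAt ℝ f p := by
    filter_upwards [hf.eventually (by simp)] with p hp
    exact hp.differentiableAt (by simp)
  have h1 : (fun y => fderiv ℝ (fun x => f (x, y)) a ξ) =ᶠ[𝓝 b] fun y => fderiv ℝ f (a, y) (ξ, 0) := by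
    have hc : ContinuousAt (fun y : F => (a, y)) b := by fun_prop
    filter_upwards [hc.eventually hd] with y hy
    have : HasFDerivAt (fun x : E => (x, y)) (ContinuousLinearMap.inl ℝ E F) a :=
      hasFDerivAt_prodMk_left a y
    have h := (HasFDerivAt.comp a (f := fun x : E => (x, y)) hy.hasFDerivAt this).fderiv
    simp only [Function.comp_def] at h
    rw [h]
    simp
  have h2 : (fun x => fderiv ℝ (fun y => f (x, y)) b η) =ᶠ[𝓝 a] fun x => fderiv ℝ f (x, b) (0, η) := by
    have hc : ContinuousAt (fun x : E => (x, b)) a := by fun_prop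
    filter_upwards [hc.eventually hd] with x hx
    have : HasFDerivAt (fun y : F => (x, y)) (ContinuousLinearMap.inr ℝ E F) b :=
      hasFDerivAt_prodMk_right x b
    have h := (HasFDerivAt.comp b (f := fun y : F => (x, y)) hx.hasFDerivAt this).fderiv
    simp only [Function.comp_def] at h
    rw [h]
    simp
  have hD : DifferentiableAt ℝ (fderiv ℝ f) (a, b) :=
    (hf.fderiv_right (m := 1) (by norm_num)).differentiableAt (by simp)
  have h1' : HasFDerivAt (fun y => fderiv ℝ f (a, y) (ξ, 0))
      ((fderiv ℝ (fderiv ℝ f) (a, b) ∘L ContinuousLinearMap.inr ℝ E F).flip (ξ, 0)) b :=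
    by simpa using (HasFDerivAt.comp b (f := fun y : F => (a, y)) hD.hasFDerivAt
      (hasFDerivAt_prodMk_right a b)).clm_apply (hasFDerivAt_const (ξ, (0 : F)) b)
  have h2' : HasFDerivAt (fun x => fderiv ℝ f (x, b) (0, η))
      ((fderiv ℝ (fderiv ℝ f) (a, b) ∘L ContinuousLinearMap.inl ℝ E F).flip (0, η)) a :=
    by simpa using (HasFDerivAt.comp a (f := fun x : E => (x, b)) hD.hasFDerivAt
      (hasFDerivAt_prodMk_left a b)).clm_apply (hasFDerivAt_const ((0 : E), η) a)
  rw [h1.fderiv_eq, h2.fderiv_eq, h1'.fderiv, h2'.fderiv]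
  simpa using (hf.isSymmSndFDerivAt (by simp)).eq (0, η) (ξ, 0)

variable {EG : Type*} [NormedAddCommGroup EG] [NormedSpace ℝ EG]
  {G : Type*} [TopologicalSpace G] [ChartedSpace EG G] [Group G] [LieGroup 𝓘(ℝ, EG) ∞ G]
  {E : Type*} [NormedAddCommGroup E] [NormedSpace ℝ E]

variable (EG G) in
/-- The preferred chart of the Lie group at the identity. -/
abbrev chartOne : PartialEquiv G EG := extChartAt 𝓘(ℝ, EG) (1 : G)

/-- At a point sent to the identity, the manifold derivative is the derivative in the chart `chartOne`. -/
theorem mfderiv_eq_fderiv_chartOne {f : E → G} {x : E} (hf : ContMDiffAt 𝓘(ℝ, E) 𝓘(ℝ, EG) ∞ f x)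
    (h : f x = 1) : (mfderiv 𝓘(ℝ, E) 𝓘(ℝ, EG) f x : E →L[ℝ] EG) =
      fderiv ℝ (fun z => chartOne EG G (f z)) x := by
  have hd := hf.mdifferentiableAt (by simp)
  rw [hd.mfderiv]
  simp only [writtenInExtChartAt, h, mfld_simps, fderivWithin_univ]
  rfl

theorem contMDiffAt_chartOne_symm {a : EG} (ha : a ∈ (chartOne EG G).target) :
    ContMDiffAt 𝓘(ℝ, EG) 𝓘(ℝ, EG) ∞ (chartOne EG G).symm a :=
  have : IsManifold 𝓘(ℝ, EG) ∞ G := ContMDiffMul.toIsManifold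
  (contMDiffOn_extChartAt_symm (1 : G)).contMDiffAt
    ((isOpen_extChartAt_target (1 : G)).mem_nhds ha)

theorem contMDiffAt_chartOne {p : G} (hp : p ∈ (chartOne EG G).source) :
    ContMDiffAt 𝓘(ℝ, EG) 𝓘(ℝ, EG) ∞ (chartOne EG G) p :=
  have : IsManifold 𝓘(ℝ, EG) ∞ G := ContMDiffMul.toIsManifold
  contMDiffAt_extChartAt' (by simpa using hp)

theorem contDiffAt_chartOne_comp {f : E → G} {x : E} (hf : ContMDiffAt 𝓘(ℝ, E) 𝓘(ℝ, EG) ∞ f x)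
    (h : f x = 1) : ContDiffAt ℝ ∞ (fun z => chartOne EG G (f z)) x := by
  rw [← contMDiffAt_iff_contDiffAt]
  refine ContMDiffAt.comp x (contMDiffAt_chartOne ?_) hf
  rw [h]
  exact mem_extChartAt_source (1 : G)

variable (G) in
/-- The Maurer–Cartan form of `G` in the chart at the identity: at `a` it is the derivative of
`b ↦ p⁻¹ q` at `b = a`, where `p`, `q` are the points with coordinates `a`, `b`. -/
def mcForm (a : EG) : EG →L[ℝ] EG :=
  fderiv ℝ (fun b => chartOne EG G (((chartOne EG G).symm a)⁻¹ * (chartOne EG G).symm b)) a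

theorem contDiffAt_leftQuot {a : EG} (ha : a ∈ (chartOne EG G).target) :
    ContDiffAt ℝ ∞ (fun p : EG × EG =>
      chartOne EG G (((chartOne EG G).symm p.1)⁻¹ * (chartOne EG G).symm p.2)) (a, a) := by
  refine contDiffAt_chartOne_comp ?_ (by simp)
  have h := contMDiffAt_chartOne_symm (G := G) ha
  have h1 : ContMDiffAt 𝓘(ℝ, EG × EG) 𝓘(ℝ, EG) ∞ (fun p : EG × EG => (chartOne EG G).symm p.1) (a, a) :=
    ContMDiffAt.comp (a, a) (g := (chartOne EG G).symm) h contDiffAt_fst.contMDiffAt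
  have h2 : ContMDiffAt 𝓘(ℝ, EG × EG) 𝓘(ℝ, EG) ∞ (fun p : EG × EG => (chartOne EG G).symm p.2) (a, a) :=
    ContMDiffAt.comp (a, a) (g := (chartOne EG G).symm) h contDiffAt_snd.contMDiffAt
  exact h1.inv.mul h2

/-- The Maurer–Cartan form as a partial derivative of a smooth function of two variables. -/
theorem mcForm_eventually_eq {a : EG} (ha : a ∈ (chartOne EG G).target) :
    ∀ᶠ c in 𝓝 a, mcForm G c = fderiv ℝ (fun p : EG × EG =>
      chartOne EG G (((chartOne EG G).symm p.1)⁻¹ * (chartOne EG G).symm p.2)) (c, c) ∘L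
        ContinuousLinearMap.inr ℝ EG EG := by
  filter_upwards [(isOpen_extChartAt_target (I := 𝓘(ℝ, EG)) (1 : G)).mem_nhds ha] with c hc
  have := (contDiffAt_leftQuot hc).differentiableAt (by simp)
  exact (HasFDerivAt.comp c (f := fun y : EG => (c, y)) this.hasFDerivAt
    (hasFDerivAt_prodMk_right c c)).fderiv

theorem contDiffAt_mcForm {a : EG} (ha : a ∈ (chartOne EG G).target) :
    ContDiffAt ℝ ∞ (mcForm G : EG → EG →L[ℝ] EG) a := by
  refine ContDiffAt.congr_of_eventuallyEq ?_ (mcForm_eventually_eq ha)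
  refine ContDiffAt.clm_comp ?_ contDiffAt_const
  exact ((contDiffAt_leftQuot ha).fderiv_right (m := ∞) (by simp)).comp a
    (f := fun c : EG => (c, c)) (contDiffAt_id.prodMk contDiffAt_id)

variable (EG G) in
theorem chartOne_one_mem : chartOne EG G 1 ∈ (chartOne EG G).target := mem_extChartAt_target (1 : G)

@[simp] theorem chartOne_symm_one : (chartOne EG G).symm (chartOne EG G 1) = 1 :=
  extChartAt_to_inv (1 : G)

theorem mcForm_one : mcForm G (chartOne EG G 1) = ContinuousLinearMap.id ℝ EG := by
  have : (fun b => chartOne EG G (((chartOne EG G).symm (chartOne EG G 1))⁻¹ * (chartOne EG G).symm b))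
      =ᶠ[𝓝 (chartOne EG G 1)] id := by
    filter_upwards [(isOpen_extChartAt_target (I := 𝓘(ℝ, EG)) (1 : G)).mem_nhds
      (chartOne_one_mem EG G)] with b hb
    rw [chartOne_symm_one, inv_one, one_mul]
    exact (chartOne EG G).right_inv hb
  rw [mcForm, this.fderiv_eq, fderiv_id]

theorem mfderiv_inv_mul_comp_mul (p : G) (v : EG) :
    (mfderiv 𝓘(ℝ, EG) 𝓘(ℝ, EG) (fun q : G => p⁻¹ * q) p : EG →L[ℝ] EG)
      ((mfderiv 𝓘(ℝ, EG) 𝓘(ℝ, EG) (fun q : G => p * q) 1 : EG →L[ℝ] EG) v) = v := by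
  have h1 : MDifferentiableAt 𝓘(ℝ, EG) 𝓘(ℝ, EG) (fun q : G => p * q) 1 :=
    (contMDiff_mul_left (I := 𝓘(ℝ, EG)) (n := ∞)).mdifferentiable (by simp) _
  have h2 : MDifferentiableAt 𝓘(ℝ, EG) 𝓘(ℝ, EG) (fun q : G => p⁻¹ * q) (p * 1) :=
    (contMDiff_mul_left (I := 𝓘(ℝ, EG)) (n := ∞)).mdifferentiable (by simp) _
  have h3 := mfderiv_comp (1 : G) h2 h1
  have h4 : ((fun q : G => p⁻¹ * q) ∘ fun q => p * q) = id := by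
    funext q; simp
  rw [h4, mfderiv_id] at h3
  have h5 := congrArg (fun L : EG →L[ℝ] EG => L v) h3
  rw [mul_one] at h5
  exact h5.symm

/-- The Maurer–Cartan form is the derivative of the left translation to the identity, precomposed with
the derivative of the inverse chart. -/
theorem mcForm_eq_mfderiv {a : EG} (ha : a ∈ (chartOne EG G).target) (v : EG) :
    mcForm G a v =
      (mfderiv 𝓘(ℝ, EG) 𝓘(ℝ, EG) (fun q : G => ((chartOne EG G).symm a)⁻¹ * q)
        ((chartOne EG G).symm a) : EG →L[ℝ] EG)
      ((mfderiv 𝓘(ℝ, EG) 𝓘(ℝ, EG) (chartOne EG G).symm a : EG →L[ℝ] EG) v) := by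
  have h1 := contMDiffAt_chartOne_symm (G := G) ha
  have h2 : ContMDiff 𝓘(ℝ, EG) 𝓘(ℝ, EG) ∞ (fun q : G => ((chartOne EG G).symm a)⁻¹ * q) :=
    contMDiff_mul_left
  have h3 := mfderiv_comp a (h2.mdifferentiable (by simp) _) (h1.mdifferentiableAt (by simp))
  have h4 := mfderiv_eq_fderiv_chartOne ((h2 _).comp a h1) (by simp)
  rw [h3] at h4
  exact (congrArg (fun L : EG →L[ℝ] EG => L v) h4).symm

variable (EG G) in
/-- The left-invariant vector field of `v` in the chart at the identity. -/
def leftField (v : EG) : EG → EG :=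
  mpullbackWithin 𝓘(ℝ, EG) 𝓘(ℝ, EG) (chartOne EG G).symm
    (mulInvariantVectorField (G := G) (I := 𝓘(ℝ, EG)) v) (Set.range 𝓘(ℝ, EG))

/-- The Maurer–Cartan form is constant on left-invariant fields. -/
theorem mcForm_leftField {a : EG} (ha : a ∈ (chartOne EG G).target) (v : EG) :
    mcForm G a (leftField EG G v a) = v := by
  have : IsManifold 𝓘(ℝ, EG) ∞ G := ContMDiffMul.toIsManifold
  have : IsManifold 𝓘(ℝ, EG) 1 G := IsManifold.of_le (n := ∞) (by simp)
  rw [mcForm_eq_mfderiv ha]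
  have h : (mfderivWithin 𝓘(ℝ, EG) 𝓘(ℝ, EG) (chartOne EG G).symm (Set.range 𝓘(ℝ, EG)) a).IsInvertible :=
    isInvertible_mfderivWithin_extChartAt_symm ha
  have h2 : (mfderiv 𝓘(ℝ, EG) 𝓘(ℝ, EG) (chartOne EG G).symm a : EG →L[ℝ] EG) (leftField EG G v a) =
      (mfderiv 𝓘(ℝ, EG) 𝓘(ℝ, EG) (fun q : G => (chartOne EG G).symm a * q) 1 : EG →L[ℝ] EG) v := by
    have h3 : (mfderivWithin 𝓘(ℝ, EG) 𝓘(ℝ, EG) (chartOne EG G).symm (Set.range 𝓘(ℝ, EG)) a :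
        EG →L[ℝ] EG) (leftField EG G v a) = (mulInvariantVectorField (G := G) (I := 𝓘(ℝ, EG)) v
          ((chartOne EG G).symm a) : EG) := by
      obtain ⟨e, he⟩ := h
      rw [leftField, mpullbackWithin_apply, ← he, ContinuousLinearMap.inverse_equiv]
      exact e.apply_symm_apply _
    rwa [modelWithCornersSelf_coe, Set.range_id, mfderivWithin_univ] at h3
  rw [h2]
  exact mfderiv_inv_mul_comp_mul _ v

/-- The bracket of the Lie algebra, computed by the Lie bracket of left-invariant fields in the chart. -/
theorem bracket_eq_lieBracket [FiniteDimensional ℝ EG] (u v : EG) :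
    bracket G u v = lieBracket ℝ (leftField EG G u) (leftField EG G v) (chartOne EG G 1) := by
  have : IsManifold 𝓘(ℝ, EG) ∞ G := ContMDiffMul.toIsManifold
  have : IsManifold 𝓘(ℝ, EG) 1 G := IsManifold.of_le (n := ∞) (by simp)
  have h1 : bracket G u v = mlieBracket 𝓘(ℝ, EG)
      (mulInvariantVectorField (G := G) (I := 𝓘(ℝ, EG)) u)
      (mulInvariantVectorField (G := G) (I := 𝓘(ℝ, EG)) v) (1 : G) := rfl
  rw [h1, ← mlieBracketWithin_univ, mlieBracketWithin_apply, mfderiv_extChartAt_self]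
  simp only [Set.preimage_univ, Set.univ_inter, modelWithCornersSelf_coe, Set.range_id]
  rw [← lieBracketWithin_univ]
  have h2 : ∀ w, leftField EG G w = mpullbackWithin 𝓘(ℝ, EG) 𝓘(ℝ, EG) (chartOne EG G).symm
    (mulInvariantVectorField (G := G) (I := 𝓘(ℝ, EG)) w) Set.univ := fun w => by
      unfold leftField; rw [modelWithCornersSelf_coe, Set.range_id]
  rw [h2, h2]
  exact congrArg (fun L : EG →L[ℝ] EG => L _) (ContinuousLinearMap.inverse_id (R := ℝ) (M := EG))

theorem eventually_isInvertible_mcForm [FiniteDimensional ℝ EG] :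
    ∀ᶠ a in 𝓝 (chartOne EG G 1), (mcForm G a).IsInvertible := by
  have hc : ContinuousAt (mcForm G : EG → EG →L[ℝ] EG) (chartOne EG G 1) :=
    (contDiffAt_mcForm (chartOne_one_mem EG G)).continuousAt
  have : CompleteSpace EG := FiniteDimensional.complete ℝ EG
  refine hc.eventually (?_ : ∀ᶠ L in 𝓝 (mcForm G (chartOne EG G 1)), L.IsInvertible)
  rw [mcForm_one]
  exact (ContinuousLinearEquiv.refl ℝ EG).nhds

theorem leftField_eventually_eq [FiniteDimensional ℝ EG] (v : EG) :
    leftField EG G v =ᶠ[𝓝 (chartOne EG G 1)] fun a => (mcForm G a).inverse v := by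
  filter_upwards [eventually_isInvertible_mcForm (G := G), (isOpen_extChartAt_target (I := 𝓘(ℝ, EG)) (1 : G)).mem_nhds
      (chartOne_one_mem EG G)] with a ha ha'
  obtain ⟨e, he⟩ := ha
  have h := mcForm_leftField ha' v
  rw [← he] at h ⊢
  rw [ContinuousLinearMap.inverse_equiv]
  exact (e.symm_apply_eq.2 h.symm).symm

theorem leftField_one [FiniteDimensional ℝ EG] (v : EG) :
    leftField EG G v (chartOne EG G 1) = v := by
  have h := (leftField_eventually_eq (G := G) v).self_of_nhds
  simp only [mcForm_one, ContinuousLinearMap.inverse_id] at h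
  exact h

theorem contDiffAt_leftField [FiniteDimensional ℝ EG] (v : EG) :
    ContDiffAt ℝ ∞ (leftField EG G v) (chartOne EG G 1) := by
  have : CompleteSpace EG := FiniteDimensional.complete ℝ EG
  refine ContDiffAt.congr_of_eventuallyEq ?_ (leftField_eventually_eq v)
  refine ContDiffAt.clm_apply ?_ contDiffAt_const
  refine ContDiffAt.comp (chartOne EG G 1) (g := ContinuousLinearMap.inverse) ?_
    (contDiffAt_mcForm (chartOne_one_mem EG G))
  rw [mcForm_one]
  exact contDiffAt_map_inverse (ContinuousLinearEquiv.refl ℝ EG)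

/-- Differentiating `Θ(X_v) = v` for the left-invariant field `X_v`. -/
theorem fderiv_mcForm_apply [FiniteDimensional ℝ EG] (u v : EG) :
    fderiv ℝ (mcForm G) (chartOne EG G 1) u v = -fderiv ℝ (leftField EG G v) (chartOne EG G 1) u := by
  have h1 := (contDiffAt_mcForm (chartOne_one_mem EG G)).differentiableAt (by simp)
  have h2 := (contDiffAt_leftField (G := G) v).differentiableAt (by simp)
  have h3 := h1.hasFDerivAt.clm_apply h2.hasFDerivAt
  have h4 : (fun a => mcForm G a (leftField EG G v a)) =ᶠ[𝓝 (chartOne EG G 1)] fun _ => v := by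
    filter_upwards [(isOpen_extChartAt_target (I := 𝓘(ℝ, EG)) (1 : G)).mem_nhds
      (chartOne_one_mem EG G)] with a ha
    exact mcForm_leftField ha v
  have h5 := h3.fderiv
  rw [h4.fderiv_eq, fderiv_const_apply, mcForm_one, leftField_one] at h5
  have h6 := congrArg (fun L : EG →L[ℝ] EG => L u) h5
  simp only [zero_apply, add_apply, ContinuousLinearMap.flip_apply,
    ContinuousLinearMap.id_comp] at h6
  rw [eq_neg_iff_add_eq_zero, add_comm]
  exact h6.symm

/-- The Maurer–Cartan equation at the identity. -/
theorem fderiv_mcForm_sub [FiniteDimensional ℝ EG] (u v : EG) :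
    fderiv ℝ (mcForm G) (chartOne EG G 1) u v - fderiv ℝ (mcForm G) (chartOne EG G 1) v u =
      -bracket G u v := by
  rw [fderiv_mcForm_apply, fderiv_mcForm_apply, bracket_eq_lieBracket, lieBracket, leftField_one,
    leftField_one]
  abel

end Lie

/-! ### The adjoint representation -/

section Lie
open Filter Topology VectorField

variable {EG : Type*} [NormedAddCommGroup EG] [NormedSpace ℝ EG]
  {G : Type*} [TopologicalSpace G] [ChartedSpace EG G] [Group G] [LieGroup 𝓘(ℝ, EG) ∞ G]
  {E : Type*} [NormedAddCommGroup E] [NormedSpace ℝ E]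

theorem chartOne_target_mem_nhds {a : EG} (ha : a ∈ (chartOne EG G).target) :
    (chartOne EG G).target ∈ 𝓝 a :=
  (isOpen_extChartAt_target (I := 𝓘(ℝ, EG)) (1 : G)).mem_nhds ha

theorem chartOne_source_mem_nhds {p : G} (hp : p ∈ (chartOne EG G).source) :
    (chartOne EG G).source ∈ 𝓝 p :=
  (isOpen_extChartAt_source (I := 𝓘(ℝ, EG)) (1 : G)).mem_nhds hp

/-- The pullback of the Maurer–Cartan form under a map, by the chain rule. -/
theorem mcForm_comp_fderiv {H : E → EG} {y : E} (hH : DifferentiableAt ℝ H y)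
    (hy : H y ∈ (chartOne EG G).target) : mcForm G (H y) ∘L fderiv ℝ H y =
      fderiv ℝ (fun z => chartOne EG G
        (((chartOne EG G).symm (H y))⁻¹ * (chartOne EG G).symm (H z))) y := by
  have h1 : DifferentiableAt ℝ (fun b : EG => chartOne EG G
      (((chartOne EG G).symm (H y))⁻¹ * (chartOne EG G).symm b)) (H y) :=
    ((contDiffAt_leftQuot hy).differentiableAt (by simp)).comp (H y) (f := fun b : EG => (H y, b))
      (by fun_prop)
  exact (h1.hasFDerivAt.comp y hH.hasFDerivAt).fderiv.symm

theorem contMDiff_conj (g : G) : ContMDiff 𝓘(ℝ, EG) 𝓘(ℝ, EG) ∞ (fun h : G => g * h * g⁻¹) :=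
  contMDiff_mul_right.comp contMDiff_mul_left

/-- `Ad g` is the derivative at the identity of conjugation by `g`, read in the chart. -/
theorem Ad_eq_fderiv (g : G) : (Ad g : EG →L[ℝ] EG) =
    fderiv ℝ (fun b => chartOne EG G (g * (chartOne EG G).symm b * g⁻¹)) (chartOne EG G 1) := by
  have hd : MDifferentiableAt 𝓘(ℝ, EG) 𝓘(ℝ, EG) (fun h : G => g * h * g⁻¹) 1 :=
    (contMDiff_conj g).mdifferentiable (by simp) 1
  rw [Ad, hd.mfderiv]
  have h1 : g * 1 * g⁻¹ = 1 := by simp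
  simp only [writtenInExtChartAt, h1, modelWithCornersSelf_coe, Set.range_id, fderivWithin_univ]
  rfl

/-- Conjugation by `g` is smooth near the identity in the chart. -/
theorem contDiffAt_conjChart (g : G) : ContDiffAt ℝ ∞
    (fun b => chartOne EG G (g * (chartOne EG G).symm b * g⁻¹)) (chartOne EG G 1) :=
  contDiffAt_chartOne_comp ((contMDiff_conj g).contMDiffAt.comp (chartOne EG G 1)
    (contMDiffAt_chartOne_symm (chartOne_one_mem EG G))) (by simp)

theorem Ad_one : (Ad (1 : G) : EG →L[ℝ] EG) = ContinuousLinearMap.id ℝ EG := by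
  rw [Ad_eq_fderiv]
  have : (fun b => chartOne EG G (1 * (chartOne EG G).symm b * 1⁻¹)) =ᶠ[𝓝 (chartOne EG G 1)] id := by
    filter_upwards [chartOne_target_mem_nhds (chartOne_one_mem EG G)] with b hb
    simpa using (chartOne EG G).right_inv hb
  rw [this.fderiv_eq, fderiv_id]

theorem eventually_conj_mem_source (g : G) : ∀ᶠ b in 𝓝 (chartOne EG G 1),
    g * (chartOne EG G).symm b * g⁻¹ ∈ (chartOne EG G).source := by
  have hc : ContinuousAt (fun b => g * (chartOne EG G).symm b * g⁻¹) (chartOne EG G 1) :=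
    ((contMDiff_conj g).contMDiffAt.comp (chartOne EG G 1)
      (contMDiffAt_chartOne_symm (chartOne_one_mem EG G))).continuousAt
  refine hc.eventually_mem (chartOne_source_mem_nhds ?_)
  simpa using mem_extChartAt_source (I := 𝓘(ℝ, EG)) (1 : G)

theorem Ad_mul (g h : G) : (Ad (g * h) : EG →L[ℝ] EG) = Ad g ∘L Ad h := by
  rw [Ad_eq_fderiv, Ad_eq_fderiv h]
  have h1 : (fun b => chartOne EG G (g * h * (chartOne EG G).symm b * (g * h)⁻¹)) =ᶠ[𝓝 (chartOne EG G 1)]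
      (fun b => chartOne EG G (g * (chartOne EG G).symm b * g⁻¹)) ∘
        fun b => chartOne EG G (h * (chartOne EG G).symm b * h⁻¹) := by
    filter_upwards [eventually_conj_mem_source h] with b hb
    simp only [Function.comp, (chartOne EG G).left_inv hb]
    congr 1
    group
  have h2 : chartOne EG G (h * (chartOne EG G).symm (chartOne EG G 1) * h⁻¹) = chartOne EG G 1 := by
    simp
  have h3 := (contDiffAt_conjChart (EG := EG) g).differentiableAt (by simp)
  rw [← h2] at h3
  have h4 := (h3.hasFDerivAt.comp (chartOne EG G 1)
    (f := fun b => chartOne EG G (h * (chartOne EG G).symm b * h⁻¹))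
    ((contDiffAt_conjChart (EG := EG) h).differentiableAt (by simp)).hasFDerivAt).fderiv
  rw [h1.fderiv_eq, h4, h2, ← Ad_eq_fderiv]

variable [FiniteDimensional ℝ EG]

/-- The adjoint action preserves the Lie bracket: conjugation pulls the Maurer–Cartan form `Θ` back to
`Ad g ∘ Θ`, and the bracket is minus the antisymmetrized derivative of `Θ` at the identity. -/
theorem Ad_bracket (g : G) (u v : EG) :
    Ad g (bracket G u v) = bracket G (Ad g u) (Ad g v) := by
  set o := chartOne EG G 1 with ho
  set C : EG → EG := fun b => chartOne EG G (g * (chartOne EG G).symm b * g⁻¹) with hC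
  have hC1 : ContDiffAt ℝ ∞ C o := contDiffAt_conjChart g
  have hCo : C o = o := by simp [hC, ho]
  have hAd : (Ad g : EG →L[ℝ] EG) = fderiv ℝ C o := Ad_eq_fderiv g
  -- conjugation `C` pulls the Maurer–Cartan form back to `Ad g ∘ Θ`
  have key : ∀ᶠ c in 𝓝 o, Ad g ∘L mcForm G c = mcForm G (C c) ∘L fderiv ℝ C c := by
    filter_upwards [(hC1.of_le (m := 1) (by simp)).eventually (by simp), eventually_conj_mem_source g,
      chartOne_target_mem_nhds (chartOne_one_mem EG G)] with c hc hc2 hc3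
    have hCt : C c ∈ (chartOne EG G).target := (chartOne EG G).map_source hc2
    rw [mcForm_comp_fderiv (hc.differentiableAt (by simp)) hCt]
    have hq := (contDiffAt_leftQuot hc3).comp c (f := fun b : EG => (c, b))
      (contDiffAt_const.prodMk contDiffAt_id)
    have hqc : ContinuousAt (fun b => ((chartOne EG G).symm c)⁻¹ * (chartOne EG G).symm b) c :=
      ((contMDiff_mul_left (I := 𝓘(ℝ, EG)) (n := ∞)).contMDiffAt.comp c
        (contMDiffAt_chartOne_symm hc3)).continuousAt
    have hsrc : ∀ᶠ b in 𝓝 c, ((chartOne EG G).symm c)⁻¹ * (chartOne EG G).symm b ∈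
        (chartOne EG G).source :=
      hqc.eventually_mem (chartOne_source_mem_nhds
        (by simp))
    have hcont : ∀ᶠ b in 𝓝 c, g * (chartOne EG G).symm b * g⁻¹ ∈ (chartOne EG G).source :=
      (((contMDiff_conj g).contMDiffAt.comp c (contMDiffAt_chartOne_symm hc3)).continuousAt
        ).eventually_mem (chartOne_source_mem_nhds hc2)
    have h1 : (fun b => chartOne EG G (((chartOne EG G).symm (C c))⁻¹ * (chartOne EG G).symm (C b)))
        =ᶠ[𝓝 c] C ∘ fun b => chartOne EG G (((chartOne EG G).symm c)⁻¹ * (chartOne EG G).symm b) := by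
      filter_upwards [hsrc, hcont] with b hb hb2
      simp only [hC, Function.comp, (chartOne EG G).left_inv hb, (chartOne EG G).left_inv hb2,
        (chartOne EG G).left_inv hc2]
      congr 1
      group
    have h2 : chartOne EG G (((chartOne EG G).symm c)⁻¹ * (chartOne EG G).symm c) = o := by simp [ho]
    have h3 := hC1.differentiableAt (by simp)
    rw [← h2] at h3
    have h4 := (h3.hasFDerivAt.comp c (hq.differentiableAt (by simp)).hasFDerivAt).fderiv
    simp only [Function.comp_def] at h1 h4
    rw [h1.fderiv_eq, h4, h2, hAd]
    rfl
  -- differentiate this identity at the identity of the group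
  have hmc := (contDiffAt_mcForm (chartOne_one_mem EG G)).differentiableAt (by simp)
  have hCd := hC1.differentiableAt (by simp)
  have hCd' := (hC1.fderiv_right (m := ∞) (by simp)).differentiableAt (by simp)
  have hL : HasFDerivAt (fun c => (Ad g : EG →L[ℝ] EG) ∘L mcForm G c) _ o :=
    (hasFDerivAt_const (Ad g : EG →L[ℝ] EG) o).clm_comp hmc.hasFDerivAt
  have hmc' := hmc
  change DifferentiableAt ℝ (mcForm G) o at hmc'
  rw [← hCo] at hmc'
  have hR := (hmc'.hasFDerivAt.comp o hCd.hasFDerivAt).clm_comp hCd'.hasFDerivAt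
  have hD := Filter.EventuallyEq.fderiv_eq (𝕜 := ℝ) key
  rw [hL.fderiv] at hD
  simp only [Function.comp_def] at hR
  rw [hR.fderiv] at hD
  have hmo : mcForm G o = ContinuousLinearMap.id ℝ EG := mcForm_one
  have hD2 : ∀ u v, Ad g (fderiv ℝ (mcForm G) o u v) =
      fderiv ℝ (fderiv ℝ C) o u v + fderiv ℝ (mcForm G) o (Ad g u) (Ad g v) := by
    intro u v
    have := congrArg (fun L : EG →L[ℝ] EG →L[ℝ] EG => L u v) hD
    simp only [add_apply, ContinuousLinearMap.comp_apply, ContinuousLinearMap.compL_apply,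
      ContinuousLinearMap.flip_apply, zero_apply, map_zero, add_zero, hCo, hmo, ← hAd,
      ContinuousLinearMap.id_apply, ContinuousLinearMap.id_comp, ← ho] at this
    exact this
  -- the second derivative of `C` is symmetric and drops out on antisymmetrization
  have hsymm : fderiv ℝ (fderiv ℝ C) o u v = fderiv ℝ (fderiv ℝ C) o v u :=
    (hC1.isSymmSndFDerivAt
    (by simpa using WithTop.coe_le_coe.2 (le_top : (2 : ℕ∞) ≤ ⊤))).eq u v
  have h1 := fderiv_mcForm_sub (G := G) u v
  have h2 := fderiv_mcForm_sub (G := G) (Ad g u) (Ad g v)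
  rw [eq_neg_iff_add_eq_zero] at h1 h2
  have h3 := congrArg (fun x => (Ad g : EG →L[ℝ] EG) x) h1
  simp only [map_add, map_sub, map_zero] at h3
  change Ad g (fderiv ℝ (mcForm G) o u v) - Ad g (fderiv ℝ (mcForm G) o v u) + _ = 0 at h3
  change fderiv ℝ (mcForm G) o (Ad g u) (Ad g v) - fderiv ℝ (mcForm G) o (Ad g v) (Ad g u) + _ = 0 at h2
  rw [hD2, hD2, hsymm] at h3
  have h4 := h3.trans h2.symm
  rw [add_sub_add_left_eq_sub] at h4
  exact add_left_cancel h4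

end Lie

/-! ### Derivative of the adjoint representation and logarithmic derivatives -/

section Lie
open Filter Topology VectorField

variable {EG : Type*} [NormedAddCommGroup EG] [NormedSpace ℝ EG]
  {G : Type*} [TopologicalSpace G] [ChartedSpace EG G] [Group G] [LieGroup 𝓘(ℝ, EG) ∞ G]
  {E : Type*} [NormedAddCommGroup E] [NormedSpace ℝ E]

/-- `Ad(p⁻¹)` is a smooth function of the chart coordinates of `p`, as a partial derivative of
`(p, q) ↦ p⁻¹ q p`. -/
theorem contDiffAt_Ad_inv_chart :
    ContDiffAt ℝ ∞ (fun a : EG => (Ad ((chartOne EG G).symm a)⁻¹ : EG →L[ℝ] EG)) (chartOne EG G 1) := by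
  set o := chartOne EG G 1 with ho
  have hot := chartOne_one_mem EG G
  let K : EG × EG → EG := fun p => chartOne EG G
    (((chartOne EG G).symm p.1)⁻¹ * (chartOne EG G).symm p.2 * (((chartOne EG G).symm p.1)⁻¹)⁻¹)
  have hK : ∀ a ∈ (chartOne EG G).target, ContDiffAt ℝ ∞ K (a, o) := by
    intro a ha
    refine contDiffAt_chartOne_comp ?_ (by simp [ho])
    have h1 : ContMDiffAt 𝓘(ℝ, EG × EG) 𝓘(ℝ, EG) ∞ (fun p : EG × EG => (chartOne EG G).symm p.1) (a, o) :=
      ContMDiffAt.comp (a, o) (g := (chartOne EG G).symm) (contMDiffAt_chartOne_symm ha)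
        contDiffAt_fst.contMDiffAt
    have h2 : ContMDiffAt 𝓘(ℝ, EG × EG) 𝓘(ℝ, EG) ∞ (fun p : EG × EG => (chartOne EG G).symm p.2) (a, o) :=
      ContMDiffAt.comp (a, o) (g := (chartOne EG G).symm) (contMDiffAt_chartOne_symm hot)
        contDiffAt_snd.contMDiffAt
    exact (h1.inv.mul h2).mul h1.inv.inv
  have heq : (fun a : EG => (Ad ((chartOne EG G).symm a)⁻¹ : EG →L[ℝ] EG)) =ᶠ[𝓝 o]
      fun a => fderiv ℝ K (a, o) ∘L ContinuousLinearMap.inr ℝ EG EG := by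
    filter_upwards [chartOne_target_mem_nhds hot] with a ha
    rw [Ad_eq_fderiv]
    exact (HasFDerivAt.comp o (f := fun y : EG => (a, y))
      ((hK a ha).differentiableAt (by simp)).hasFDerivAt (hasFDerivAt_prodMk_right a o)).fderiv
  refine ContDiffAt.congr_of_eventuallyEq ?_ heq
  refine ContDiffAt.clm_comp ?_ contDiffAt_const
  exact ((hK o hot).fderiv_right (m := ∞) (by simp)).comp o
    (f := fun c : EG => (c, o)) (contDiffAt_id.prodMk contDiffAt_const)

variable [FiniteDimensional ℝ EG]

/-- The derivative at the identity of `p ↦ Ad(p⁻¹)` is `-ad`. -/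
theorem fderiv_Ad_inv_chart (u ζ : EG) :
    fderiv ℝ (fun a : EG => (Ad ((chartOne EG G).symm a)⁻¹ : EG →L[ℝ] EG)) (chartOne EG G 1) u ζ =
      -bracket G u ζ := by
  set o := chartOne EG G 1 with ho
  have hot : o ∈ (chartOne EG G).target := chartOne_one_mem EG G
  let m : EG × EG → EG := fun p => chartOne EG G ((chartOne EG G).symm p.1 * (chartOne EG G).symm p.2)
  have hmc : ∀ p : EG × EG, p.1 ∈ (chartOne EG G).target → p.2 ∈ (chartOne EG G).target →
      ContMDiffAt 𝓘(ℝ, EG × EG) 𝓘(ℝ, EG) ∞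
      (fun p : EG × EG => (chartOne EG G).symm p.1 * (chartOne EG G).symm p.2) p := by
    intro p hp1 hp2
    have h1 : ContMDiffAt 𝓘(ℝ, EG × EG) 𝓘(ℝ, EG) ∞ (fun p : EG × EG => (chartOne EG G).symm p.1) p :=
      ContMDiffAt.comp p (g := (chartOne EG G).symm) (contMDiffAt_chartOne_symm hp1)
        contDiffAt_fst.contMDiffAt
    have h2 : ContMDiffAt 𝓘(ℝ, EG × EG) 𝓘(ℝ, EG) ∞ (fun p : EG × EG => (chartOne EG G).symm p.2) p :=
      ContMDiffAt.comp p (g := (chartOne EG G).symm) (contMDiffAt_chartOne_symm hp2)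
        contDiffAt_snd.contMDiffAt
    exact h1.mul h2
  have hm : ContDiffAt ℝ ∞ m (o, o) := contDiffAt_chartOne_comp (hmc (o, o) hot hot) (by simp [ho])
  have hm' : ∀ᶠ p in 𝓝 (o, o), ContDiffAt ℝ 1 m p :=
    (hm.of_le (m := 1) (by simp)).eventually (by simp)
  have hoo : (chartOne EG G).symm o = 1 := chartOne_symm_one
  have hmo : ∀ a ∈ (chartOne EG G).target, m (o, a) = a := fun a ha => by
    simp only [m, hoo, one_mul, (chartOne EG G).right_inv ha]
  have hom : ∀ a ∈ (chartOne EG G).target, m (a, o) = a := fun a ha => by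
    simp only [m, hoo, mul_one, (chartOne EG G).right_inv ha]
  -- `Ad(p⁻¹)ζ` is the Maurer–Cartan form applied to the right-invariant field of `ζ`.
  have hA : ∀ᶠ a in 𝓝 o, (Ad ((chartOne EG G).symm a)⁻¹ : EG →L[ℝ] EG) ζ =
      mcForm G a (fderiv ℝ (fun c => m (c, a)) o ζ) := by
    have hc : ContinuousAt (fun a : EG => (o, a)) o := by fun_prop
    filter_upwards [chartOne_target_mem_nhds hot, hc.eventually hm'] with a ha ha2
    have hd : DifferentiableAt ℝ (fun c => m (c, a)) o :=
      (ha2.differentiableAt (by simp)).comp o (f := fun c : EG => (c, a)) (by fun_prop)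
    have h1 := mcForm_comp_fderiv (G := G) (H := fun c => m (c, a)) (y := o) hd (by simpa [hmo a ha] using ha)
    simp only [hmo a ha] at h1
    have h2 : (fun z => chartOne EG G (((chartOne EG G).symm a)⁻¹ * (chartOne EG G).symm (m (z, a)))) =ᶠ[𝓝 o]
        fun b => chartOne EG G (((chartOne EG G).symm a)⁻¹ * (chartOne EG G).symm b *
          (((chartOne EG G).symm a)⁻¹)⁻¹) := by
      have hcc : ContinuousAt (fun b : EG => (b, a)) o := by fun_prop
      have hsrc : ∀ᶠ b in 𝓝 o, (chartOne EG G).symm b * (chartOne EG G).symm a ∈ (chartOne EG G).source := by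
        have := (hmc (o, a) hot ha).continuousAt.comp (f := fun b : EG => (b, a)) hcc
        refine this.eventually_mem (chartOne_source_mem_nhds ?_)
        simp only [Function.comp, hoo, one_mul]
        exact (chartOne EG G).map_target ha
      filter_upwards [hsrc] with b hb
      simp only [m, (chartOne EG G).left_inv hb, inv_inv, mul_assoc]
    rw [Ad_eq_fderiv, ← h2.fderiv_eq, ← h1]
    rfl
  -- the left-invariant fields are the other partial derivatives of the multiplication
  have hB : (fun c => fderiv ℝ (fun a => m (c, a)) o u) =ᶠ[𝓝 o] leftField EG G u := by
    have hc : ContinuousAt (fun a : EG => (a, o)) o := by fun_prop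
    filter_upwards [chartOne_target_mem_nhds hot, hc.eventually hm',
      eventually_isInvertible_mcForm (G := G)] with c hct hc2 hinv
    have hd : DifferentiableAt ℝ (fun a => m (c, a)) o :=
      (hc2.differentiableAt (by simp)).comp o (f := fun a : EG => (c, a)) (by fun_prop)
    have h1 := mcForm_comp_fderiv (G := G) (H := fun a => m (c, a)) (y := o) hd (by simpa [hom c hct] using hct)
    simp only [hom c hct] at h1
    have h2 : (fun z => chartOne EG G (((chartOne EG G).symm c)⁻¹ * (chartOne EG G).symm (m (c, z)))) =ᶠ[𝓝 o]
        id := by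
      have hcc : ContinuousAt (fun b : EG => (c, b)) o := by fun_prop
      have hsrc : ∀ᶠ b in 𝓝 o, (chartOne EG G).symm c * (chartOne EG G).symm b ∈ (chartOne EG G).source := by
        have := (hmc (c, o) hct hot).continuousAt.comp (f := fun b : EG => (c, b)) hcc
        refine this.eventually_mem (chartOne_source_mem_nhds ?_)
        simp only [Function.comp, hoo, mul_one]
        exact (chartOne EG G).map_target hct
      filter_upwards [hsrc, chartOne_target_mem_nhds hot] with b hb hb2
      simp only [m, (chartOne EG G).left_inv hb, inv_mul_cancel_left, (chartOne EG G).right_inv hb2, id]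
    rw [h2.fderiv_eq, fderiv_id] at h1
    have h3 := congrArg (fun L : EG →L[ℝ] EG => L u) h1
    have h4 := mcForm_leftField hct u
    obtain ⟨e, he⟩ := hinv
    rw [← he] at h3 h4
    exact e.injective (h3.trans h4.symm)
  have hmcd := (contDiffAt_mcForm hot).differentiableAt (by simp)
  have hY : DifferentiableAt ℝ (fun a => fderiv ℝ (fun c => m (c, a)) o ζ) o := by
    have hc : ContinuousAt (fun a : EG => (o, a)) o := by fun_prop
    have h1 : (fun a => fderiv ℝ (fun c => m (c, a)) o ζ) =ᶠ[𝓝 o]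
        fun a => fderiv ℝ m (o, a) (ζ, 0) := by
      filter_upwards [hc.eventually hm'] with a ha2
      have h := (HasFDerivAt.comp o (f := fun c : EG => (c, a))
        (ha2.differentiableAt (by simp)).hasFDerivAt (hasFDerivAt_prodMk_left o a)).fderiv
      simp only [Function.comp_def] at h
      rw [h]
      simp
    refine DifferentiableAt.congr_of_eventuallyEq ?_ h1
    have h2 := ((hm.fderiv_right (m := ∞) (by simp)).comp o (f := fun a : EG => (o, a))
      (contDiffAt_const.prodMk contDiffAt_id)).differentiableAt (by simp)
    exact h2.clm_apply (differentiableAt_const _)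
  have hAd := (contDiffAt_Ad_inv_chart (EG := EG) (G := G)).differentiableAt (by simp)
  have h1 : fderiv ℝ (fun a : EG => (Ad ((chartOne EG G).symm a)⁻¹ : EG →L[ℝ] EG) ζ) o u =
      fderiv ℝ (fun a : EG => (Ad ((chartOne EG G).symm a)⁻¹ : EG →L[ℝ] EG)) o u ζ := by
    have h := (hAd.hasFDerivAt.clm_apply (hasFDerivAt_const ζ o)).fderiv
    rw [h]
    simp
    rfl
  have hY0 : fderiv ℝ (fun c => m (c, o)) o ζ = ζ := by
    have : (fun c => m (c, o)) =ᶠ[𝓝 o] id := by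
      filter_upwards [chartOne_target_mem_nhds hot] with a ha using hom a ha
    rw [this.fderiv_eq, fderiv_id]
    rfl
  have h2 := (hmcd.hasFDerivAt.clm_apply hY.hasFDerivAt).fderiv
  -- exchanging the derivatives of `m` relates the derivatives of the right- and left-invariant fields
  have h3 := fderiv_fderiv_swap (hm.of_le
    (by simpa using WithTop.coe_le_coe.2 (le_top : (2 : ℕ∞) ≤ ⊤))) ζ u
  rw [← h1, Filter.EventuallyEq.fderiv_eq (𝕜 := ℝ) hA, h2]
  simp only [add_apply, ContinuousLinearMap.comp_apply, ContinuousLinearMap.flip_apply, hY0]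
  rw [h3, hB.fderiv_eq, ← fderiv_mcForm_sub, fderiv_mcForm_apply ζ u]
  have : mcForm G o = ContinuousLinearMap.id ℝ EG := mcForm_one
  rw [this]
  simp only [ContinuousLinearMap.id_apply, sub_neg_eq_add]
  exact add_comm _ _

/-- `ad a` is skew for an `Ad`-invariant inner product: differentiate `⟨Ad(p⁻¹) u, Ad(p⁻¹) v⟩ = ⟨u, v⟩`
at the identity. -/
theorem AdInvariantInner.bracket_left (B : AdInvariantInner EG G) (a u v : EG) :
    B.form (bracket G a u) v = -B.form u (bracket G a v) := by
  have hAd := ((contDiffAt_Ad_inv_chart (EG := EG) (G := G)).differentiableAt (by simp)).hasFDerivAt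
  have hu := hAd.clm_apply (hasFDerivAt_const u _)
  have hv := hAd.clm_apply (hasFDerivAt_const v _)
  have h1 := ((B.form.hasFDerivAt.comp _ hu).clm_apply hv).fderiv
  have h2 : (fun a : EG => B.form ((Ad ((chartOne EG G).symm a)⁻¹ : EG →L[ℝ] EG) u)
      ((Ad ((chartOne EG G).symm a)⁻¹ : EG →L[ℝ] EG) v)) = fun _ => B.form u v := by
    funext a
    exact B.ad_invariant _ _ _
  simp only [Function.comp_def] at h1
  rw [h2, fderiv_const_apply] at h1
  have h4 : fderiv ℝ (fun a : EG => (Ad ((chartOne EG G).symm a)⁻¹ : EG →L[ℝ] EG)) (chartOne EG G 1) a =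
    -bracket G a := by
    ext ζ
    exact fderiv_Ad_inv_chart a ζ
  have h5 : (Ad ((chartOne EG G).symm (chartOne EG G 1))⁻¹ : EG →L[ℝ] EG) =
      ContinuousLinearMap.id ℝ EG := by
    rw [chartOne_symm_one, inv_one, Ad_one]
  have h3 := congrArg (fun L : EG →L[ℝ] ℝ => L a) h1
  rw [h5] at h3
  simp only [add_apply, ContinuousLinearMap.comp_apply, ContinuousLinearMap.flip_apply,
    ContinuousLinearMap.id_apply, zero_apply, map_zero, zero_add, h4, neg_apply, map_neg] at h3
  linarith [h3]

/-- The left logarithmic derivative `γ⁻¹ dγ` of a `G`-valued function on a normed space. -/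
def logDeriv (γ : E → G) (y : E) : E →L[ℝ] EG :=
  fderiv ℝ (fun z => chartOne EG G ((γ y)⁻¹ * γ z)) y

/-- Near `y`, the logarithmic derivative is the pullback of the Maurer–Cartan form under the coordinate
expression of `γ(y)⁻¹ γ`. -/
theorem logDeriv_eventually_eq {γ : E → G} {y : E}
    (hγ : ∀ᶠ z in 𝓝 y, ContMDiffAt 𝓘(ℝ, E) 𝓘(ℝ, EG) ∞ γ z) :
    (logDeriv γ : E → E →L[ℝ] EG) =ᶠ[𝓝 y] fun z =>
      mcForm G (chartOne EG G ((γ y)⁻¹ * γ z)) ∘L fderiv ℝ (fun z => chartOne EG G ((γ y)⁻¹ * γ z)) z := by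
  have hcs : ∀ᶠ z in 𝓝 y, (γ y)⁻¹ * γ z ∈ (chartOne EG G).source := by
    have hc : ContinuousAt (fun z => (γ y)⁻¹ * γ z) y :=
      ((contMDiff_mul_left (I := 𝓘(ℝ, EG)) (n := ∞)).contMDiffAt.comp y hγ.self_of_nhds).continuousAt
    exact hc.eventually_mem (chartOne_source_mem_nhds (by simp))
  filter_upwards [hγ, hcs, hcs.eventually_nhds] with z hz hzs hzs'
  have hd : ContDiffAt ℝ ∞ (fun z => chartOne EG G ((γ y)⁻¹ * γ z)) z := by
    rw [← contMDiffAt_iff_contDiffAt]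
    exact (contMDiffAt_chartOne hzs).comp z
      ((contMDiff_mul_left (I := 𝓘(ℝ, EG)) (n := ∞)).contMDiffAt.comp z hz)
  rw [mcForm_comp_fderiv (hd.differentiableAt (by simp)) ((chartOne EG G).map_source hzs)]
  refine Filter.EventuallyEq.fderiv_eq ?_
  filter_upwards [hzs'] with x hx
  rw [(chartOne EG G).left_inv hzs, (chartOne EG G).left_inv hx]
  congr 1
  group

theorem contDiffAt_quotChart {γ : E → G} {y : E} (hγ : ContMDiffAt 𝓘(ℝ, E) 𝓘(ℝ, EG) ∞ γ y) :
    ContDiffAt ℝ ∞ (fun z => chartOne EG G ((γ y)⁻¹ * γ z)) y :=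
  contDiffAt_chartOne_comp ((contMDiff_mul_left (I := 𝓘(ℝ, EG)) (n := ∞)).contMDiffAt.comp y hγ)
    (by simp)

theorem contDiffAt_logDeriv {γ : E → G} {y : E}
    (hγ : ∀ᶠ z in 𝓝 y, ContMDiffAt 𝓘(ℝ, E) 𝓘(ℝ, EG) ∞ γ z) :
    ContDiffAt ℝ ∞ (logDeriv γ : E → E →L[ℝ] EG) y := by
  refine ContDiffAt.congr_of_eventuallyEq ?_ (logDeriv_eventually_eq hγ)
  have hd := contDiffAt_quotChart hγ.self_of_nhds
  refine ContDiffAt.clm_comp ?_ (hd.fderiv_right (m := ∞) (by simp))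
  refine ContDiffAt.comp y (g := mcForm G) ?_ hd
  exact contDiffAt_mcForm (by simp)

/-- The Maurer–Cartan equation `dθ(v, w) = -[θ v, θ w]` for `θ = γ⁻¹ dγ`. -/
theorem fderiv_logDeriv_sub {γ : E → G} {y : E}
    (hγ : ∀ᶠ z in 𝓝 y, ContMDiffAt 𝓘(ℝ, E) 𝓘(ℝ, EG) ∞ γ z) (v w : E) :
    fderiv ℝ (logDeriv γ : E → E →L[ℝ] EG) y v w - fderiv ℝ (logDeriv γ : E → E →L[ℝ] EG) y w v =
      -bracket G (logDeriv γ y v) (logDeriv γ y w) := by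
  have hd := contDiffAt_quotChart hγ.self_of_nhds
  set H : E → EG := fun z => chartOne EG G ((γ y)⁻¹ * γ z) with hH
  have hHy : H y = chartOne EG G 1 := by simp [hH]
  have hmc := (contDiffAt_mcForm (chartOne_one_mem EG G)).differentiableAt (by simp)
  rw [← hHy] at hmc
  have hR := (hmc.hasFDerivAt.comp y (hd.differentiableAt (by simp)).hasFDerivAt).clm_comp
    ((hd.fderiv_right (m := ∞) (by simp)).differentiableAt (by simp)).hasFDerivAt
  simp only [Function.comp_def] at hR
  have h0 : (logDeriv γ y : E →L[ℝ] EG) = fderiv ℝ H y := rfl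
  have key : ∀ v w, fderiv ℝ (logDeriv γ : E → E →L[ℝ] EG) y v w =
      fderiv ℝ (fderiv ℝ H) y v w +
        fderiv ℝ (mcForm G) (chartOne EG G 1) (logDeriv γ y v) (logDeriv γ y w) := by
    intro v w
    rw [(logDeriv_eventually_eq hγ).fderiv_eq, hR.fderiv, h0]
    rw [hHy, mcForm_one]
    rfl
  have hsymm : fderiv ℝ (fderiv ℝ H) y v w = fderiv ℝ (fderiv ℝ H) y w v :=
    (hd.isSymmSndFDerivAt
    (by simpa using WithTop.coe_le_coe.2 (le_top : (2 : ℕ∞) ≤ ⊤))).eq v w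
  rw [key, key, ← fderiv_mcForm_sub, hsymm]
  abel

/-- Near `y`, `Ad(γ⁻¹)` factors through the coordinates of `γ(y)⁻¹ γ` in the chart at the identity. -/
theorem Ad_inv_comp_eventually_eq {γ : E → G} {y : E} (hγ : ContMDiffAt 𝓘(ℝ, E) 𝓘(ℝ, EG) ∞ γ y) :
    (fun z => (Ad (γ z)⁻¹ : EG →L[ℝ] EG)) =ᶠ[𝓝 y] fun z =>
      (Ad ((chartOne EG G).symm (chartOne EG G ((γ y)⁻¹ * γ z)))⁻¹ : EG →L[ℝ] EG) ∘L Ad (γ y)⁻¹ := by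
  have hcs : ∀ᶠ z in 𝓝 y, (γ y)⁻¹ * γ z ∈ (chartOne EG G).source := by
    have hc : ContinuousAt (fun z => (γ y)⁻¹ * γ z) y :=
      ((contMDiff_mul_left (I := 𝓘(ℝ, EG)) (n := ∞)).contMDiffAt.comp y hγ).continuousAt
    exact hc.eventually_mem (chartOne_source_mem_nhds (by simp))
  filter_upwards [hcs] with z hz
  rw [(chartOne EG G).left_inv hz, ← Ad_mul]
  congr 1
  group

theorem contDiffAt_Ad_inv_comp {γ : E → G} {y : E} (hγ : ContMDiffAt 𝓘(ℝ, E) 𝓘(ℝ, EG) ∞ γ y) :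
    ContDiffAt ℝ ∞ (fun z => (Ad (γ z)⁻¹ : EG →L[ℝ] EG)) y := by
  refine ContDiffAt.congr_of_eventuallyEq ?_ (Ad_inv_comp_eventually_eq hγ)
  refine ContDiffAt.clm_comp ?_ contDiffAt_const
  refine ContDiffAt.comp y (g := fun a : EG => (Ad ((chartOne EG G).symm a)⁻¹ : EG →L[ℝ] EG)) ?_
    (contDiffAt_quotChart hγ)
  simpa using contDiffAt_Ad_inv_chart (EG := EG) (G := G)

/-- The derivative of `Ad(γ⁻¹)` is `-ad(γ⁻¹ dγ) ∘ Ad(γ⁻¹)`. -/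
theorem fderiv_Ad_inv_comp {γ : E → G} {y : E} (hγ : ContMDiffAt 𝓘(ℝ, E) 𝓘(ℝ, EG) ∞ γ y)
    (v : E) (ξ : EG) : fderiv ℝ (fun z => (Ad (γ z)⁻¹ : EG →L[ℝ] EG)) y v ξ =
      -bracket G (logDeriv γ y v) (Ad (γ y)⁻¹ ξ) := by
  have hd := (contDiffAt_quotChart hγ).differentiableAt (by simp)
  have hA := (contDiffAt_Ad_inv_chart (EG := EG) (G := G)).differentiableAt (by simp)
  have hHy : chartOne EG G ((γ y)⁻¹ * γ y) = chartOne EG G 1 := by simp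
  rw [← hHy] at hA
  have h1 := (hA.hasFDerivAt.comp y (f := fun z => chartOne EG G ((γ y)⁻¹ * γ z))
    hd.hasFDerivAt).clm_comp (hasFDerivAt_const (Ad (γ y)⁻¹ : EG →L[ℝ] EG) y)
  simp only [Function.comp_def] at h1
  rw [(Ad_inv_comp_eventually_eq hγ).fderiv_eq, h1.fderiv, ← fderiv_Ad_inv_chart, ← hHy]
  simp [logDeriv]

end Lie

/-! ### Differential forms in charts -/

section FormsOnManifolds
open Filter Topology

variable {n : ℕ} {M : Type*} [TopologicalSpace M] [ChartedSpace (Model n) M]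
  [IsManifold (𝓡 (2 * n)) ∞ M]
  {V W X : Type*} [NormedAddCommGroup V] [NormedSpace ℝ V] [NormedAddCommGroup W] [NormedSpace ℝ W]
  [NormedAddCommGroup X] [NormedSpace ℝ X] {k l : ℕ}

variable (n) in
/-- The extended chart at `c`. -/
abbrev chartE (c : M) : PartialEquiv M (Model n) := extChartAt (𝓡 (2 * n)) c

/-- The derivative at `y` of the inverse chart, as a map from chart coordinates to `T_p M`,
`p = φ_c⁻¹ y`. -/
def jac (c : M) (y : Model n) : Model n →L[ℝ] Model n :=
  tangentCoordChange (𝓡 (2 * n)) c ((chartE n c).symm y) ((chartE n c).symm y)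

theorem inChart_eq (c : M) (η : M → Model n [⋀^Fin k]→L[ℝ] V) (y : Model n) :
    inChart c η y = (η ((chartE n c).symm y)).compContinuousLinearMap (jac c y) := rfl

theorem jac_bijective {c : M} {y : Model n} (hy : y ∈ (chartE n c).target) :
    Function.Bijective (jac c y) := by
  set p := (chartE n c).symm y with hp
  have hpc : p ∈ (chartE n c).source := (chartE n c).map_target hy
  have hpp : p ∈ (chartE n p).source := mem_extChartAt_source p
  refine Function.bijective_iff_has_inverse.2 ⟨tangentCoordChange (𝓡 (2 * n)) p c p, fun v => ?_, fun v => ?_⟩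
  · exact (tangentCoordChange_comp ⟨⟨hpc, hpp⟩, hpc⟩).trans (tangentCoordChange_self hpc)
  · exact (tangentCoordChange_comp ⟨⟨hpp, hpc⟩, hpp⟩).trans (tangentCoordChange_self hpp)

theorem jac_self (x : M) : jac x (chartE n x x) = ContinuousLinearMap.id ℝ (Model n) := by
  have h : (chartE n x).symm (chartE n x x) = x := extChartAt_to_inv x
  ext1 v
  rw [jac, h]
  exact tangentCoordChange_self (mem_extChartAt_source x)

theorem inChart_self (x : M) (η : M → Model n [⋀^Fin k]→L[ℝ] V) :
    inChart x η (chartE n x x) = η x := by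
  rw [inChart_eq, jac_self, show (chartE n x).symm (chartE n x x) = x from extChartAt_to_inv x]
  rfl

theorem isOpen_chartDomain (c : M) {U : Set M} (hU : IsOpen U) : IsOpen (chartDomain (n := n) c U) :=
  (continuousOn_extChartAt_symm c).isOpen_inter_preimage (isOpen_extChartAt_target c) hU

theorem chartE_self_mem_chartDomain {x : M} {U : Set M} (hx : x ∈ U) :
    chartE n x x ∈ chartDomain x U :=
  ⟨mem_extChartAt_target x, by
    rw [Set.mem_preimage, show (chartE n x).symm (chartE n x x) = x from extChartAt_to_inv x]; exact hx⟩

theorem chartDomain_subset (c : M) (U : Set M) : chartDomain c U ⊆ (chartE n c).target :=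
  Set.inter_subset_left

theorem chartDomain_univ (c : M) : chartDomain c Set.univ = (chartE n c).target := by
  simp [chartDomain]

/-- The transition map between two charts. -/
def chartTrans (c p : M) (y : Model n) : Model n := chartE n p ((chartE n c).symm y)

theorem contDiffOn_chartTrans (c p : M) :
    ContDiffOn ℝ ∞ (chartTrans (n := n) c p) (chartDomain c (chartE n p).source) := by
  have h := contDiffOn_ext_coord_change (I := 𝓡 (2 * n)) (n := ∞) p c
  refine h.mono ?_
  intro y hy
  rw [PartialEquiv.trans_source]
  exact ⟨hy.1, hy.2⟩

theorem isOpen_chartDomain_source (c p : M) : IsOpen (chartDomain (n := n) c (chartE n p).source) :=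
  isOpen_chartDomain c (isOpen_extChartAt_source p)

theorem contDiffAt_chartTrans {c p : M} {y : Model n} (hy : y ∈ chartDomain c (chartE n p).source) :
    ContDiffAt ℝ ∞ (chartTrans c p) y :=
  (contDiffOn_chartTrans c p).contDiffAt ((isOpen_chartDomain_source c p).mem_nhds hy)

theorem fderiv_chartTrans {c p : M} {y : Model n} (hy : y ∈ chartDomain c (chartE n p).source) :
    fderiv ℝ (chartTrans c p) y = tangentCoordChange (𝓡 (2 * n)) c p ((chartE n c).symm y) := by
  have h := hasFDerivWithinAt_tangentCoordChange (I := 𝓡 (2 * n)) (x := c) (y := p)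
    (z := (chartE n c).symm y) ⟨(chartE n c).map_target hy.1, hy.2⟩
  rw [show extChartAt (𝓡 (2 * n)) c ((chartE n c).symm y) = y from (chartE n c).right_inv hy.1] at h
  simp only [modelWithCornersSelf_coe, Set.range_id, hasFDerivWithinAt_univ] at h
  exact h.fderiv

/-- Coordinate expressions of a form in two charts are related by pullback. -/
theorem inChart_eq_pullback {c p : M} {y : Model n} (hy : y ∈ chartDomain c (chartE n p).source)
    (η : M → Model n [⋀^Fin k]→L[ℝ] V) : inChart c η y =
      (inChart p η (chartTrans c p y)).compContinuousLinearMap (fderiv ℝ (chartTrans c p) y) := by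
  have hb : (chartE n p).symm (chartTrans c p y) = (chartE n c).symm y := (chartE n p).left_inv hy.2
  have hq := (chartE n c).map_target hy.1
  rw [fderiv_chartTrans hy, inChart_eq, inChart_eq, jac, jac, hb]
  ext v
  simp only [ContinuousAlternatingMap.compContinuousLinearMap_apply]
  congr 1
  funext a
  exact (tangentCoordChange_comp ⟨⟨hq, hy.2⟩, mem_extChartAt_source _⟩).symm

theorem IsSmoothFormOn.contDiffAt {U : Set M} (hU : IsOpen U) {η : M → Model n [⋀^Fin k]→L[ℝ] V}
    (hη : IsSmoothFormOn U η) {c : M} {y : Model n} (hy : y ∈ chartDomain c U) :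
    ContDiffAt ℝ ∞ (inChart c η) y :=
  (hη c).contDiffAt ((isOpen_chartDomain c hU).mem_nhds hy)

/-- The exterior derivative can be computed in any chart. -/
theorem inChart_extDer {U : Set M} (hU : IsOpen U) {η : M → Model n [⋀^Fin k]→L[ℝ] V}
    (hη : IsSmoothFormOn U η) {c : M} {y : Model n} (hy : y ∈ chartDomain c U) :
    inChart c (extDer η) y = extDeriv (inChart c η) y := by
  set p := (chartE n c).symm y with hp
  have hy' : y ∈ chartDomain c (chartE n p).source := ⟨hy.1, mem_extChartAt_source p⟩
  have h1 : inChart c η =ᶠ[𝓝 y] fun z =>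
      (inChart p η (chartTrans c p z)).compContinuousLinearMap (fderiv ℝ (chartTrans c p) z) := by
    filter_upwards [(isOpen_chartDomain_source c p).mem_nhds hy'] with z hz
    exact inChart_eq_pullback hz η
  have hd : DifferentiableAt ℝ (inChart p η) (chartTrans c p y) :=
    (hη.contDiffAt hU (c := p) (chartE_self_mem_chartDomain hy.2)).differentiableAt (by simp)
  -- the exterior derivative commutes with the pullback under the transition map
  rw [h1.extDeriv_eq, extDeriv_pullback hd (contDiffAt_chartTrans hy')
    (by simpa using WithTop.coe_le_coe.2 (le_top : (2 : ℕ∞) ≤ ⊤)), fderiv_chartTrans hy']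
  rfl

theorem contDiffOn_extDeriv [FiniteDimensional ℝ V] {s : Set (Model n)} (hs : IsOpen s)
    {f : Model n → Model n [⋀^Fin k]→L[ℝ] V} (hf : ContDiffOn ℝ ∞ f s) :
    ContDiffOn ℝ ∞ (extDeriv f) s := by
  refine contDiffOn_form fun v => ?_
  have h : ∀ y ∈ s, extDeriv f y v = ∑ i : Fin (k + 1), (-1 : ℤ) ^ (i : ℕ) • fderiv ℝ (fun y => f y (i.removeNth v)) y (v i) :=
    fun y hy => extDeriv_apply ((hf.contDiffAt (hs.mem_nhds hy)).differentiableAt (by simp)) v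
  refine ContDiffOn.congr ?_ h
  refine ContDiffOn.sum fun i _ => ?_
  simp only [← Int.cast_smul_eq_zsmul ℝ]
  refine ContDiffOn.const_smul _ ?_
  have h2 := contDiffOn_form_iff.1 hf (i.removeNth v)
  exact (h2.fderiv_of_isOpen (m := ∞) hs (by simp)).clm_apply contDiffOn_const

theorem IsSmoothFormOn.extDer [FiniteDimensional ℝ V] {U : Set M} (hU : IsOpen U)
    {η : M → Model n [⋀^Fin k]→L[ℝ] V} (hη : IsSmoothFormOn U η) : IsSmoothFormOn U (extDer η) :=
  fun c => (contDiffOn_extDeriv (isOpen_chartDomain c hU) (hη c)).congr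
    fun _ hy => inChart_extDer hU hη hy

theorem IsSmoothFormOn.mono {U U' : Set M} (h : U' ⊆ U) {η : M → Model n [⋀^Fin k]→L[ℝ] V}
    (hη : IsSmoothFormOn U η) : IsSmoothFormOn U' η :=
  fun c => (hη c).mono fun _ hy => ⟨hy.1, h hy.2⟩

theorem IsSmoothFormOn.add {U : Set M} {η θ : M → Model n [⋀^Fin k]→L[ℝ] V}
    (hη : IsSmoothFormOn U η) (hθ : IsSmoothFormOn U θ) : IsSmoothFormOn U (fun x => η x + θ x) :=
  fun c => ((hη c).add (hθ c)).congr fun _ _ => rfl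

theorem IsSmoothFormOn.const_smul {U : Set M} {η : M → Model n [⋀^Fin k]→L[ℝ] V}
    (hη : IsSmoothFormOn U η) (t : ℝ) : IsSmoothFormOn U (fun x => t • η x) :=
  fun c => ((hη c).const_smul t).congr fun _ _ => rfl

theorem IsSmoothFormOn.fun_smul {U : Set M} {η : M → Model n [⋀^Fin k]→L[ℝ] V}
    (hη : IsSmoothFormOn U η) {f : M → ℝ} (hf : ∀ c : M, ContDiffOn ℝ ∞ (fun y => f ((chartE n c).symm y)) (chartDomain c U)) :
    IsSmoothFormOn U (fun x => f x • η x) :=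
  fun c => ((hf c).smul (hη c)).congr fun _ _ => rfl

/-! ### The coordinate expression of the metric -/

/-- The metric in the coordinates of the chart at `c`. -/
def metricIn (g : Metric n M) (c : M) (y : Model n) : Model n →L[ℝ] Model n →L[ℝ] ℝ :=
  pullInner (jac c y) (metricAt g ((chartE n c).symm y))

theorem isInner_metricIn (g : Metric n M) {c : M} {y : Model n} (hy : y ∈ (chartE n c).target) :
    IsInner (metricIn g c y) :=
  (isInner_metricAt g _).pull (jac_bijective hy).1

theorem contDiffOn_metricIn (g : Metric n M) (c : M) :
    ContDiffOn ℝ ∞ (metricIn g c) (chartE n c).target := by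
  -- the coordinate vector fields of the chart at `c` are smooth sections of the tangent bundle
  have hsec : ∀ v : Model n, ContMDiffOn (𝓡 (2 * n)) ((𝓡 (2 * n)).prod 𝓘(ℝ, Model n)) ∞
      (fun p : M => Bundle.TotalSpace.mk' (Model n) (E := fun x : M => TangentSpace (𝓡 (2 * n)) x) p
        (tangentCoordChange (𝓡 (2 * n)) c p p v)) (chartE n c).source := by
    intro v
    let e := trivializationAt (Model n) (TangentSpace (𝓡 (2 * n)) : M → Type _) c
    have h := (e.contMDiffOn_symm (IB := 𝓡 (2 * n)) (n := ∞)).comp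
      (s := (chartE n c).source) (f := fun p : M => (p, v)) (I := 𝓡 (2 * n))
      (contMDiffOn_id.prodMk contMDiffOn_const) (by
        intro p hp
        rw [Set.mem_preimage, e.mem_target]
        simpa [e] using hp)
    refine h.congr fun p hp => ?_
    have hpb : p ∈ e.baseSet := by simpa [e] using hp
    simp only [Function.comp]
    rw [← e.mk_symm hpb v, ← e.symmL_apply (R := ℝ) hpb v]
    simp only [e]
    rw [TangentBundle.symmL_trivializationAt_eq_core (by simpa using hp)]
    rfl
  refine contDiffOn_clm_apply.2 fun u => contDiffOn_clm_apply.2 fun v => ?_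
  have h1 : ContMDiffOn (𝓡 (2 * n)) ((𝓡 (2 * n)).prod 𝓘(ℝ)) ∞
      (fun p : M => Bundle.TotalSpace.mk' ℝ (E := Bundle.Trivial M ℝ) p
        (metricAt g p (tangentCoordChange (𝓡 (2 * n)) c p p u) (tangentCoordChange (𝓡 (2 * n)) c p p v)))
        (chartE n c).source :=
    ContMDiffOn.clm_bundle_apply₂ (F₁ := Model n) (F₂ := Model n)
      (E₁ := (TangentSpace (𝓡 (2 * n)) : M → Type _)) (E₂ := (TangentSpace (𝓡 (2 * n)) : M → Type _))
      (E₃ := Bundle.Trivial M ℝ) g.contMDiff.contMDiffOn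
      (hsec u) (hsec v)
  have h2 : ContMDiffOn (𝓡 (2 * n)) 𝓘(ℝ) ∞ (fun p : M =>
        (metricAt g p (tangentCoordChange (𝓡 (2 * n)) c p p u) (tangentCoordChange (𝓡 (2 * n)) c p p v)))
        (chartE n c).source := by
    intro p hp
    have h3 := h1 p hp
    simp only [Bundle.contMDiffWithinAt_totalSpace] at h3
    exact h3.2
  rw [← contMDiffOn_iff_contDiffOn]
  exact h2.comp (contMDiffOn_extChartAt_symm c) fun y hy => (chartE n c).map_target hy

end FormsOnManifolds

/-! ### Wedge products of forms on a manifold -/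

section FormOperations
open Filter Topology
open ContinuousAlternatingMap (ofSubsingleton alternatizeUncurryFin alternatizeUncurryFin_apply
  alternatizeUncurryFinCLM)

variable {n : ℕ} {M : Type*} [TopologicalSpace M] [ChartedSpace (Model n) M]
  [IsManifold (𝓡 (2 * n)) ∞ M]
  {V W X : Type*} [NormedAddCommGroup V] [NormedSpace ℝ V] [NormedAddCommGroup W] [NormedSpace ℝ W]
  [NormedAddCommGroup X] [NormedSpace ℝ X] {k l : ℕ}

theorem wedgeOne_comp (b : V →L[ℝ] W →L[ℝ] X) (α : Model n →L[ℝ] V) (γ : Model n [⋀^Fin k]→L[ℝ] W)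
    (T : Model n →L[ℝ] Model n) : wedgeOne b (α ∘L T) (γ.compContinuousLinearMap T) =
      (wedgeOne b α γ).compContinuousLinearMap T := by
  ext v
  rw [ContinuousAlternatingMap.compContinuousLinearMap_apply, wedgeOne_apply, wedgeOne_apply]
  rfl

/-- The wedge product of a 1-form and a `k`-form on `M`, with coefficients multiplied by `b`. -/
def wedgeForm (b : V →L[ℝ] W →L[ℝ] X) (α : M → Model n [⋀^Fin 1]→L[ℝ] V)
    (γ : M → Model n [⋀^Fin k]→L[ℝ] W) (x : M) : Model n [⋀^Fin (k + 1)]→L[ℝ] X :=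
  wedgeOne b ((ofSubsingleton ℝ (Model n) V (0 : Fin 1)).symm (α x)) (γ x)

theorem inChart_wedgeForm (b : V →L[ℝ] W →L[ℝ] X) (α : M → Model n [⋀^Fin 1]→L[ℝ] V)
    (γ : M → Model n [⋀^Fin k]→L[ℝ] W) (c : M) (y : Model n) : inChart c (wedgeForm b α γ) y =
      wedgeOne b ((ofSubsingleton ℝ (Model n) V (0 : Fin 1)).symm (inChart c α y))
        (inChart c γ y) := by
  rw [inChart_eq, inChart_eq, inChart_eq, wedgeForm, ← wedgeOne_comp]
  rfl

theorem contDiffOn_ofSubsingleton_symm {Y : Type*} [NormedAddCommGroup Y] [NormedSpace ℝ Y]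
    [FiniteDimensional ℝ V] {α : Y → Model n [⋀^Fin 1]→L[ℝ] V} {s : Set Y} {r : WithTop ℕ∞}
    (hα : ContDiffOn ℝ r α s) :
    ContDiffOn ℝ r (fun y => (ofSubsingleton ℝ (Model n) V (0 : Fin 1)).symm (α y)) s :=
  contDiffOn_clm_apply.2 fun v => contDiffOn_form_iff.1 hα fun _ => v

theorem IsSmoothFormOn.wedgeForm [FiniteDimensional ℝ V] [FiniteDimensional ℝ W]
    [FiniteDimensional ℝ X] {U : Set M} (b : V →L[ℝ] W →L[ℝ] X)
    {α : M → Model n [⋀^Fin 1]→L[ℝ] V} {γ : M → Model n [⋀^Fin k]→L[ℝ] W}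
    (hα : IsSmoothFormOn U α) (hγ : IsSmoothFormOn U γ) : IsSmoothFormOn U (wedgeForm b α γ) :=
  fun c => (contDiffOn_wedgeOne b (contDiffOn_ofSubsingleton_symm (hα c)) (hγ c)).congr
    fun _ _ => inChart_wedgeForm b α γ c _

/-! ### Metric operations in coordinates -/

variable (S : SymplecticRiemannian n M)

/-- The volume form in the coordinates of a chart. -/
def volIn (c : M) (y : Model n) : Model n [⋀^Fin (2 * n)]→L[ℝ] ℝ :=
  volAt (metricIn S.metric c y) (inChart c S.orientation.toForm y)

theorem inChart_volForm {c : M} {y : Model n} (hy : y ∈ (chartE n c).target) :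
    inChart c (volForm S) y = volIn S c y :=
  (volAt_pull _ (jac_bijective hy)).symm

theorem inChart_ne_zero {η : M → Model n [⋀^Fin k]→L[ℝ] V} (hη : ∀ x, η x ≠ 0) {c : M} {y : Model n}
    (hy : y ∈ (chartE n c).target) : inChart c η y ≠ 0 := by
  intro h
  refine hη ((chartE n c).symm y) ?_
  ext v
  choose u hu using fun a => (jac_bijective hy).2 (v a)
  have h2 := congrArg (fun f : Model n [⋀^Fin k]→L[ℝ] V => f u) h
  simp only [inChart_eq, ContinuousAlternatingMap.compContinuousLinearMap_apply] at h2
  rw [show v = jac c y ∘ u from funext fun a => (hu a).symm, h2]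
  rfl

theorem contDiffOn_volIn (c : M) : ContDiffOn ℝ ∞ (volIn S c) (chartE n c).target := by
  refine contDiffOn_volAt (contDiffOn_metricIn S.metric c) (fun y hy => isInner_metricIn _ hy) ?_
    fun y hy => inChart_ne_zero S.orientation.ne_zero hy
  have := S.orientation.smooth c
  rwa [chartDomain_univ] at this

theorem inChart_hodgeStar (h : k + l = 2 * n) (β : M → Model n [⋀^Fin k]→L[ℝ] V) {c : M}
    {y : Model n} (hy : y ∈ (chartE n c).target) :
    inChart c (fun x => hodgeStar S h x (β x)) y =
      starAt (metricIn S.metric c y) (volIn S c y) h (inChart c β y) := by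
  rw [inChart_eq, hodgeStar_eq, ← starAt_pull (isInner_metricAt _ _) _ (jac_bijective hy),
    ← volAt_pull _ (jac_bijective hy)]
  rfl

theorem IsSmoothFormOn.hodgeStar [FiniteDimensional ℝ V] {U : Set M} (h : k + l = 2 * n)
    {β : M → Model n [⋀^Fin k]→L[ℝ] V} (hβ : IsSmoothFormOn U β) :
    IsSmoothFormOn U (fun x => hodgeStar S h x (β x)) :=
  fun c => (contDiffOn_starAt ((contDiffOn_metricIn S.metric c).mono (chartDomain_subset c U))
    (fun y hy => isInner_metricIn _ hy.1) ((contDiffOn_volIn S c).mono (chartDomain_subset c U)) h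
    (hβ c)).congr fun y hy => inChart_hodgeStar S h β hy.1

theorem inChart_primitivePart (α : M → Model n [⋀^Fin 2]→L[ℝ] V) {c : M}
    {y : Model n} (hy : y ∈ (chartE n c).target) :
    inChart c (fun x => primitivePart S x (α x)) y =
      primAt (metricIn S.metric c y) (inChart c S.symp.toForm y) (inChart c α y) := by
  rw [inChart_eq, primitivePart_eq, ← primAt_pull (isInner_metricAt _ _) (jac_bijective hy)]
  rfl

theorem contDiffOn_primitivePart [FiniteDimensional ℝ V] (hn : 2 ≤ n) {U : Set M} {c : M}
    {Y : Type*} [NormedAddCommGroup Y] [NormedSpace ℝ Y] {s : Set Y} {f : Y → Model n}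
    (hf : ContDiff ℝ ∞ f) (hs : ∀ z ∈ s, f z ∈ chartDomain c U)
    {α : Y → Model n [⋀^Fin 2]→L[ℝ] V} (hα : ContDiffOn ℝ ∞ α s) :
    ContDiffOn ℝ ∞ (fun z => primAt (metricIn S.metric c (f z)) (inChart c S.symp.toForm (f z)) (α z)) s := by
  have h1 : ∀ z ∈ s, f z ∈ (chartE n c).target := fun z hz => (hs z hz).1
  have h2 := S.symp.smooth c
  rw [chartDomain_univ] at h2
  exact contDiffOn_primAt ((contDiffOn_metricIn S.metric c).comp hf.contDiffOn h1)
    (fun z hz => isInner_metricIn _ (h1 z hz)) (h2.comp hf.contDiffOn h1)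
    (fun z hz => inChart_ne_zero (S.symp.toForm_ne_zero hn) (h1 z hz)) hα

theorem IsSmoothFormOn.primitivePart [FiniteDimensional ℝ V] (hn : 2 ≤ n) {U : Set M}
    {α : M → Model n [⋀^Fin 2]→L[ℝ] V} (hα : IsSmoothFormOn U α) :
    IsSmoothFormOn U (fun x => primitivePart S x (α x)) :=
  fun c => (contDiffOn_primitivePart S hn contDiff_id (fun _ h => h) (hα c)).congr
    fun _ hy => inChart_primitivePart S α hy.1

theorem pairAt_eq_inChart (g : Metric n M) (b : V →L[ℝ] W →L[ℝ] X)
    (α : M → Model n [⋀^Fin k]→L[ℝ] V) (β : M → Model n [⋀^Fin k]→L[ℝ] W) {c : M}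
    {y : Model n} (hy : y ∈ (chartE n c).target) :
    pairAt (metricAt g ((chartE n c).symm y)) b (α ((chartE n c).symm y)) (β ((chartE n c).symm y)) =
      pairAt (metricIn g c y) b (inChart c α y) (inChart c β y) :=
  (pairAt_pull (isInner_metricAt _ _) (jac_bijective hy) b _ _).symm

/-! ### The Leibniz rule -/

/-- The derivative of a 1-form on the model space, as a bilinear map; `dα` is its antisymmetrization. -/
def derivOne (α : Model n → Model n [⋀^Fin 1]→L[ℝ] V) (y : Model n) :
    Model n →L[ℝ] Model n →L[ℝ] V :=
  fderiv ℝ (fun z => (ofSubsingleton ℝ (Model n) V (0 : Fin 1)).symm (α z)) y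

theorem extDeriv_eq_sum {f : Model n → Model n [⋀^Fin k]→L[ℝ] V} (y : Model n)
    (v : Fin (k + 1) → Model n) : extDeriv f y v =
      ∑ i : Fin (k + 1), (-1 : ℝ) ^ (i : ℕ) • fderiv ℝ f y (v i) (i.removeNth v) := by
  rw [extDeriv, alternatizeUncurryFin_apply]
  refine Finset.sum_congr rfl fun i _ => ?_
  rw [← Int.cast_smul_eq_zsmul ℝ]
  push_cast
  rfl

theorem fderiv_form_apply {f : Model n → Model n [⋀^Fin k]→L[ℝ] V} {y : Model n}
    (hf : DifferentiableAt ℝ f y) (u : Model n) (v : Fin k → Model n) :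
    fderiv ℝ f y u v = fderiv ℝ (fun z => f z v) y u := by
  simpa using! (fderiv_continuousAlternatingMap_apply_const_apply hf v u).symm

theorem extDeriv_one_apply {α : Model n → Model n [⋀^Fin 1]→L[ℝ] V} {y : Model n}
    (hα : DifferentiableAt ℝ α y)
    (hα' : DifferentiableAt ℝ (fun z => (ofSubsingleton ℝ (Model n) V (0 : Fin 1)).symm (α z)) y)
    (u v : Model n) : extDeriv α y ![u, v] = derivOne α y u v - derivOne α y v u := by
  have key : ∀ u v, fderiv ℝ α y u (fun _ => v) = derivOne α y u v := by
    intro u v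
    rw [fderiv_form_apply hα, derivOne]
    have := (hα'.hasFDerivAt.clm_apply (hasFDerivAt_const v y)).fderiv
    simp only [ContinuousLinearMap.comp_zero, zero_add] at this
    have h2 := congrArg (fun L : Model n →L[ℝ] V => L u) this
    simpa using! h2
  rw [extDeriv_eq_sum, Fin.sum_univ_two, ← key, ← key]
  have h0 : (0 : Fin 2).removeNth ![u, v] = fun _ => v := by
    funext i; fin_cases i; rfl
  have h1 : (1 : Fin 2).removeNth ![u, v] = fun _ => u := by
    funext i; fin_cases i; rfl
  rw [h0, h1]
  simp [sub_eq_add_neg]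

theorem fderiv_wedgeOne [FiniteDimensional ℝ V] [FiniteDimensional ℝ W] [FiniteDimensional ℝ X]
    (b : V →L[ℝ] W →L[ℝ] X) {s : Set (Model n)} (hs : IsOpen s) {α : Model n → Model n →L[ℝ] V}
    {γ : Model n → Model n [⋀^Fin k]→L[ℝ] W} (hα : ContDiffOn ℝ ∞ α s) (hγ : ContDiffOn ℝ ∞ γ s)
    {y : Model n} (hy : y ∈ s) (u : Model n) :
    fderiv ℝ (fun z => wedgeOne b (α z) (γ z)) y u =
      wedgeOne b (fderiv ℝ α y u) (γ y) + wedgeOne b (α y) (fderiv ℝ γ y u) := by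
  have hw := ((contDiffOn_wedgeOne b hα hγ).contDiffAt (hs.mem_nhds hy)).differentiableAt (by simp)
  have hα' := ((hα.contDiffAt (hs.mem_nhds hy)).differentiableAt (by simp))
  have hγ' := ((hγ.contDiffAt (hs.mem_nhds hy)).differentiableAt (by simp))
  have hγv := fun v => ((contDiffOn_form_iff.1 hγ v).contDiffAt (hs.mem_nhds hy)).differentiableAt (by simp)
  ext v
  rw [fderiv_form_apply hw]
  simp only [wedgeOne_apply, ContinuousAlternatingMap.add_apply]
  have h1 := fun i : Fin (k + 1) =>
    (((b.hasFDerivAt.comp y (hα'.hasFDerivAt.clm_apply (hasFDerivAt_const (v i) y))).clm_apply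
      (hγv (i.removeNth v)).hasFDerivAt).const_smul ((-1 : ℝ) ^ (i : ℕ)))
  have h2 := (HasFDerivAt.fun_sum (u := Finset.univ) fun i _ => h1 i).fderiv
  simp only [Function.comp_def, Pi.smul_apply] at h2
  rw [← Finset.sum_add_distrib]
  refine (congrArg (fun L : Model n →L[ℝ] X => L u) h2).trans ?_
  rw [sum_apply]
  refine Finset.sum_congr rfl fun i _ => ?_
  rw [smul_apply, ← smul_add, fderiv_form_apply hγ']
  congr 1
  simp
  exact add_comm _ _

theorem alternatizeUncurryFin_comp_apply (f : Model n →L[ℝ] Model n →L[ℝ] Model n [⋀^Fin k]→L[ℝ] X)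
    (v : Fin (k + 1 + 1) → Model n) :
    alternatizeUncurryFin (alternatizeUncurryFinCLM ℝ (Model n) X ∘L f) v =
      ∑ i : Fin (k + 1 + 1), (-1 : ℝ) ^ (i : ℕ) • alternatizeUncurryFin (f (v i)) (i.removeNth v) := by
  rw [alternatizeUncurryFin_apply]
  refine Finset.sum_congr rfl fun i _ => ?_
  rw [← Int.cast_smul_eq_zsmul ℝ]
  push_cast
  rfl

/-- The Leibniz rule `d(α ∧ γ) = dα ∧ γ - α ∧ dγ` for a 1-form `α`. -/
theorem extDeriv_wedgeOne [FiniteDimensional ℝ V] [FiniteDimensional ℝ W] [FiniteDimensional ℝ X]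
    (b : V →L[ℝ] W →L[ℝ] X) {s : Set (Model n)} (hs : IsOpen s) {α : Model n → Model n →L[ℝ] V}
    {γ : Model n → Model n [⋀^Fin k]→L[ℝ] W} (hα : ContDiffOn ℝ ∞ α s) (hγ : ContDiffOn ℝ ∞ γ s)
    {y : Model n} (hy : y ∈ s) :
    extDeriv (fun z => wedgeOne b (α z) (γ z)) y =
      wedgeTwo b (fderiv ℝ α y) (γ y) - wedgeOne b (α y) (extDeriv γ y) := by
  -- `F u w = b(α(u), ∂_w γ)`; alternating it twice in either order gives the two forms of the last term
  let F : Model n →L[ℝ] Model n →L[ℝ] Model n [⋀^Fin k]→L[ℝ] X :=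
    (((ContinuousLinearMap.compL ℝ (Model n) (Model n [⋀^Fin k]→L[ℝ] W)
      (Model n [⋀^Fin k]→L[ℝ] X)).flip (fderiv ℝ γ y)) ∘L (pairForm b k)) ∘L α y
  ext v
  have key := congrArg (fun f : Model n [⋀^Fin (k + 1 + 1)]→L[ℝ] X => f v)
    (alternatize_twice_flip F)
  simp only [ContinuousAlternatingMap.neg_apply, alternatizeUncurryFin_comp_apply] at key
  rw [ContinuousAlternatingMap.sub_apply, extDeriv_eq_sum, wedgeTwo_apply]
  simp only [fderiv_wedgeOne b hs hα hγ hy, ContinuousAlternatingMap.add_apply, smul_add,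
    Finset.sum_add_distrib]
  rw [sub_eq_add_neg]
  congr 1
  have h1 : ∀ u w, alternatizeUncurryFin (F u) w = b (α y u) (extDeriv γ y w) := by
    intro u w
    rw [alternatizeUncurryFin_apply, extDeriv, alternatizeUncurryFin_apply, map_sum]
    refine Finset.sum_congr rfl fun i _ => ?_
    rw [map_zsmul]
    rfl
  have h2 : ∀ u, alternatizeUncurryFin (F.flip u) = wedgeOne b (α y) (fderiv ℝ γ y u) :=
    fun _ => rfl
  simp only [h1, h2] at key
  rw [wedgeOne_apply, key, neg_neg]

end FormOperations

/-! ### The covariant Leibniz rule -/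

section CovariantLeibniz
open Filter Topology
open ContinuousAlternatingMap (ofSubsingleton alternatizeUncurryFin alternatizeUncurryFin_apply
  alternatizeUncurryFinCLM)

variable {n : ℕ} {M : Type*} [TopologicalSpace M] [ChartedSpace (Model n) M]
  [IsManifold (𝓡 (2 * n)) ∞ M]
  {V W X : Type*} [NormedAddCommGroup V] [NormedSpace ℝ V] [NormedAddCommGroup W] [NormedSpace ℝ W]
  [NormedAddCommGroup X] [NormedSpace ℝ X] {k l : ℕ}

/-- The derivative at `x`, in the preferred chart at `x`, of a 1-form on `M`. It depends on the chart,
but its antisymmetrization `dα` does not. -/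
def derivForm (α : M → Model n [⋀^Fin 1]→L[ℝ] V) (x : M) : Model n →L[ℝ] Model n →L[ℝ] V :=
  derivOne (inChart x α) (chartE n x x)

theorem extDer_wedgeForm [FiniteDimensional ℝ V] [FiniteDimensional ℝ W] [FiniteDimensional ℝ X]
    (b : V →L[ℝ] W →L[ℝ] X) {U : Set M} (hU : IsOpen U) {α : M → Model n [⋀^Fin 1]→L[ℝ] V}
    {γ : M → Model n [⋀^Fin k]→L[ℝ] W} (hα : IsSmoothFormOn U α) (hγ : IsSmoothFormOn U γ)
    {x : M} (hx : x ∈ U) : extDer (wedgeForm b α γ) x = wedgeTwo b (derivForm α x) (γ x) -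
      wedgeOne b ((ofSubsingleton ℝ (Model n) V (0 : Fin 1)).symm (α x)) (extDer γ x) := by
  have h := extDeriv_wedgeOne b (isOpen_chartDomain x hU) (contDiffOn_ofSubsingleton_symm (hα x))
    (hγ x) (chartE_self_mem_chartDomain hx)
  rw [inChart_self, inChart_self] at h
  have h2 : inChart x (wedgeForm b α γ) = fun y =>
    wedgeOne b ((ofSubsingleton ℝ (Model n) V (0 : Fin 1)).symm (inChart x α y)) (inChart x γ y) :=
    funext fun y => inChart_wedgeForm b α γ x y
  rw [extDer, h2]
  exact h

theorem extDer_one_apply [FiniteDimensional ℝ V] {U : Set M} (hU : IsOpen U)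
    {α : M → Model n [⋀^Fin 1]→L[ℝ] V} (hα : IsSmoothFormOn U α) {x : M} (hx : x ∈ U)
    (u v : Model n) : extDer α x ![u, v] = derivForm α x u v - derivForm α x v u :=
  extDeriv_one_apply
    ((hα.contDiffAt hU (chartE_self_mem_chartDomain hx)).differentiableAt (by simp))
    (((contDiffOn_ofSubsingleton_symm (hα x)).contDiffAt
      ((isOpen_chartDomain x hU).mem_nhds (chartE_self_mem_chartDomain hx))).differentiableAt
        (by simp)) u v

variable {EG : Type*} [NormedAddCommGroup EG] [NormedSpace ℝ EG] [FiniteDimensional ℝ EG]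
  {G : Type*} [TopologicalSpace G] [ChartedSpace EG G] [Group G] [LieGroup 𝓘(ℝ, EG) ∞ G]

/-- The bilinear form `(u, v) ↦ [a(u), α(v)]`. -/
def bracketTwo (G : Type*) [TopologicalSpace G] [ChartedSpace EG G] [Group G] [LieGroup 𝓘(ℝ, EG) ∞ G]
    (a α : Model n →L[ℝ] EG) : Model n →L[ℝ] Model n →L[ℝ] EG :=
  (ContinuousLinearMap.compL ℝ (Model n) EG EG).flip α ∘L bracket G ∘L a

@[simp] theorem bracketTwo_apply (a α : Model n →L[ℝ] EG) (u v : Model n) :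
    bracketTwo G a α u v = bracket G (a u) (α v) := rfl

theorem wedgeBracket_eq (a : Model n [⋀^Fin 1]→L[ℝ] EG) (β : Model n [⋀^Fin k]→L[ℝ] EG) :
    wedgeBracket G a β = wedgeOne (bracket G) ((ofSubsingleton ℝ (Model n) EG (0 : Fin 1)).symm a) β :=
  rfl

theorem wedgeBracket_one_apply (a α : Model n [⋀^Fin 1]→L[ℝ] EG) (u v : Model n) :
    wedgeBracket G a α ![u, v] =
      bracketTwo G ((ofSubsingleton ℝ (Model n) EG (0 : Fin 1)).symm a)
        ((ofSubsingleton ℝ (Model n) EG (0 : Fin 1)).symm α) u v -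
      bracketTwo G ((ofSubsingleton ℝ (Model n) EG (0 : Fin 1)).symm a)
        ((ofSubsingleton ℝ (Model n) EG (0 : Fin 1)).symm α) v u := by
  rw [wedgeBracket_eq, wedgeOne_apply, Fin.sum_univ_two]
  have h0 : (0 : Fin 2).removeNth ![u, v] = fun _ => v := by
    funext i; fin_cases i; rfl
  have h1 : (1 : Fin 2).removeNth ![u, v] = fun _ => u := by
    funext i; fin_cases i; rfl
  rw [h0, h1]
  simp [sub_eq_add_neg]

/-- By invariance of the inner product, `⟨α ∧ [a ∧ γ]⟩ = ⟨[a ∧ α] ∧ γ⟩` for 1-forms `a`, `α`. -/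
theorem wedgeOne_wedgeBracket (B : AdInvariantInner EG G) (a α : Model n →L[ℝ] EG)
    (γ : Model n [⋀^Fin k]→L[ℝ] EG) :
    wedgeOne B.form α (wedgeOne (bracket G) a γ) = wedgeTwo B.form (bracketTwo G a α) γ := by
  -- alternate `F u w = ⟨[a(u), α(w)], γ⟩` twice, in either order
  let F : Model n →L[ℝ] Model n →L[ℝ] Model n [⋀^Fin k]→L[ℝ] ℝ :=
    (ContinuousLinearMap.compL ℝ (Model n) EG (Model n [⋀^Fin k]→L[ℝ] ℝ))
      ((pairForm B.form k).flip γ) ∘L bracketTwo G a α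
  ext v
  have key := congrArg (fun f : Model n [⋀^Fin (k + 1 + 1)]→L[ℝ] ℝ => f v)
    (alternatize_twice_flip F)
  simp only [ContinuousAlternatingMap.neg_apply, alternatizeUncurryFin_comp_apply] at key
  rw [wedgeOne_apply, wedgeTwo_apply]
  refine Eq.trans ?_ key.symm
  rw [← Finset.sum_neg_distrib]
  refine Finset.sum_congr rfl fun i _ => ?_
  rw [← smul_neg, wedgeOne_apply, map_sum, alternatizeUncurryFin_apply, ← Finset.sum_neg_distrib]
  congr 1
  refine Finset.sum_congr rfl fun j _ => ?_
  rw [← Int.cast_smul_eq_zsmul ℝ, map_smul, ← smul_neg]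
  push_cast
  congr 1
  have h := B.bracket_left (a (i.removeNth v j)) (α (v i)) (γ (j.removeNth (i.removeNth v)))
  change _ = -B.form (bracket G (a (i.removeNth v j)) (α (v i))) (γ (j.removeNth (i.removeNth v)))
  rw [h, neg_neg]

/-- The pairing with a 2-form that is the antisymmetrization of a bilinear form `κ`: the factors of two
cancel, and `κ` can be used in place of its antisymmetrization. -/
theorem pairAt_two_of_skew {g : Model n →L[ℝ] Model n →L[ℝ] ℝ} (hg : IsInner g)
    (b : V →L[ℝ] W →L[ℝ] X) {α : Model n [⋀^Fin 2]→L[ℝ] V} {κ : Model n →L[ℝ] Model n →L[ℝ] V}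
    (h : ∀ u v, α ![u, v] = κ u v - κ v u) (β : Model n [⋀^Fin 2]→L[ℝ] W) :
    pairAt g b α β = ∑ p, ∑ q, b (κ (coframeAt g p) (coframeAt g q)) (β ![frame p, frame q]) := by
  have hβ : ∀ u v, β ![u, v] = -β ![v, u] := by
    intro u v
    have h1 := β.map_swap (v := ![u, v]) (i := 0) (j := 1) (by decide)
    have h2 : ![u, v] ∘ Equiv.swap (0 : Fin 2) 1 = ![v, u] := by
      funext i
      fin_cases i <;> rfl
    rw [h2] at h1
    exact (neg_eq_iff_eq_neg.2 h1).symm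
  rw [pairAt_two_swap hg]
  simp only [h, map_sub, sub_apply, Finset.sum_sub_distrib]
  have h2 : ∑ p, ∑ q, b (κ (coframeAt g q) (coframeAt g p)) (β ![frame p, frame q]) =
      -∑ p, ∑ q, b (κ (coframeAt g p) (coframeAt g q)) (β ![frame p, frame q]) := by
    rw [Finset.sum_comm, ← Finset.sum_neg_distrib]
    refine Finset.sum_congr rfl fun p _ => ?_
    rw [← Finset.sum_neg_distrib]
    refine Finset.sum_congr rfl fun q _ => ?_
    rw [hβ, map_neg]
  rw [h2, sub_neg_eq_add, ← two_smul ℝ, smul_smul]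
  norm_num

variable (S : SymplecticRiemannian n M) (B : AdInvariantInner EG G)

theorem hodgeStar_smul (h : k + l = 2 * n) (x : M) (t : ℝ) (β : Model n [⋀^Fin k]→L[ℝ] V) :
    hodgeStar S h x (t • β) = t • hodgeStar S h x β := by
  ext u
  simp only [hodgeStar_eq, starAt_apply, ContinuousAlternatingMap.smul_apply, Finset.smul_sum,
    smul_comm t]

/-- The covariant Leibniz rule `d⟨α ∧ *β⟩ = (⟨d_A α, β⟩ - ⟨α, d_A^* β⟩) vol` in a local trivialization,
where `a` is the value at `x` of the connection form. The left side does not involve `a`, because the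
two bracket terms on the right cancel by invariance of the inner product. -/
theorem extDer_wedgeForm_hodgeStar {U : Set M} (hU : IsOpen U) (h : 2 + l = 2 * n)
    (h' : l + 1 + 1 = 2 * n)
    {α : M → Model n [⋀^Fin 1]→L[ℝ] EG} {β : M → Model n [⋀^Fin 2]→L[ℝ] EG}
    (hα : IsSmoothFormOn U α) (hβ : IsSmoothFormOn U β) {x : M} (hx : x ∈ U)
    (a : Model n [⋀^Fin 1]→L[ℝ] EG) (v : Fin (l + 1 + 1) → Model n) :
    extDer (wedgeForm B.form α fun z => hodgeStar S h z (β z)) x v =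
      (h'.symm ▸ volForm S x : Model n [⋀^Fin (l + 1 + 1)]→L[ℝ] ℝ) v *
        (pointInner S B x (extDer α x + wedgeBracket G a (α x)) (β x) +
          pointInner S B x (α x) (hodgeStar S h' x
            (extDer (fun z => hodgeStar S h z (β z)) x +
              wedgeBracket G a (hodgeStar S h x (β x))))) := by
  have hg := isInner_metricAt S.metric x
  set α' := (ofSubsingleton ℝ (Model n) EG (0 : Fin 1)).symm (α x) with hα'
  set a' := (ofSubsingleton ℝ (Model n) EG (0 : Fin 1)).symm a with ha'
  rw [extDer_wedgeForm B.form hU hα (hβ.hodgeStar S h) hx]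
  have h1 := wedgeOne_eq_neg_pairAt hg (S.orientation.ne_zero x) h' B.form (α x)
    (extDer (fun z => hodgeStar S h z (β z)) x + wedgeBracket G a (hodgeStar S h x (β x))) v
  -- the term with the bracket becomes `⟨[a ∧ α] ∧ *β⟩`, which also occurs in `⟨d_A α ∧ *β⟩`
  have h2 : wedgeOne B.form α' (extDer (fun z => hodgeStar S h z (β z)) x +
      wedgeBracket G a (hodgeStar S h x (β x))) v =
      wedgeOne B.form α' (extDer (fun z => hodgeStar S h z (β z)) x) v +
        wedgeTwo B.form (bracketTwo G a' α') (hodgeStar S h x (β x)) v := by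
    rw [← wedgeOne_wedgeBracket, wedgeOne_apply, wedgeOne_apply, wedgeOne_apply,
      ← Finset.sum_add_distrib]
    refine Finset.sum_congr rfl fun i _ => ?_
    rw [← smul_add, ← map_add]
    rfl
  have h3 : ∀ u v, (extDer α x + wedgeBracket G a (α x)) ![u, v] =
      (derivForm α x + bracketTwo G a' α') u v - (derivForm α x + bracketTwo G a' α') v u := by
    intro u v
    rw [ContinuousAlternatingMap.add_apply, extDer_one_apply hU hα hx, wedgeBracket_one_apply]
    simp only [add_apply]
    abel
  have h4 := wedgeTwo_starAt (metricAt S.metric x)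
    (volAt (metricAt S.metric x) (S.orientation.toForm x)) h B.form
    (derivForm α x + bracketTwo G a' α') (β x) v
  rw [← pairAt_two_of_skew hg B.form h3] at h4
  have h5 : wedgeTwo B.form (derivForm α x + bracketTwo G a' α') (hodgeStar S h x (β x)) v =
      wedgeTwo B.form (derivForm α x) (hodgeStar S h x (β x)) v +
        wedgeTwo B.form (bracketTwo G a' α') (hodgeStar S h x (β x)) v := by
    simp only [wedgeTwo_apply, wedgeOne_apply, add_apply, map_add, smul_add, Finset.sum_add_distrib]
  rw [hodgeStar_eq] at h5
  rw [ContinuousAlternatingMap.sub_apply, hodgeStar_eq]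
  rw [hodgeStar_eq] at h1 h2
  rw [h2] at h1
  rw [h5] at h4
  rw [pointInner_eq, pointInner_eq, hodgeStar_eq S h' x, mul_add]
  simp only [smul_eq_mul] at h1 h4
  have aux : ∀ {a b c p q : ℝ}, a + b = p → c + b = -q → a - c = p + q := by
    intro a b c p q h h'
    linarith
  exact aux h4 h1

/-- The adjointness `⟨[η ∧ ζ], β⟩ = ⟨*[*β ∧ η], ζ⟩` for 1-forms `η`, `ζ` and a 2-form `β`. -/
theorem pointInner_wedgeBracket (hn : 2 ≤ n) (x : M) (η ζ : Model n [⋀^Fin 1]→L[ℝ] EG)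
    (β : Model n [⋀^Fin 2]→L[ℝ] EG) (h : 2 + (2 * n - 2) = 2 * n)
    (h' : 2 * n - 2 + 1 + 1 = 2 * n) :
    pointInner S B x (wedgeBracket G η ζ) β =
      pointInner S B x (hodgeStar S h' x (wedgeBracketRight G (hodgeStar S h x β) η)) ζ := by
  have hg := isInner_metricAt S.metric x
  set η' := (ofSubsingleton ℝ (Model n) EG (0 : Fin 1)).symm η with hη'
  set ζ' := (ofSubsingleton ℝ (Model n) EG (0 : Fin 1)).symm ζ with hζ'
  obtain ⟨v, hv⟩ : ∃ v, (h'.symm ▸ volForm S x : Model n [⋀^Fin (2 * n - 2 + 1 + 1)]→L[ℝ] ℝ) v ≠ 0 := by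
    refine ⟨frame ∘ Fin.cast h', ?_⟩
    rw [map_comp_castForm]
    have h1 := volAt_frame_mul_coframe hg (S.orientation.ne_zero x)
    exact left_ne_zero_of_mul (h1.trans_ne one_ne_zero)
  have hB : B.form.flip = B.form := by
    ext u w
    exact B.symm w u
  have h1 := wedgeOne_eq_neg_pairAt hg (S.orientation.ne_zero x) h' B.form ζ
    (wedgeBracket G η (hodgeStar S h x β)) v
  have h2 : wedgeOne B.form ζ' (wedgeBracket G η (hodgeStar S h x β)) =
      wedgeTwo B.form (bracketTwo G η' ζ') (hodgeStar S h x β) := wedgeOne_wedgeBracket B η' ζ' _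
  have h4 := wedgeTwo_starAt (metricAt S.metric x)
    (volAt (metricAt S.metric x) (S.orientation.toForm x)) h B.form (bracketTwo G η' ζ') β v
  rw [← pairAt_two_of_skew hg B.form (wedgeBracket_one_apply η ζ)] at h4
  have h3 : wedgeBracketRight G (hodgeStar S h x β) η =
      (-1 : ℝ) • wedgeBracket G η (hodgeStar S h x β) := by
    rw [wedgeBracketRight, Odd.neg_one_pow ⟨n - 1, by omega⟩]
  rw [h3, hodgeStar_smul, pointInner_eq, pointInner_eq, pairAt_smul_left, pairAt_flip hg _ _ ζ, hB]
  rw [h2] at h1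
  have h6 := h4.symm.trans h1
  have aux : ∀ {m p q : ℝ}, m ≠ 0 → m * p = -(m * q) → p = (-1 : ℝ) * q := by
    intro m p q hm h
    have : m * (p + q) = 0 := by linarith
    rcases mul_eq_zero.1 this with h | h
    · exact absurd h hm
    · linarith
  exact aux hv h6

end CovariantLeibniz

/-! ### Integration on a closed manifold -/

section IntegrationTheory
open Filter Topology MeasureTheory

variable {n : ℕ} {M : Type*} [TopologicalSpace M] [ChartedSpace (Model n) M]
  [IsManifold (𝓡 (2 * n)) ∞ M]

theorem chartDensity_eq (g : Metric n M) (c : M) (y : Model n) :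
    chartDensity g c y = √(gramAt (metricIn g c y)).det := rfl

theorem chartDensity_pos (g : Metric n M) {c : M} {y : Model n} (hy : y ∈ (chartE n c).target) :
    0 < chartDensity g c y :=
  Real.sqrt_pos.2 (det_gramAt_pos (isInner_metricIn g hy))

theorem continuousOn_chartDensity (g : Metric n M) (c : M) :
    ContinuousOn (chartDensity g c) (chartE n c).target := by
  have h := (contDiffOn_det (fun i j => contDiffOn_gramAt (contDiffOn_metricIn g c) i j)).continuousOn
  exact h.sqrt

theorem continuousOn_comp_symm {f : M → ℝ} (hf : Continuous f) (c : M) :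
    ContinuousOn (fun y => f ((chartE n c).symm y)) (chartE n c).target :=
  hf.comp_continuousOn (continuousOn_extChartAt_symm c)

theorem image_chartE_subset {c : M} {K : Set M} (hKc : K ⊆ (chartE n c).source) :
    chartE n c '' K ⊆ (chartE n c).target := by
  rintro _ ⟨x, hx, rfl⟩
  exact (chartE n c).map_source (hKc hx)

theorem chartE_symm_notMem {c : M} {K : Set M} {y : Model n}
    (hy : y ∈ (chartE n c).target \ chartE n c '' K) : (chartE n c).symm y ∉ K :=
  fun h => hy.2 ⟨_, h, (chartE n c).right_inv hy.1⟩

variable [T2Space M] [CompactSpace M]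

theorem tsupport_chartPartition_subset (c : M) :
    tsupport (chartPartition n M c) ⊆ (chartE n c).source := by
  rw [extChartAt_source]
  exact Classical.choose_spec
    (SmoothPartitionOfUnity.exists_isSubordinate_chartAt_source (𝓡 (2 * n)) M) c

variable (n M) in
/-- The centres of the finitely many charts that contribute to the partition of unity. -/
def chartFinset : Finset M :=
  ((chartPartition n M).locallyFinite.finite_nonempty_of_compact).toFinset

theorem chartPartition_eq_zero {c : M} (hc : c ∉ chartFinset n M) (x : M) :
    chartPartition n M c x = 0 := by
  by_contra h
  exact hc ((Set.Finite.mem_toFinset _).2 ⟨x, h⟩)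

theorem sum_chartPartition (x : M) : ∑ c ∈ chartFinset n M, chartPartition n M c x = 1 := by
  rw [← (chartPartition n M).sum_eq_one (Set.mem_univ x)]
  refine (finsum_eq_sum_of_support_subset _ fun c hc => ?_).symm
  by_contra h
  exact hc (chartPartition_eq_zero (by simpa using h) x)

/-- The coordinate image of a closed subset of a chart domain is compact. -/
theorem isCompact_image_chartE {c : M} {K : Set M} (hK : IsClosed K) (hKc : K ⊆ (chartE n c).source) :
    IsCompact (chartE n c '' K) :=
  hK.isCompact.image_of_continuousOn ((continuousOn_extChartAt c).mono hKc)

/-- A function on a chart domain that is continuous and vanishes off a compact set is integrable. -/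
theorem integrableOn_target {c : M} {K : Set M} (hK : IsClosed K) (hKc : K ⊆ (chartE n c).source)
    {h : Model n → ℝ} (hh : ContinuousOn h (chartE n c).target)
    (h0 : ∀ y ∈ (chartE n c).target, (chartE n c).symm y ∉ K → h y = 0) :
    IntegrableOn h (chartE n c).target :=
  IntegrableOn.of_forall_sdiff_eq_zero
    ((hh.mono (image_chartE_subset hKc)).integrableOn_compact (isCompact_image_chartE hK hKc))
    (isOpen_extChartAt_target c).measurableSet fun y hy => h0 y hy.1 (chartE_symm_notMem hy)

/-- The integrand of the part of the integral of `f` computed in the chart at `c`. -/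
def chartTerm (g : Metric n M) (f : M → ℝ) (c : M) (y : Model n) : ℝ :=
  chartPartition n M c ((chartE n c).symm y) * f ((chartE n c).symm y) * chartDensity g c y

theorem integral_eq_sum (g : Metric n M) (f : M → ℝ) :
    integral g f = ∑ c ∈ chartFinset n M, ∫ y in (chartE n c).target, chartTerm g f c y := by
  refine finsum_eq_sum_of_support_subset _ fun c hc => ?_
  by_contra h
  refine hc ?_
  simp only [chartPartition_eq_zero (by simpa using h), zero_mul, integral_zero]

theorem continuousOn_chartTerm (g : Metric n M) {f : M → ℝ} (hf : Continuous f) (c : M) :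
    ContinuousOn (chartTerm g f c) (chartE n c).target :=
  ((continuousOn_comp_symm (chartPartition n M c).contMDiff.continuous c).mul (continuousOn_comp_symm hf c)).mul
    (continuousOn_chartDensity g c)

theorem chartTerm_eq_zero (g : Metric n M) (f : M → ℝ) (c : M) (y : Model n)
    (hy : (chartE n c).symm y ∉ tsupport (chartPartition n M c)) : chartTerm g f c y = 0 := by
  rw [chartTerm, image_eq_zero_of_notMem_tsupport hy, zero_mul, zero_mul]

theorem integrableOn_chartTerm (g : Metric n M) {f : M → ℝ} (hf : Continuous f) (c : M) :
    IntegrableOn (chartTerm g f c) (chartE n c).target :=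
  integrableOn_target (isClosed_tsupport _) (tsupport_chartPartition_subset c)
    (continuousOn_chartTerm g hf c) fun _ _ h => chartTerm_eq_zero g f c _ h

theorem integral_add_of_continuous (g : Metric n M) {f f' : M → ℝ} (hf : Continuous f) (hf' : Continuous f') :
    integral g (fun x => f x + f' x) = integral g f + integral g f' := by
  simp only [integral_eq_sum, ← Finset.sum_add_distrib]
  refine Finset.sum_congr rfl fun c _ => ?_
  rw [← MeasureTheory.integral_add (integrableOn_chartTerm g hf c) (integrableOn_chartTerm g hf' c)]
  congr 1
  funext y
  simp only [chartTerm]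
  ring

theorem integral_const_mul_left (g : Metric n M) (t : ℝ) (f : M → ℝ) :
    integral g (fun x => t * f x) = t * integral g f := by
  simp only [integral_eq_sum, Finset.mul_sum]
  refine Finset.sum_congr rfl fun c _ => ?_
  rw [← MeasureTheory.integral_const_mul]
  congr 1
  funext y
  simp only [chartTerm]
  ring

theorem integral_finset_sum {ι : Type*} (g : Metric n M) (s : Finset ι) {f : ι → M → ℝ}
    (hf : ∀ i ∈ s, Continuous (f i)) :
    integral g (fun x => ∑ i ∈ s, f i x) = ∑ i ∈ s, integral g (f i) := by
  classical
  induction s using Finset.induction_on with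
  | empty =>
    simp only [Finset.sum_empty]
    simpa using integral_const_mul_left g 0 (fun _ => 0)
  | insert a s ha ih =>
    have h1 := fun i hi => hf i (Finset.mem_insert_of_mem hi)
    simp only [Finset.sum_insert ha]
    rw [integral_add_of_continuous g (hf a (Finset.mem_insert_self a s)) (continuous_finsetSum s h1), ih h1]

/-- A nonnegative continuous function with vanishing integral is zero. -/
theorem eq_zero_of_integral_eq_zero (g : Metric n M) {f : M → ℝ} (hf : Continuous f)
    (h0 : ∀ x, 0 ≤ f x) (h : integral g f = 0) (x : M) : f x = 0 := by
  have hnn : ∀ c, ∀ y ∈ (chartE n c).target, 0 ≤ chartTerm g f c y := fun c y hy =>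
    mul_nonneg (mul_nonneg ((chartPartition n M).nonneg c _) (h0 _)) (chartDensity_pos g hy).le
  have hmeas : ∀ c : M, MeasurableSet (chartE n c).target := fun c =>
    (isOpen_extChartAt_target c).measurableSet
  rw [integral_eq_sum, Finset.sum_eq_zero_iff_of_nonneg
    (fun c _ => setIntegral_nonneg (hmeas c) (hnn c))] at h
  obtain ⟨c, hc, hcx⟩ : ∃ c ∈ chartFinset n M, chartPartition n M c x ≠ 0 := by
    by_contra! hcon
    have := sum_chartPartition (n := n) x
    rw [Finset.sum_eq_zero hcon] at this
    exact zero_ne_one this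
  have hxs : x ∈ (chartE n c).source :=
    tsupport_chartPartition_subset c (subset_closure hcx)
  have hae := (setIntegral_eq_zero_iff_of_nonneg_ae
    ((ae_restrict_iff' (hmeas c)).2 (Eventually.of_forall (hnn c)))
    (integrableOn_chartTerm g hf c)).1 (h c hc)
  have hz := Measure.eqOn_open_of_ae_eq hae (isOpen_extChartAt_target c)
    (continuousOn_chartTerm g hf c) continuousOn_const ((chartE n c).map_source hxs)
  rw [chartTerm, (chartE n c).left_inv hxs] at hz
  have hd := chartDensity_pos g ((chartE n c).map_source hxs)
  exact ((mul_eq_zero.1 ((mul_eq_zero.1 hz).resolve_right hd.ne')).resolve_left hcx)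

/-- Differentiation under the integral sign, for a family whose coordinate expressions are jointly
smooth. -/
theorem hasDerivAt_integral (g : Metric n M) {H : ℝ → M → ℝ} {H' : M → ℝ}
    (hH : ∀ c : M, ContDiffOn ℝ ∞ (fun p : ℝ × Model n => H p.1 ((chartE n c).symm p.2))
      (Set.univ ×ˢ (chartE n c).target)) (hH' : ∀ x, HasDerivAt (fun t => H t x) (H' x) 0) :
    HasDerivAt (fun t => integral g (H t)) (integral g H') 0 := by
  simp only [integral_eq_sum]
  refine HasDerivAt.fun_sum fun c _ => ?_
  -- each chart contributes an integral over a compact set, on which the derivative is bounded for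
  -- `|t| ≤ 1`
  set K := chartE n c '' tsupport (chartPartition n M c) with hK
  have hKc : IsCompact K := isCompact_image_chartE (isClosed_tsupport _) (tsupport_chartPartition_subset c)
  have hKt : K ⊆ (chartE n c).target := image_chartE_subset (tsupport_chartPartition_subset c)
  have hopen : IsOpen (Set.univ ×ˢ (chartE n c).target : Set (ℝ × Model n)) :=
    isOpen_univ.prod (isOpen_extChartAt_target c)
  have hset : ∀ f : M → ℝ, ∫ y in (chartE n c).target, chartTerm g f c y =
      ∫ y in K, chartTerm g f c y := fun f =>
    setIntegral_eq_of_subset_of_forall_sdiff_eq_zero (isOpen_extChartAt_target c).measurableSet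
      hKt fun y hy => chartTerm_eq_zero g f c y (chartE_symm_notMem hy)
  simp only [hset]
  set Φ : ℝ × Model n → ℝ := fun p => H p.1 ((chartE n c).symm p.2) with hΦ
  set w : Model n → ℝ := fun y => chartPartition n M c ((chartE n c).symm y) * chartDensity g c y with hw
  have hwc : ContinuousOn w (chartE n c).target :=
    (continuousOn_comp_symm (chartPartition n M c).contMDiff.continuous c).mul (continuousOn_chartDensity g c)
  have hterm : ∀ f y, chartTerm g f c y = f ((chartE n c).symm y) * w y := fun f y => by
    simp only [chartTerm, hw]; ring
  have hder : ∀ t, ∀ y ∈ (chartE n c).target,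
      HasDerivAt (fun s => Φ (s, y)) (fderiv ℝ Φ (t, y) (1, 0)) t := fun t y hy => by
    have h1 := (((hH c).contDiffAt (hopen.mem_nhds (show (t, y) ∈ _ from ⟨trivial, hy⟩))).differentiableAt
      (by simp)).hasFDerivAt
    have h2 : HasDerivAt (fun s : ℝ => (s, y)) ((1 : ℝ), (0 : Model n)) t :=
      (hasDerivAt_id t).prodMk (hasDerivAt_const t y)
    exact h1.comp_hasDerivAt t h2
  have hfc : ContinuousOn (fun p => fderiv ℝ Φ p (1, 0)) (Set.univ ×ˢ (chartE n c).target) :=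
    ((hH c).continuousOn_fderiv_of_isOpen hopen (by simp)).clm_apply continuousOn_const
  have hbc : IsCompact (Metric.closedBall (0 : ℝ) 1 ×ˢ K) := (isCompact_closedBall 0 1).prod hKc
  obtain ⟨C, hC⟩ := hbc.exists_bound_of_continuousOn (f := fun p => fderiv ℝ Φ p (1, 0) * w p.2)
    (((hfc.mono (Set.prod_mono (Set.subset_univ _) hKt))).mul
      ((hwc.mono hKt).comp continuousOn_snd fun p hp => hp.2))
  have hslice : ∀ t : ℝ, ∀ f : ℝ × Model n → ℝ, ContinuousOn f (Set.univ ×ˢ (chartE n c).target) →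
      ContinuousOn (fun y => f (t, y) * w y) K := fun t f hf =>
    (hf.comp (by fun_prop) fun y hy => ⟨trivial, hKt hy⟩).mul (hwc.mono hKt)
  have hmain := hasDerivAt_integral_of_dominated_loc_of_deriv_le
    (μ := volume.restrict K) (F := fun t y => chartTerm g (H t) c y)
    (F' := fun t y => fderiv ℝ Φ (t, y) (1, 0) * w y) (x₀ := (0 : ℝ))
    (s := Metric.closedBall (0 : ℝ) 1) (bound := fun _ => C) (Metric.closedBall_mem_nhds 0 one_pos) ?_ ?_ ?_ ?_ ?_ ?_
  · refine hmain.2.congr_deriv ?_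
    refine setIntegral_congr_fun hKc.measurableSet fun y hy => ?_
    rw [hterm, (hder 0 y (hKt hy)).unique (hH' ((chartE n c).symm y))]
  · refine Eventually.of_forall fun t => ?_
    simp only [hterm]
    exact (hslice t Φ (hH c).continuousOn).aestronglyMeasurable hKc.measurableSet
  · simp only [hterm]
    exact (hslice 0 Φ (hH c).continuousOn).integrableOn_compact hKc
  · exact (hslice 0 _ hfc).aestronglyMeasurable hKc.measurableSet
  · refine (ae_restrict_iff' hKc.measurableSet).2 (Eventually.of_forall fun y hy t ht => ?_)
    exact hC (t, y) ⟨ht, hy⟩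
  · exact integrableOn_const hKc.measure_lt_top.ne
  · refine (ae_restrict_iff' hKc.measurableSet).2 (Eventually.of_forall fun y hy t ht => ?_)
    simp only [hterm]
    exact (hder t y (hKt hy)).mul_const _

end IntegrationTheory

/-! ### The divergence theorem -/

section Stokes
open Filter Topology MeasureTheory

variable {n : ℕ} {M : Type*} [TopologicalSpace M] [ChartedSpace (Model n) M]
  [IsManifold (𝓡 (2 * n)) ∞ M] {k l : ℕ}

theorem metricIn_eq_pull (g : Metric n M) {c p : M} {y : Model n}
    (hy : y ∈ chartDomain c (chartE n p).source) :
    metricIn g c y = pullInner (fderiv ℝ (chartTrans c p) y) (metricIn g p (chartTrans c p y)) := by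
  have hb : (chartE n p).symm (chartTrans c p y) = (chartE n c).symm y := (chartE n p).left_inv hy.2
  have hq := (chartE n c).map_target hy.1
  rw [fderiv_chartTrans hy, metricIn, metricIn, jac, jac, hb]
  ext1 u
  ext1 v
  simp only [pullInner_apply]
  rw [tangentCoordChange_comp ⟨⟨hq, hy.2⟩, mem_extChartAt_source _⟩,
    tangentCoordChange_comp ⟨⟨hq, hy.2⟩, mem_extChartAt_source _⟩]

/-- The transformation rule of the Riemannian density, which makes the integral independent of charts. -/
theorem chartDensity_chartTrans (g : Metric n M) {c p : M} {y : Model n}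
    (hy : y ∈ chartDomain c (chartE n p).source) :
    |(fderiv ℝ (chartTrans c p) y).det| * chartDensity g p (chartTrans c p y) = chartDensity g c y := by
  rw [chartDensity_eq, chartDensity_eq, metricIn_eq_pull g hy, det_gramAt_pull,
    Real.sqrt_mul (sq_nonneg _), Real.sqrt_sq_eq_abs]

theorem chartTrans_mem {c p : M} {y : Model n} (hy : y ∈ chartDomain c (chartE n p).source) :
    chartTrans c p y ∈ chartDomain p (chartE n c).source := by
  refine ⟨(chartE n p).map_source hy.2, ?_⟩
  rw [Set.mem_preimage, show (extChartAt (𝓡 (2 * n)) p).symm (chartTrans c p y) = (chartE n c).symm y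
    from (chartE n p).left_inv hy.2]
  exact (chartE n c).map_target hy.1

theorem chartTrans_chartTrans {c p : M} {y : Model n} (hy : y ∈ chartDomain c (chartE n p).source) :
    chartTrans p c (chartTrans c p y) = y := by
  rw [chartTrans, show (chartE n p).symm (chartTrans c p y) = (chartE n c).symm y
    from (chartE n p).left_inv hy.2, (chartE n c).right_inv hy.1]

theorem image_chartTrans (c p : M) : chartTrans c p '' chartDomain (n := n) c (chartE n p).source =
    chartDomain p (chartE n c).source := by
  ext z
  refine ⟨?_, fun hz => ⟨chartTrans p c z, chartTrans_mem hz, chartTrans_chartTrans hz⟩⟩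
  rintro ⟨y, hy, rfl⟩
  exact chartTrans_mem hy

theorem continuous_of_charts {f : M → ℝ}
    (hf : ∀ c : M, ContinuousOn (fun y => f ((chartE n c).symm y)) (chartE n c).target) :
    Continuous f := by
  rw [continuous_iff_continuousAt]
  intro x
  have h1 : ContinuousAt (fun y => f ((chartE n x).symm y)) (chartE n x x) :=
    (hf x).continuousAt ((isOpen_extChartAt_target x).mem_nhds (mem_extChartAt_target x))
  have h2 : ContinuousAt (fun z => f ((chartE n x).symm (chartE n x z))) x :=
    ContinuousAt.comp (f := chartE n x) (g := fun y => f ((chartE n x).symm y)) h1 (continuousAt_extChartAt x)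
  refine h2.congr ?_
  filter_upwards [(isOpen_extChartAt_source (I := 𝓡 (2 * n)) x).mem_nhds (mem_extChartAt_source x)] with z hz
  rw [(chartE n x).left_inv hz]

variable (S : SymplecticRiemannian n M)

/-- The version of `map_comp_eq_det_smul` for a top form whose degree is only propositionally `2 * n`. -/
theorem comp_frame_cast {d : ℕ} (h : d = 2 * n) (μ : Model n [⋀^Fin d]→L[ℝ] ℝ)
    (T : Model n →L[ℝ] Model n) : μ (fun i => T ((frame ∘ Fin.cast h) i)) =
      LinearMap.det (T : Model n →ₗ[ℝ] Model n) * μ (frame ∘ Fin.cast h) := by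
  subst h
  exact map_comp_eq_det_smul μ T frame

/-- The function `f` with `dν = f vol`, for a form `ν` of degree `2n - 1`. -/
def divergence (h' : l + 1 + 1 = 2 * n) (ν : M → Model n [⋀^Fin (l + 1)]→L[ℝ] ℝ) (x : M) : ℝ :=
  extDer ν x (frame ∘ Fin.cast h') / volForm S x frame

theorem divergence_chart (h' : l + 1 + 1 = 2 * n) {ν : M → Model n [⋀^Fin (l + 1)]→L[ℝ] ℝ}
    (hν : IsSmoothFormOn Set.univ ν) {c : M} {y : Model n} (hy : y ∈ (chartE n c).target) :
    divergence S h' ν ((chartE n c).symm y) =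
      extDeriv (inChart c ν) y (frame ∘ Fin.cast h') / volIn S c y frame := by
  have hy' : y ∈ chartDomain c Set.univ := ⟨hy, trivial⟩
  rw [← inChart_extDer isOpen_univ hν hy', ← inChart_volForm S hy, inChart_eq, inChart_eq]
  simp only [ContinuousAlternatingMap.compContinuousLinearMap_apply]
  have h1 := comp_frame_cast h' (extDer ν ((chartE n c).symm y)) (jac c y)
  have h2 := map_comp_eq_det_smul (volForm S ((chartE n c).symm y)) (jac c y) frame
  have h3 := det_ne_zero_of_bijective (jac_bijective hy)
  simp only [Function.comp_def] at h1 h2 ⊢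
  rw [h1, h2, mul_div_mul_left _ _ h3]
  rfl

theorem volIn_frame_ne_zero {c : M} {y : Model n} (hy : y ∈ (chartE n c).target) :
    volIn S c y frame ≠ 0 := by
  have h1 := volAt_frame_mul_coframe (isInner_metricIn S.metric hy)
    (inChart_ne_zero S.orientation.ne_zero hy)
  exact left_ne_zero_of_mul (h1.trans_ne one_ne_zero)

theorem continuous_divergence (h' : l + 1 + 1 = 2 * n) {ν : M → Model n [⋀^Fin (l + 1)]→L[ℝ] ℝ}
    (hν : IsSmoothFormOn Set.univ ν) : Continuous (divergence S h' ν) := by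
  refine continuous_of_charts (n := n) fun c => ?_
  have h1 := contDiffOn_extDeriv (isOpen_chartDomain c isOpen_univ) (hν c)
  rw [chartDomain_univ] at h1
  have h2 := (contDiffOn_form_iff.1 h1 (frame ∘ Fin.cast h')).continuousOn.div
    (contDiffOn_form_iff.1 (contDiffOn_volIn S c) frame).continuousOn
    fun y hy => volIn_frame_ne_zero S hy
  exact h2.congr fun y hy => divergence_chart S h' hν hy

variable [T2Space M] [CompactSpace M]

/-- The integral of a function supported in a chart domain can be computed in that chart. -/
theorem integral_eq_chart (g : Metric n M) {f : M → ℝ} (hf : Continuous f) {c : M} {K : Set M}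
    (hK : IsClosed K) (hKc : K ⊆ (chartE n c).source) (h0 : ∀ x, x ∉ K → f x = 0) :
    integral g f = ∫ y in (chartE n c).target, f ((chartE n c).symm y) * chartDensity g c y := by
  have hterm : ∀ p : M, ∫ y in (chartE n p).target, chartTerm g f p y =
      ∫ y in (chartE n c).target, chartPartition n M p ((chartE n c).symm y) *
        (f ((chartE n c).symm y) * chartDensity g c y) := by
    intro p
    have hmeas : ∀ c : M, MeasurableSet (chartE n c).target := fun c =>
      (isOpen_extChartAt_target c).measurableSet
    have hopen := isOpen_chartDomain_source (n := n) c p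
    have h1 : ∫ y in (chartE n p).target, chartTerm g f p y =
        ∫ y in chartDomain p (chartE n c).source, chartTerm g f p y := by
      refine setIntegral_eq_of_subset_of_forall_sdiff_eq_zero (hmeas p) (chartDomain_subset _ _) ?_
      intro y hy
      have : (chartE n p).symm y ∉ K := fun h => hy.2 ⟨hy.1, hKc h⟩
      rw [chartTerm, h0 _ this, mul_zero, zero_mul]
    rw [h1, ← image_chartTrans, integral_image_eq_integral_abs_det_fderiv_smul volume
      hopen.measurableSet
      (fun y hy => ((contDiffAt_chartTrans hy).differentiableAt (by simp)).hasFDerivAt.hasFDerivWithinAt)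
      (fun y hy z hz h => by rw [← chartTrans_chartTrans hy, h, chartTrans_chartTrans hz])]
    rw [setIntegral_eq_of_subset_of_forall_sdiff_eq_zero (hmeas c) (chartDomain_subset c (chartE n p).source)]
    · refine setIntegral_congr_fun hopen.measurableSet fun y hy => ?_
      have hb : (chartE n p).symm (chartTrans c p y) = (chartE n c).symm y := (chartE n p).left_inv hy.2
      simp only [smul_eq_mul, chartTerm, hb, ← chartDensity_chartTrans g hy]
      ring
    · intro y hy
      have : (chartE n c).symm y ∉ tsupport (chartPartition n M p) :=
        fun h => hy.2 ⟨hy.1, tsupport_chartPartition_subset p h⟩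
      rw [image_eq_zero_of_notMem_tsupport this, zero_mul]
  rw [integral_eq_sum]
  simp only [hterm]
  rw [← MeasureTheory.integral_finsetSum]
  · simp only [← Finset.sum_mul, sum_chartPartition, one_mul]
  · intro p _
    refine integrableOn_target hK hKc ((continuousOn_comp_symm
      (chartPartition n M p).contMDiff.continuous c).mul ((continuousOn_comp_symm hf c).mul
        (continuousOn_chartDensity g c))) fun y _ hyK => ?_
    rw [h0 _ hyK, zero_mul, mul_zero]

/-- The integral of a partial derivative of a compactly supported function vanishes; the locally
constant factor `σ` accounts for the orientation of the chart. -/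
theorem integral_fderiv_eq_zero {c : M} {K : Set M} (hK : IsClosed K)
    (hKc : K ⊆ (chartE n c).source) {h : Model n → ℝ} (hh : ContDiffOn ℝ ∞ h (chartE n c).target)
    (h0 : ∀ y ∈ (chartE n c).target, (chartE n c).symm y ∉ K → h y = 0)
    {σ : Model n → ℝ} (hσ : ∀ y ∈ (chartE n c).target, ∀ᶠ z in 𝓝 y, σ z = σ y) (u : Model n) :
    IntegrableOn (fun y => σ y * fderiv ℝ h y u) (chartE n c).target ∧
      ∫ y in (chartE n c).target, σ y * fderiv ℝ h y u = 0 := by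
  have hopen := isOpen_extChartAt_target (I := 𝓡 (2 * n)) c
  have hσc : ContinuousOn σ (chartE n c).target := fun y hy =>
    (continuousAt_const.congr (hσ y hy |>.mono fun z hz => hz.symm)).continuousWithinAt
  have hKcl : IsClosed (chartE n c '' K) := (isCompact_image_chartE hK hKc).isClosed
  set H : Model n → ℝ := (chartE n c).target.indicator fun y => σ y * h y with hH
  -- off the image of `K`, the extension by zero vanishes near every point
  have hoff : ∀ y, y ∉ chartE n c '' K → ∀ᶠ z in 𝓝 y, H z = 0 := by
    intro y hy
    filter_upwards [hKcl.isOpen_compl.mem_nhds hy] with z hz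
    by_cases hzt : z ∈ (chartE n c).target
    · rw [hH, Set.indicator_of_mem hzt, h0 z hzt (chartE_symm_notMem ⟨hzt, hz⟩), mul_zero]
    · rw [hH, Set.indicator_of_notMem hzt]
  have hnot : ∀ y, y ∉ (chartE n c).target → y ∉ chartE n c '' K := fun y hy h =>
    hy (image_chartE_subset hKc h)
  have hin : ∀ y ∈ (chartE n c).target, HasFDerivAt H (σ y • fderiv ℝ h y) y := by
    intro y hy
    have h1 := (((hh.contDiffAt (hopen.mem_nhds hy)).differentiableAt (by simp)).hasFDerivAt).const_smul (σ y)
    refine h1.congr_of_eventuallyEq ?_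
    filter_upwards [hσ y hy, hopen.mem_nhds hy] with z hz hzt
    rw [hH, Set.indicator_of_mem hzt, hz]
    rfl
  have hout : ∀ y, y ∉ (chartE n c).target → HasFDerivAt H (0 : Model n →L[ℝ] ℝ) y := by
    intro y hy
    exact (hasFDerivAt_const (0 : ℝ) y).congr_of_eventuallyEq (hoff y (hnot y hy))
  have hdiff : Differentiable ℝ H := fun y => by
    by_cases hy : y ∈ (chartE n c).target
    · exact (hin y hy).differentiableAt
    · exact (hout y hy).differentiableAt
  have hfd : (fun y => fderiv ℝ H y u) =
      (chartE n c).target.indicator fun y => σ y * fderiv ℝ h y u := by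
    funext y
    by_cases hy : y ∈ (chartE n c).target
    · rw [(hin y hy).fderiv, Set.indicator_of_mem hy]
      rfl
    · rw [(hout y hy).fderiv, Set.indicator_of_notMem hy]
      rfl
  have hfz : ∀ y ∈ (chartE n c).target, (chartE n c).symm y ∉ K → fderiv ℝ h y = 0 := by
    intro y hy hyK
    have h1 : h =ᶠ[𝓝 y] fun _ => 0 := by
      have hyK' : y ∉ chartE n c '' K := by
        rintro ⟨x, hx, rfl⟩
        rw [(chartE n c).left_inv (hKc hx)] at hyK
        exact hyK hx
      filter_upwards [hKcl.isOpen_compl.mem_nhds hyK', hopen.mem_nhds hy] with z hz hzt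
      exact h0 z hzt (chartE_symm_notMem ⟨hzt, hz⟩)
    rw [h1.fderiv_eq, fderiv_const_apply]
  have hint : Integrable H := by
    refine IntegrableOn.integrable_indicator ?_ hopen.measurableSet
    exact integrableOn_target hK hKc (hσc.mul hh.continuousOn) fun y hy hyK => by
      rw [h0 y hy hyK, mul_zero]
  have hintOn : IntegrableOn (fun y => σ y * fderiv ℝ h y u) (chartE n c).target := by
    refine integrableOn_target hK hKc (hσc.mul
      ((hh.continuousOn_fderiv_of_isOpen hopen (by simp)).clm_apply continuousOn_const))
      fun y hy hyK => ?_
    rw [hfz y hy hyK, zero_apply, mul_zero]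
  have hint' : Integrable fun y => fderiv ℝ H y u := by
    rw [hfd]
    exact hintOn.integrable_indicator hopen.measurableSet
  have hmain := integral_mul_fderiv_eq_neg_fderiv_mul_of_integrable (μ := (volume : Measure (Model n)))
    (f := fun _ => (1 : ℝ)) (g := H) (v := u) (by simp) (by simpa using hint') (by simpa using hint)
    (fun _ _ => differentiableAt_const _) (fun x _ => hdiff x)
  refine ⟨hintOn, ?_⟩
  rw [← integral_indicator hopen.measurableSet, ← hfd]
  simpa using hmain

/-- Stokes' theorem for forms supported in a chart domain. -/
theorem integral_divergence_of_support (h' : l + 1 + 1 = 2 * n)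
    {ν : M → Model n [⋀^Fin (l + 1)]→L[ℝ] ℝ} (hν : IsSmoothFormOn Set.univ ν) {c : M} {K : Set M}
    (hK : IsClosed K) (hKc : K ⊆ (chartE n c).source) (h0 : ∀ x, x ∉ K → ν x = 0) :
    integral S.metric (divergence S h' ν) = 0 := by
  have hopen := isOpen_extChartAt_target (I := 𝓡 (2 * n)) c
  have hd0 : ∀ x, x ∉ K → divergence S h' ν x = 0 := by
    intro x hx
    have h1 : inChart x ν =ᶠ[𝓝 (chartE n x x)] fun _ => 0 := by
      filter_upwards [(isOpen_chartDomain x hK.isOpen_compl).mem_nhds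
        (chartE_self_mem_chartDomain hx)] with y hy
      rw [inChart_eq, h0 _ hy.2]
      rfl
    rw [divergence, extDer, h1.extDeriv_eq]
    simp [extDeriv_eq_sum]
  rw [integral_eq_chart S.metric (continuous_divergence S h' hν) hK hKc hd0]
  set s : Model n → ℝ := fun y => inChart c S.orientation.toForm y frame with hs
  have hs0 : ∀ y ∈ (chartE n c).target, s y ≠ 0 := fun y hy =>
    map_frame_ne_zero (inChart_ne_zero S.orientation.ne_zero hy)
  have hsc : ContinuousOn s (chartE n c).target := by
    have h1 := S.orientation.smooth c
    rw [chartDomain_univ] at h1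
    exact (contDiffOn_form_iff.1 h1 frame).continuousOn
  -- `σ` is the sign of the orientation form relative to the chart, hence locally constant
  set σ : Model n → ℝ := fun y => |s y| / s y with hσ
  have hσc : ∀ y ∈ (chartE n c).target, ∀ᶠ z in 𝓝 y, σ z = σ y := by
    intro y hy
    have hcy := hsc.continuousAt (hopen.mem_nhds hy)
    rcases lt_or_gt_of_ne (hs0 y hy) with h | h
    · filter_upwards [hcy.eventually_lt continuousAt_const h] with z hz
      rw [hσ]
      simp only [abs_of_neg h, abs_of_neg hz]
      rw [neg_div_self h.ne, neg_div_self hz.ne]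
    · filter_upwards [continuousAt_const.eventually_lt hcy h] with z hz
      rw [hσ]
      simp only [abs_of_pos h, abs_of_pos hz]
      rw [div_self h.ne', div_self hz.ne']
  have hνc : ContDiffOn ℝ ∞ (inChart c ν) (chartE n c).target := by
    have := hν c
    rwa [chartDomain_univ] at this
  -- in the chart, the divergence is a sum of partial derivatives of the coefficients of `ν`
  have hval : ∀ y ∈ (chartE n c).target,
      divergence S h' ν ((chartE n c).symm y) * chartDensity S.metric c y =
        ∑ i : Fin (l + 1 + 1), (-1 : ℝ) ^ (i : ℕ) * (σ y * fderiv ℝ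
          (fun z => inChart c ν z (i.removeNth (frame ∘ Fin.cast h'))) y ((frame ∘ Fin.cast h') i)) := by
    intro y hy
    have hdy := (hνc.contDiffAt (hopen.mem_nhds hy)).differentiableAt (by simp)
    have h1 : volIn S c y frame = chartDensity S.metric c y / |s y| * s y := rfl
    have h2 := chartDensity_pos S.metric hy
    have h3 := hs0 y hy
    have h4 := abs_ne_zero.2 h3
    rw [divergence_chart S h' hν hy, h1, extDeriv_eq_sum]
    have h5 : ∀ a : ℝ, a / (chartDensity S.metric c y / |s y| * s y) * chartDensity S.metric c y =
        σ y * a := by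
      intro a
      rw [hσ]
      field_simp
    rw [h5, Finset.mul_sum]
    refine Finset.sum_congr rfl fun i _ => ?_
    rw [fderiv_form_apply hdy, smul_eq_mul]
    ring
  rw [setIntegral_congr_fun hopen.measurableSet hval]
  have hz : ∀ w, ∀ y ∈ (chartE n c).target, (chartE n c).symm y ∉ K → inChart c ν y w = 0 := by
    intro w y _ hyK
    rw [inChart_eq, h0 _ hyK]
    rfl
  have hterm := fun i : Fin (l + 1 + 1) => integral_fderiv_eq_zero hK hKc
    (contDiffOn_form_iff.1 hνc (i.removeNth (frame ∘ Fin.cast h'))) (hz _) hσc ((frame ∘ Fin.cast h') i)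
  rw [MeasureTheory.integral_finsetSum]
  · refine Finset.sum_eq_zero fun i _ => ?_
    rw [MeasureTheory.integral_const_mul, (hterm i).2, mul_zero]
  · exact fun i _ => (hterm i).1.const_mul _

theorem extDer_add {U : Set M} (hU : IsOpen U) {ν ν' : M → Model n [⋀^Fin k]→L[ℝ] ℝ}
    (hν : IsSmoothFormOn U ν) (hν' : IsSmoothFormOn U ν') {x : M} (hx : x ∈ U) :
    extDer (fun z => ν z + ν' z) x = extDer ν x + extDer ν' x :=
  extDeriv_add ((hν.contDiffAt hU (chartE_self_mem_chartDomain hx)).differentiableAt (by simp))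
    ((hν'.contDiffAt hU (chartE_self_mem_chartDomain hx)).differentiableAt (by simp))

theorem isSmoothFormOn_sum {ι : Type*} (s : Finset ι) {U : Set M} {ν : ι → M → Model n [⋀^Fin k]→L[ℝ] ℝ}
    (hν : ∀ i, IsSmoothFormOn U (ν i)) : IsSmoothFormOn U (fun x => ∑ i ∈ s, ν i x) := by
  intro c
  refine contDiffOn_form fun v => ?_
  have h : ContDiffOn ℝ ∞ (fun y => ∑ i ∈ s, inChart c (ν i) y v) (chartDomain c U) :=
    ContDiffOn.sum fun i _ => contDiffOn_form_iff.1 (hν i c) v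
  refine h.congr fun y _ => ?_
  rw [inChart_eq, ContinuousAlternatingMap.compContinuousLinearMap_apply,
    ContinuousAlternatingMap.sum_apply]
  rfl

theorem divergence_sum {ι : Type*} (s : Finset ι) (h' : l + 1 + 1 = 2 * n)
    {ν : ι → M → Model n [⋀^Fin (l + 1)]→L[ℝ] ℝ} (hν : ∀ i, IsSmoothFormOn Set.univ (ν i)) (x : M) :
    divergence S h' (fun x => ∑ i ∈ s, ν i x) x = ∑ i ∈ s, divergence S h' (ν i) x := by
  classical
  induction s using Finset.induction_on with
  | empty =>
    have h1 : inChart x (fun x => ∑ i ∈ (∅ : Finset ι), ν i x) = fun _ => 0 := by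
      funext y
      rw [inChart_eq, Finset.sum_empty]
      rfl
    rw [divergence, extDer, h1]
    simp [extDeriv_eq_sum]
  | insert a s ha ih =>
    simp only [Finset.sum_insert ha]
    rw [← ih, divergence, extDer_add isOpen_univ (hν a) (isSmoothFormOn_sum s hν) trivial,
      ContinuousAlternatingMap.add_apply, add_div]
    rfl

theorem contDiffOn_chartPartition (c p : M) :
    ContDiffOn ℝ ∞ (fun y => chartPartition n M c ((chartE n p).symm y)) (chartE n p).target := by
  rw [← contMDiffOn_iff_contDiffOn]
  exact (chartPartition n M c).contMDiff.comp_contMDiffOn (contMDiffOn_extChartAt_symm p)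

/-- Stokes' theorem on a closed oriented Riemannian manifold. -/
theorem integral_divergence (h' : l + 1 + 1 = 2 * n)
    {ν : M → Model n [⋀^Fin (l + 1)]→L[ℝ] ℝ} (hν : IsSmoothFormOn Set.univ ν) :
    integral S.metric (divergence S h' ν) = 0 := by
  have hsm : ∀ c : M, IsSmoothFormOn Set.univ (fun x => chartPartition n M c x • ν x) := fun c =>
    hν.fun_smul fun p => (contDiffOn_chartPartition c p).mono (chartDomain_subset p _)
  have h1 : divergence S h' ν = fun x => ∑ c ∈ chartFinset n M,
      divergence S h' (fun x => chartPartition n M c x • ν x) x := by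
    funext x
    rw [← divergence_sum S _ h' hsm]
    congr 1
    funext z
    rw [← Finset.sum_smul, sum_chartPartition, one_smul]
  rw [h1, integral_finset_sum S.metric _ fun c _ => continuous_divergence S h' (hsm c)]
  refine Finset.sum_eq_zero fun c _ => integral_divergence_of_support S h' (hsm c)
    (isClosed_tsupport _) (tsupport_chartPartition_subset c) fun x hx => ?_
  rw [image_eq_zero_of_notMem_tsupport hx, zero_smul]

end Stokes

section GaugeTransformations
open Filter Topology
open ContinuousAlternatingMap (ofSubsingleton)

variable {n : ℕ} {M : Type*} [TopologicalSpace M] [ChartedSpace (Model n) M]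
  [IsManifold (𝓡 (2 * n)) ∞ M]
  {V W X : Type*} [NormedAddCommGroup V] [NormedSpace ℝ V] [NormedAddCommGroup W] [NormedSpace ℝ W]
  [NormedAddCommGroup X] [NormedSpace ℝ X] {k l : ℕ}
  {EG : Type*} [NormedAddCommGroup EG] [NormedSpace ℝ EG]
  {G : Type*} [TopologicalSpace G] [ChartedSpace EG G] [Group G] [LieGroup 𝓘(ℝ, EG) ∞ G]

/-! ### Linear changes of the coefficients -/

theorem starAt_map (R : V →L[ℝ] W) (g : Model n →L[ℝ] Model n →L[ℝ] ℝ)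
    (m : Model n [⋀^Fin (2 * n)]→L[ℝ] ℝ) (h : k + l = 2 * n) (β : Model n [⋀^Fin k]→L[ℝ] V) :
    starAt g m h (R.compContinuousAlternatingMap β) = R.compContinuousAlternatingMap (starAt g m h β) := by
  ext v
  simp only [starAt_apply, ContinuousLinearMap.compContinuousAlternatingMap_coe, Function.comp_apply,
    map_smul, map_sum]

theorem primAt_map (R : V →L[ℝ] W) (g : Model n →L[ℝ] Model n →L[ℝ] ℝ)
    (w : Model n [⋀^Fin 2]→L[ℝ] ℝ) (α : Model n [⋀^Fin 2]→L[ℝ] V) :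
    primAt g w (R.compContinuousAlternatingMap α) = R.compContinuousAlternatingMap (primAt g w α) := by
  have h : pairAt g (ContinuousLinearMap.lsmul ℝ ℝ) w (R.compContinuousAlternatingMap α) =
      R (pairAt g (ContinuousLinearMap.lsmul ℝ ℝ) w α) := by
    simp [pairAt, map_sum]
  ext v
  simp only [primAt, h, ContinuousAlternatingMap.sub_apply, tensor_apply,
    ContinuousLinearMap.compContinuousAlternatingMap_coe, Function.comp_apply, map_sub, map_smul]

theorem pairAt_map (g : Model n →L[ℝ] Model n →L[ℝ] ℝ) {R : V →L[ℝ] V} {b : V →L[ℝ] V →L[ℝ] ℝ}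
    (hR : ∀ u v, b (R u) (R v) = b u v) (α β : Model n [⋀^Fin k]→L[ℝ] V) :
    pairAt g b (R.compContinuousAlternatingMap α) (R.compContinuousAlternatingMap β) =
      pairAt g b α β := by
  simp only [pairAt, ContinuousLinearMap.compContinuousAlternatingMap_coe, Function.comp_apply, hR]

theorem wedgeOne_map {b : V →L[ℝ] V →L[ℝ] ℝ} {R : V →L[ℝ] V} (hR : ∀ u v, b (R u) (R v) = b u v)
    (α : Model n →L[ℝ] V) (γ : Model n [⋀^Fin k]→L[ℝ] V) :
    wedgeOne b (R ∘L α) (R.compContinuousAlternatingMap γ) = wedgeOne b α γ := by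
  ext v
  simp only [wedgeOne_apply, ContinuousLinearMap.compContinuousAlternatingMap_coe,
    Function.comp_apply, ContinuousLinearMap.comp_apply, hR]

/-! ### Logarithmic derivatives in charts -/

theorem leftLogDeriv_eq_logDeriv {g : M → G} {x : M} (hg : ContMDiffAt (𝓡 (2 * n)) 𝓘(ℝ, EG) ∞ g x) :
    (leftLogDeriv g x : Model n →L[ℝ] EG) =
      logDeriv (fun z => g ((chartE n x).symm z)) (chartE n x x) := by
  have hd : MDifferentiableAt (𝓡 (2 * n)) 𝓘(ℝ, EG) (fun y => (g x)⁻¹ * g y) x :=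
    ((contMDiff_mul_left (I := 𝓘(ℝ, EG)) (n := ∞)).contMDiffAt.comp x hg).mdifferentiableAt (by simp)
  rw [leftLogDeriv, hd.mfderiv, logDeriv]
  have h1 : (g x)⁻¹ * g x = 1 := by simp
  simp only [writtenInExtChartAt, h1, modelWithCornersSelf_coe, Set.range_id, fderivWithin_univ]
  rw [show (chartE n x).symm (chartE n x x) = x from extChartAt_to_inv x]
  rfl

variable [FiniteDimensional ℝ EG]

theorem logDeriv_comp {E F : Type*} [NormedAddCommGroup E] [NormedSpace ℝ E]
    [NormedAddCommGroup F] [NormedSpace ℝ F] {γ : F → G} {ψ : E → F} {y : E}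
    (hγ : ContMDiffAt 𝓘(ℝ, F) 𝓘(ℝ, EG) ∞ γ (ψ y)) (hψ : DifferentiableAt ℝ ψ y) :
    (logDeriv (fun z => γ (ψ z)) y : E →L[ℝ] EG) = logDeriv γ (ψ y) ∘L fderiv ℝ ψ y :=
  (((contDiffAt_quotChart hγ).differentiableAt (by simp)).hasFDerivAt.comp y hψ.hasFDerivAt).fderiv

theorem contMDiffAt_comp_chart {g : M → G} {U : Set M} (hU : IsOpen U)
    (hg : ContMDiffOn (𝓡 (2 * n)) 𝓘(ℝ, EG) ∞ g U) {c : M} {y : Model n} (hy : y ∈ chartDomain c U) :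
    ContMDiffAt 𝓘(ℝ, Model n) 𝓘(ℝ, EG) ∞ (fun z => g ((chartE n c).symm z)) y :=
  ContMDiffAt.comp y (hg.contMDiffAt (hU.mem_nhds hy.2))
    ((contMDiffOn_extChartAt_symm c).contMDiffAt ((isOpen_extChartAt_target c).mem_nhds hy.1))

/-- The logarithmic derivative of a `G`-valued function on `M`, read in an arbitrary chart. -/
theorem leftLogDeriv_comp_jac {g : M → G} {U : Set M} (hU : IsOpen U)
    (hg : ContMDiffOn (𝓡 (2 * n)) 𝓘(ℝ, EG) ∞ g U) {c : M} {y : Model n} (hy : y ∈ chartDomain c U) :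
    (leftLogDeriv g ((chartE n c).symm y) : Model n →L[ℝ] EG) ∘L jac c y =
      logDeriv (fun z => g ((chartE n c).symm z)) y := by
  set p := (chartE n c).symm y with hp
  have hy' : y ∈ chartDomain c (chartE n p).source := ⟨hy.1, mem_extChartAt_source p⟩
  have h1 : (fun z => g ((chartE n c).symm z)) =ᶠ[𝓝 y]
      fun z => (fun w => g ((chartE n p).symm w)) (chartTrans c p z) := by
    filter_upwards [(isOpen_chartDomain_source c p).mem_nhds hy'] with z hz
    rw [show (chartE n p).symm (chartTrans c p z) = (chartE n c).symm z from (chartE n p).left_inv hz.2]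
  have h2 : (logDeriv (fun z => g ((chartE n c).symm z)) y : Model n →L[ℝ] EG) =
      logDeriv (fun z => (fun w => g ((chartE n p).symm w)) (chartTrans c p z)) y := by
    rw [logDeriv, logDeriv, ← h1.eq_of_nhds]
    refine Filter.EventuallyEq.fderiv_eq ?_
    filter_upwards [h1] with z hz
    rw [← hz]
  rw [h2, logDeriv_comp (ψ := chartTrans c p) (γ := fun w => g ((chartE n p).symm w))
      (contMDiffAt_comp_chart hU hg (c := p) (chartE_self_mem_chartDomain hy.2))
    ((contDiffAt_chartTrans hy').differentiableAt (by simp)), fderiv_chartTrans hy',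
    leftLogDeriv_eq_logDeriv (hg.contMDiffAt (hU.mem_nhds hy.2))]
  rfl

theorem bracket_skew (u v : EG) : bracket G u v = -bracket G v u := by
  have : CompleteSpace EG := FiniteDimensional.complete ℝ EG
  have : LieGroup 𝓘(ℝ, EG) (minSmoothness ℝ 3) G :=
    LieGroup.of_le (n := ∞) (by simpa using WithTop.coe_le_coe.2 (le_top : (3 : ℕ∞) ≤ ⊤))
  exact (lie_skew (L := GroupLieAlgebra 𝓘(ℝ, EG) G) u v).symm

/-- The curvature `da + ½[a ∧ a]` is gauge covariant. The Maurer–Cartan equation cancels the quadratic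
terms in `γ⁻¹ dγ`, and the derivative of `Ad(γ⁻¹)` cancels the mixed ones. -/
theorem curvature_gauge {γ : Model n → G} {y : Model n}
    (hγ : ∀ᶠ z in 𝓝 y, ContMDiffAt 𝓘(ℝ, Model n) 𝓘(ℝ, EG) ∞ γ z)
    {a a' : Model n → Model n →L[ℝ] EG} (ha : DifferentiableAt ℝ a y)
    (h : a' =ᶠ[𝓝 y] fun z => Ad (γ z)⁻¹ ∘L a z + logDeriv γ z) (u v : Model n) :
    fderiv ℝ a' y u v - fderiv ℝ a' y v u + bracket G (a' y u) (a' y v) =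
      Ad (γ y)⁻¹ (fderiv ℝ a y u v - fderiv ℝ a y v u + bracket G (a y u) (a y v)) := by
  have hγy := hγ.self_of_nhds
  have h1 := (((contDiffAt_Ad_inv_comp hγy).differentiableAt (by simp)).hasFDerivAt.clm_comp
    ha.hasFDerivAt).add (((contDiffAt_logDeriv hγ).differentiableAt (by simp)).hasFDerivAt)
  have h2 : fderiv ℝ a' y = _ := h.fderiv_eq.trans h1.fderiv
  have key : ∀ u v, fderiv ℝ a' y u v = Ad (γ y)⁻¹ (fderiv ℝ a y u v) -
      bracket G (logDeriv γ y u) (Ad (γ y)⁻¹ (a y v)) + fderiv ℝ (logDeriv γ) y u v := by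
    intro u v
    rw [h2, sub_eq_add_neg, ← fderiv_Ad_inv_comp hγy]
    rfl
  have h3 : ∀ u, a' y u = Ad (γ y)⁻¹ (a y u) + logDeriv γ y u := fun u => by
    rw [h.eq_of_nhds]
    rfl
  have h4 := fderiv_logDeriv_sub hγ u v
  rw [key, key, h3, h3]
  simp only [map_add, map_sub, add_apply, Ad_bracket]
  rw [bracket_skew (Ad (γ y)⁻¹ (a y u)) (logDeriv γ y v)]
  rw [sub_eq_iff_eq_add] at h4
  rw [h4]
  abel

/-- The exterior derivative of `Ad(γ⁻¹) η` differs from `Ad(γ⁻¹) dη` by a bracket with `γ⁻¹ dγ`, which is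
the inhomogeneous term in the gauge transformation of a connection. -/
theorem extDeriv_gauge {γ : Model n → G} {y : Model n}
    (hγ : ContMDiffAt 𝓘(ℝ, Model n) 𝓘(ℝ, EG) ∞ γ y)
    {η η' : Model n → Model n [⋀^Fin k]→L[ℝ] EG} (hη : ∀ v, DifferentiableAt ℝ (fun z => η z v) y)
    (hη1 : DifferentiableAt ℝ η y) (hη2 : DifferentiableAt ℝ η' y)
    (h : η' =ᶠ[𝓝 y] fun z => (Ad (γ z)⁻¹).compContinuousAlternatingMap (η z)) :
    extDeriv η' y + wedgeOne (bracket G) (logDeriv γ y) (η' y) =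
      (Ad (γ y)⁻¹).compContinuousAlternatingMap (extDeriv η y) := by
  ext v
  rw [ContinuousAlternatingMap.add_apply, extDeriv_eq_sum, wedgeOne_apply, ← Finset.sum_add_distrib,
    ContinuousLinearMap.compContinuousAlternatingMap_coe, Function.comp_apply, extDeriv_eq_sum, map_sum]
  refine Finset.sum_congr rfl fun i _ => ?_
  rw [← smul_add, map_smul]
  congr 1
  have h1 := (((contDiffAt_Ad_inv_comp hγ).differentiableAt (by simp)).hasFDerivAt.clm_apply
    (hη (i.removeNth v)).hasFDerivAt)
  have h3 : (fun z => η' z (i.removeNth v)) =ᶠ[𝓝 y] fun z => Ad (γ z)⁻¹ (η z (i.removeNth v)) := by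
    filter_upwards [h] with z hz
    rw [hz]
    rfl
  have h2 := (h3.fderiv_eq (𝕜 := ℝ)).trans h1.fderiv
  rw [fderiv_form_apply hη2, h2, fderiv_form_apply hη1, h3.eq_of_nhds]
  have h4 := fderiv_Ad_inv_comp hγ (v i) (η y (i.removeNth v))
  simp only [add_apply, ContinuousLinearMap.comp_apply, ContinuousLinearMap.flip_apply]
  rw [h4]
  abel

end GaugeTransformations

/-! ### Forms with values in the adjoint bundle -/

section AdjointForms
open Filter Topology
open ContinuousAlternatingMap (ofSubsingleton)

variable {n : ℕ} {M : Type*} [TopologicalSpace M] [ChartedSpace (Model n) M]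
  [IsManifold (𝓡 (2 * n)) ∞ M]
  {EG : Type*} [NormedAddCommGroup EG] [NormedSpace ℝ EG] [FiniteDimensional ℝ EG]
  {G : Type*} [TopologicalSpace G] [ChartedSpace EG G] [Group G] [LieGroup 𝓘(ℝ, EG) ∞ G]
  {P : PrincipalBundle n M EG G} {k l : ℕ}

theorem IsAdForm.gauge_comp {η : P.LocalForms k} (hη : IsAdForm η) {i j : P.ι} {x : M}
    (hx : x ∈ P.baseSet i ∩ P.baseSet j) :
    η j x = (Ad (P.transition i j x)⁻¹ : EG →L[ℝ] EG).compContinuousAlternatingMap (η i x) := by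
  ext v
  exact hη.gauge i j x hx v

theorem isAdForm_of_gauge_comp {η : P.LocalForms k} (h : ∀ i, IsSmoothFormOn (P.baseSet i) (η i))
    (h' : ∀ i j, ∀ x ∈ P.baseSet i ∩ P.baseSet j,
      η j x = (Ad (P.transition i j x)⁻¹ : EG →L[ℝ] EG).compContinuousAlternatingMap (η i x)) :
    IsAdForm η :=
  ⟨h, fun i j x hx v => by rw [h' i j x hx]; rfl⟩

theorem IsAdForm.add {η θ : P.LocalForms k} (hη : IsAdForm η) (hθ : IsAdForm θ) :
    IsAdForm (η + θ) :=
  ⟨fun i => (hη.smooth i).add (hθ.smooth i), fun i j x hx v => by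
    simp only [Pi.add_apply, ContinuousAlternatingMap.add_apply, map_add, hη.gauge i j x hx,
      hθ.gauge i j x hx]⟩

theorem IsAdForm.smul {η : P.LocalForms k} (hη : IsAdForm η) (t : ℝ) :
    IsAdForm (fun i x => t • η i x : P.LocalForms k) :=
  ⟨fun i => (hη.smooth i).const_smul t, fun i j x hx v => by
    simp only [ContinuousAlternatingMap.smul_apply, map_smul, hη.gauge i j x hx]⟩

theorem IsAdForm.neg {η : P.LocalForms k} (hη : IsAdForm η) : IsAdForm (-η) := by
  have h := hη.smul (-1)
  have h2 : (fun i x => (-1 : ℝ) • η i x : P.LocalForms k) = -η := by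
    funext i x
    simp
  rwa [h2] at h

variable (S : SymplecticRiemannian n M)

theorem IsAdForm.star (h : k + l = 2 * n) {η : P.LocalForms k} (hη : IsAdForm η) :
    IsAdForm (star S h η) :=
  isAdForm_of_gauge_comp (fun i => (hη.smooth i).hodgeStar S h) fun i j x hx => by
    rw [PYM.star, PYM.star, hη.gauge_comp hx, hodgeStar_eq, hodgeStar_eq, starAt_map]

theorem IsAdForm.primitive (hn : 2 ≤ n) {η : P.LocalForms 2} (hη : IsAdForm η) :
    IsAdForm (primitive S η) :=
  isAdForm_of_gauge_comp (fun i => (hη.smooth i).primitivePart S hn) fun i j x hx => by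
    rw [PYM.primitive, PYM.primitive, hη.gauge_comp hx, primitivePart_eq, primitivePart_eq, primAt_map]

theorem wedgeBracket_map {R : EG →L[ℝ] EG} (hR : ∀ u v, R (bracket G u v) = bracket G (R u) (R v))
    (a : Model n →L[ℝ] EG) (β : Model n [⋀^Fin k]→L[ℝ] EG) :
    wedgeOne (bracket G) (R ∘L a) (R.compContinuousAlternatingMap β) =
      R.compContinuousAlternatingMap (wedgeOne (bracket G) a β) := by
  ext v
  simp only [wedgeOne_apply, ContinuousLinearMap.compContinuousAlternatingMap_coe,
    Function.comp_apply, ContinuousLinearMap.comp_apply, map_sum, map_smul, hR]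

theorem IsAdForm.wedgeBracket {a : P.LocalForms 1} {β : P.LocalForms k} (ha : IsAdForm a)
    (hβ : IsAdForm β) : IsAdForm (fun i x => wedgeBracket G (a i x) (β i x) : P.LocalForms (k + 1)) :=
  isAdForm_of_gauge_comp (fun i => (ha.smooth i).wedgeForm (bracket G) (hβ.smooth i))
    fun i j x hx => by
      rw [ha.gauge_comp hx, hβ.gauge_comp hx, wedgeBracket_eq, wedgeBracket_eq,
        ← wedgeBracket_map (Ad_bracket _)]
      rfl

/-! ### Gauge transformations in charts -/

theorem IsAdForm.inChart_gauge {η : P.LocalForms k} (hη : IsAdForm η) {i j : P.ι} {c : M} {y : Model n}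
    (hy : y ∈ chartDomain c (P.baseSet i ∩ P.baseSet j)) :
    inChart c (η j) y = (Ad (P.transition i j ((chartE n c).symm y))⁻¹ :
      EG →L[ℝ] EG).compContinuousAlternatingMap (inChart c (η i) y) := by
  rw [inChart_eq, inChart_eq, hη.gauge_comp hy.2]
  rfl

theorem Connection.gauge_comp (A : Connection P) {i j : P.ι} {x : M}
    (hx : x ∈ P.baseSet i ∩ P.baseSet j) :
    (ofSubsingleton ℝ (Model n) EG (0 : Fin 1)).symm (A.form j x) =
      Ad (P.transition i j x)⁻¹ ∘L (ofSubsingleton ℝ (Model n) EG (0 : Fin 1)).symm (A.form i x) +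
        leftLogDeriv (P.transition i j) x := by
  ext v
  exact A.gauge i j x hx v

theorem Connection.inChart_gauge (A : Connection P) {i j : P.ι} {c : M} {y : Model n}
    (hy : y ∈ chartDomain c (P.baseSet i ∩ P.baseSet j)) :
    (ofSubsingleton ℝ (Model n) EG (0 : Fin 1)).symm (inChart c (A.form j) y) =
      Ad (P.transition i j ((chartE n c).symm y))⁻¹ ∘L
        (ofSubsingleton ℝ (Model n) EG (0 : Fin 1)).symm (inChart c (A.form i) y) +
        logDeriv (fun z => P.transition i j ((chartE n c).symm z)) y := by
  have hU := (P.isOpen_baseSet i).inter (P.isOpen_baseSet j)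
  rw [← leftLogDeriv_comp_jac hU (P.smooth_transition i j) hy]
  have h1 := congrArg (fun L : Model n →L[ℝ] EG => L ∘L jac c y) (A.gauge_comp hy.2)
  simp only [ContinuousLinearMap.add_comp] at h1
  exact h1

theorem wedgeOne_add_left {V W X : Type*} [NormedAddCommGroup V] [NormedSpace ℝ V]
    [NormedAddCommGroup W] [NormedSpace ℝ W] [NormedAddCommGroup X] [NormedSpace ℝ X]
    (b : V →L[ℝ] W →L[ℝ] X) (α α' : Model n →L[ℝ] V) (γ : Model n [⋀^Fin k]→L[ℝ] W) :
    wedgeOne b (α + α') γ = wedgeOne b α γ + wedgeOne b α' γ := by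
  ext v
  simp only [wedgeOne_apply, ContinuousAlternatingMap.add_apply, add_apply, map_add, smul_add,
    Finset.sum_add_distrib]

/-- Gauge covariance of the covariant derivative. -/
theorem IsAdForm.covDer (A : Connection P) {η : P.LocalForms k} (hη : IsAdForm η) :
    IsAdForm (covDer A η) := by
  refine isAdForm_of_gauge_comp (fun i => ((hη.smooth i).extDer (P.isOpen_baseSet i)).add
    ((A.smooth i).wedgeForm (bracket G) (hη.smooth i))) fun i j x hx => ?_
  have hU := (P.isOpen_baseSet i).inter (P.isOpen_baseSet j)
  have hy := chartE_self_mem_chartDomain (n := n) hx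
  have hnhds := (isOpen_chartDomain x hU).mem_nhds hy
  have hxx : (chartE n x).symm (chartE n x x) = x := extChartAt_to_inv x
  have hsm : ∀ i' , P.baseSet i ∩ P.baseSet j ⊆ P.baseSet i' →
      ContDiffAt ℝ ∞ (inChart x (η i')) (chartE n x x) := fun i' h =>
    ((hη.smooth i').mono h).contDiffAt hU hy
  have h1 := extDeriv_gauge (η := inChart x (η i)) (η' := inChart x (η j))
    (contMDiffAt_comp_chart hU (P.smooth_transition i j) hy)
    (fun v => ((contDiffOn_form_iff.1 ((hη.smooth i).mono Set.inter_subset_left x) v).contDiffAt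
      hnhds).differentiableAt (by simp))
    ((hsm i Set.inter_subset_left).differentiableAt (by simp))
    ((hsm j Set.inter_subset_right).differentiableAt (by simp))
    (by filter_upwards [hnhds] with z hz using hη.inChart_gauge hz)
  rw [← leftLogDeriv_eq_logDeriv ((P.smooth_transition i j).contMDiffAt (hU.mem_nhds hx)),
    inChart_self, hxx] at h1
  rw [PYM.covDer, PYM.covDer, wedgeBracket_eq, wedgeBracket_eq, A.gauge_comp hx, wedgeOne_add_left,
    add_left_comm]
  refine (congrArg₂ (· + ·) rfl h1).trans ?_
  rw [hη.gauge_comp hx, wedgeBracket_map (Ad_bracket _)]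
  ext v
  simp only [ContinuousAlternatingMap.add_apply,
    ContinuousLinearMap.compContinuousAlternatingMap_coe, Function.comp_apply, map_add]
  exact add_comm _ _

theorem form_two_ext {V : Type*} [NormedAddCommGroup V] [NormedSpace ℝ V]
    {α β : Model n [⋀^Fin 2]→L[ℝ] V} (h : ∀ u v, α ![u, v] = β ![u, v]) : α = β := by
  ext v
  have hv : v = ![v 0, v 1] := by
    funext i
    fin_cases i <;> rfl
  rw [hv, h]

theorem half_wedgeBracket_self_apply (a : Model n [⋀^Fin 1]→L[ℝ] EG) (u v : Model n) :
    ((2 : ℝ)⁻¹ • wedgeBracket G a a) ![u, v] =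
      bracket G ((ofSubsingleton ℝ (Model n) EG (0 : Fin 1)).symm a u)
        ((ofSubsingleton ℝ (Model n) EG (0 : Fin 1)).symm a v) := by
  rw [ContinuousAlternatingMap.smul_apply, wedgeBracket_one_apply, bracketTwo_apply, bracketTwo_apply,
    bracket_skew (_ : EG) ((ofSubsingleton ℝ (Model n) EG (0 : Fin 1)).symm a u), sub_neg_eq_add,
    ← two_smul ℝ, smul_smul]
  norm_num

/-- Gauge covariance of the curvature. -/
theorem isAdForm_curvature (A : Connection P) : IsAdForm (curvature A) := by
  refine isAdForm_of_gauge_comp (fun i => ((A.smooth i).extDer (P.isOpen_baseSet i)).add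
    (((A.smooth i).wedgeForm (bracket G) (A.smooth i)).const_smul _)) fun i j x hx => ?_
  have hU := (P.isOpen_baseSet i).inter (P.isOpen_baseSet j)
  have hy := chartE_self_mem_chartDomain (n := n) hx
  have hnhds := (isOpen_chartDomain x hU).mem_nhds hy
  have hxx : (chartE n x).symm (chartE n x x) = x := extChartAt_to_inv x
  refine form_two_ext fun u v => ?_
  have h1 := curvature_gauge (y := chartE n x x)
    (γ := fun z => P.transition i j ((chartE n x).symm z))
    (a := fun z => (ofSubsingleton ℝ (Model n) EG (0 : Fin 1)).symm (inChart x (A.form i) z))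
    (a' := fun z => (ofSubsingleton ℝ (Model n) EG (0 : Fin 1)).symm (inChart x (A.form j) z))
    (by filter_upwards [hnhds] with z hz using contMDiffAt_comp_chart hU (P.smooth_transition i j) hz)
    (((contDiffOn_ofSubsingleton_symm ((A.smooth i).mono Set.inter_subset_left x)).contDiffAt
      hnhds).differentiableAt (by simp))
    (by filter_upwards [hnhds] with z hz using A.inChart_gauge hz) u v
  rw [inChart_self, inChart_self, hxx] at h1
  rw [curvature, curvature, ContinuousLinearMap.compContinuousAlternatingMap_coe, Function.comp_apply,
    ContinuousAlternatingMap.add_apply, ContinuousAlternatingMap.add_apply,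
    half_wedgeBracket_self_apply, half_wedgeBracket_self_apply,
    extDer_one_apply (P.isOpen_baseSet i) (A.smooth i) hx.1,
    extDer_one_apply (P.isOpen_baseSet j) (A.smooth j) hx.2]
  exact h1

theorem isAdForm_primitiveCurvature (hn : 2 ≤ n) (A : Connection P) :
    IsAdForm (primitiveCurvature S A) :=
  (isAdForm_curvature A).primitive S hn

theorem IsAdForm.partialPlus (hn : 2 ≤ n) (A : Connection P) {η : P.LocalForms 1} (hη : IsAdForm η) :
    IsAdForm (partialPlus S A η) :=
  (hη.covDer A).primitive S hn

/-- The operator `L_p` preserves the 1-forms with values in `Ad P`. -/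
theorem IsAdForm.Lp (hn : 2 ≤ n) (A : Connection P) {η : P.LocalForms 1} (hη : IsAdForm η) :
    IsAdForm (Lp S hn A η) := by
  refine IsAdForm.add ?_ ?_
  · exact ((((hη.partialPlus S hn A).star S _).covDer A).star S _).neg
  · refine IsAdForm.star S _ ?_
    exact (hη.wedgeBracket ((isAdForm_primitiveCurvature S hn A).star S _)).smul _

end AdjointForms

/-! ### Families of forms -/

section Families
open Filter Topology
open ContinuousAlternatingMap (ofSubsingleton)

variable {n : ℕ} {M : Type*} [TopologicalSpace M] [ChartedSpace (Model n) M]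
  [IsManifold (𝓡 (2 * n)) ∞ M]
  {V W X : Type*} [NormedAddCommGroup V] [NormedSpace ℝ V] [NormedAddCommGroup W] [NormedSpace ℝ W]
  [NormedAddCommGroup X] [NormedSpace ℝ X] {k l : ℕ}

/-- A family of forms `η_t` on `U` that is smooth in `(t, x)`. -/
def IsSmoothFamilyOn (U : Set M) (η : ℝ → M → Model n [⋀^Fin k]→L[ℝ] V) : Prop :=
  ∀ c : M, ContDiffOn ℝ ∞ (fun p : ℝ × Model n => inChart c (η p.1) p.2)
    (Set.univ ×ˢ chartDomain c U)

theorem IsSmoothFamilyOn.slice {U : Set M} {η : ℝ → M → Model n [⋀^Fin k]→L[ℝ] V}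
    (hη : IsSmoothFamilyOn U η) (t : ℝ) : IsSmoothFormOn U (η t) := fun c =>
  (hη c).comp (f := fun y : Model n => (t, y)) (contDiff_const.prodMk contDiff_id).contDiffOn
    fun _ hy => ⟨trivial, hy⟩

theorem IsSmoothFormOn.family {U : Set M} {η : M → Model n [⋀^Fin k]→L[ℝ] V}
    (hη : IsSmoothFormOn U η) : IsSmoothFamilyOn U (fun _ : ℝ => η) := fun c =>
  (hη c).comp contDiff_snd.contDiffOn fun _ hp => hp.2

theorem IsSmoothFamilyOn.add {U : Set M} {η θ : ℝ → M → Model n [⋀^Fin k]→L[ℝ] V}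
    (hη : IsSmoothFamilyOn U η) (hθ : IsSmoothFamilyOn U θ) :
    IsSmoothFamilyOn U (fun t x => η t x + θ t x) :=
  fun c => ((hη c).add (hθ c)).congr fun _ _ => rfl

theorem IsSmoothFamilyOn.const_smul {U : Set M} {η : ℝ → M → Model n [⋀^Fin k]→L[ℝ] V}
    (hη : IsSmoothFamilyOn U η) (s : ℝ) : IsSmoothFamilyOn U (fun t x => s • η t x) :=
  fun c => ((hη c).const_smul s).congr fun _ _ => rfl

theorem IsSmoothFormOn.smul_family {U : Set M} {η : M → Model n [⋀^Fin k]→L[ℝ] V}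
    (hη : IsSmoothFormOn U η) : IsSmoothFamilyOn U (fun t x => t • η x) :=
  fun c => (contDiff_fst.contDiffOn.smul (hη.family c)).congr fun _ _ => rfl

theorem IsSmoothFamilyOn.wedgeForm [FiniteDimensional ℝ V] [FiniteDimensional ℝ W]
    [FiniteDimensional ℝ X] {U : Set M} (b : V →L[ℝ] W →L[ℝ] X)
    {α : ℝ → M → Model n [⋀^Fin 1]→L[ℝ] V} {γ : ℝ → M → Model n [⋀^Fin k]→L[ℝ] W}
    (hα : IsSmoothFamilyOn U α) (hγ : IsSmoothFamilyOn U γ) :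
    IsSmoothFamilyOn U (fun t => wedgeForm b (α t) (γ t)) :=
  fun c => (contDiffOn_wedgeOne b (contDiffOn_ofSubsingleton_symm (hα c)) (hγ c)).congr
    fun _ _ => inChart_wedgeForm b _ _ c _

theorem IsSmoothFamilyOn.primitivePart [FiniteDimensional ℝ V] (S : SymplecticRiemannian n M)
    (hn : 2 ≤ n) {U : Set M} {α : ℝ → M → Model n [⋀^Fin 2]→L[ℝ] V} (hα : IsSmoothFamilyOn U α) :
    IsSmoothFamilyOn U (fun t x => primitivePart S x (α t x)) :=
  fun c => (contDiffOn_primitivePart S hn contDiff_snd (fun _ h => h.2) (hα c)).congr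
    fun _ hp => inChart_primitivePart S _ hp.2.1

theorem isOpen_univ_prod_chartDomain (c : M) {U : Set M} (hU : IsOpen U) :
    IsOpen ((Set.univ : Set ℝ) ×ˢ chartDomain (n := n) c U) :=
  isOpen_univ.prod (isOpen_chartDomain c hU)

theorem fderiv_slice {f : ℝ × Model n → V} {p : ℝ × Model n} (hf : DifferentiableAt ℝ f p)
    (u : Model n) : fderiv ℝ (fun y => f (p.1, y)) p.2 u = fderiv ℝ f p (0, u) := by
  have h := (HasFDerivAt.comp p.2 (f := fun y => (p.1, y)) (g := f) hf.hasFDerivAt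
    (hasFDerivAt_prodMk_right p.1 p.2)).fderiv
  simp only [Function.comp_def] at h
  rw [h]
  simp

theorem IsSmoothFamilyOn.extDer [FiniteDimensional ℝ V] {U : Set M} (hU : IsOpen U)
    {η : ℝ → M → Model n [⋀^Fin k]→L[ℝ] V} (hη : IsSmoothFamilyOn U η) :
    IsSmoothFamilyOn U (fun t => extDer (η t)) := by
  intro c
  have hopen := isOpen_univ_prod_chartDomain (n := n) c hU
  refine contDiffOn_form fun v => ?_
  have h : ∀ p ∈ Set.univ ×ˢ chartDomain c U, inChart c (PYM.extDer (η p.1)) p.2 v =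
      ∑ i : Fin (k + 1), (-1 : ℝ) ^ (i : ℕ) •
        fderiv ℝ (fun q : ℝ × Model n => inChart c (η q.1) q.2 (i.removeNth v)) p (0, v i) := by
    intro p hp
    rw [inChart_extDer hU (hη.slice p.1) hp.2, extDeriv_eq_sum]
    refine Finset.sum_congr rfl fun i _ => ?_
    rw [fderiv_form_apply (((hη.slice p.1).contDiffAt hU hp.2).differentiableAt (by simp)),
      ← fderiv_slice (((contDiffOn_form_iff.1 (hη c) (i.removeNth v)).contDiffAt
        (hopen.mem_nhds hp)).differentiableAt (by simp))]
  refine ContDiffOn.congr ?_ h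
  refine ContDiffOn.sum fun i _ => ContDiffOn.const_smul _ ?_
  exact ((contDiffOn_form_iff.1 (hη c) (i.removeNth v)).fderiv_of_isOpen (m := ∞) hopen
    (by simp)).clm_apply contDiffOn_const

/-- The exterior derivative commutes with differentiation in a parameter. -/
theorem hasDerivAt_extDer [FiniteDimensional ℝ V] {U : Set M} (hU : IsOpen U)
    {η : ℝ → M → Model n [⋀^Fin k]→L[ℝ] V} {η' : M → Model n [⋀^Fin k]→L[ℝ] V}
    (hη : IsSmoothFamilyOn U η) (hη' : IsSmoothFormOn U η')
    (hd : ∀ x ∈ U, ∀ v, HasDerivAt (fun t => η t x v) (η' x v) 0) {x : M} (hx : x ∈ U)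
    (v : Fin (k + 1) → Model n) :
    HasDerivAt (fun t => extDer (η t) x v) (extDer η' x v) 0 := by
  have hopen := isOpen_univ_prod_chartDomain (n := n) x hU
  set y := chartE n x x with hy
  have hyU : y ∈ chartDomain x U := chartE_self_mem_chartDomain hx
  have hval : ∀ {θ : M → Model n [⋀^Fin k]→L[ℝ] V}, IsSmoothFormOn U θ → PYM.extDer θ x v =
      ∑ i : Fin (k + 1), (-1 : ℝ) ^ (i : ℕ) •
        fderiv ℝ (fun z => inChart x θ z (i.removeNth v)) y (v i) := by
    intro θ hθ
    rw [PYM.extDer, extDeriv_eq_sum]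
    refine Finset.sum_congr rfl fun i _ => ?_
    rw [fderiv_form_apply ((hθ.contDiffAt hU hyU).differentiableAt (by simp))]
  rw [hval hη', show (fun t => PYM.extDer (η t) x v) = fun t => ∑ i : Fin (k + 1), (-1 : ℝ) ^ (i : ℕ) •
        fderiv ℝ (fun z => inChart x (η t) z (i.removeNth v)) y (v i) from
    funext fun t => hval (hη.slice t)]
  refine HasDerivAt.fun_sum fun i _ => HasDerivAt.const_smul _ ?_
  set w := i.removeNth v with hw
  set f : ℝ × Model n → V := fun p => inChart x (η p.1) p.2 w with hf
  have hfs : ContDiffOn ℝ ∞ f (Set.univ ×ˢ chartDomain x U) := contDiffOn_form_iff.1 (hη x) w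
  have hmem : ∀ t : ℝ, ∀ z ∈ chartDomain x U, ((t, z) : ℝ × Model n) ∈ (Set.univ : Set ℝ) ×ˢ chartDomain x U :=
    fun t z hz => ⟨trivial, hz⟩
  have hfa : ContDiffAt ℝ ∞ f (0, y) := hfs.contDiffAt (hopen.mem_nhds (hmem 0 y hyU))
  have h1 : ∀ z ∈ chartDomain x U, fderiv ℝ (fun t => f (t, z)) 0 1 = inChart x η' z w := by
    intro z hz
    have h2 : HasDerivAt (fun t => f (t, z)) (inChart x η' z w) 0 := by
      simp only [hf, inChart_eq, ContinuousAlternatingMap.compContinuousLinearMap_apply]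
      exact hd _ hz.2 _
    rw [fderiv_apply_one_eq_deriv, h2.deriv]
  -- the derivatives in `t` and in `x` commute
  have hswap := fderiv_fderiv_swap (f := f) (a := 0) (b := y) (hfa.of_le
    (by simpa using WithTop.coe_le_coe.2 (le_top : (2 : ℕ∞) ≤ ⊤))) 1 (v i)
  have h3 : (fun z => fderiv ℝ (fun t => f (t, z)) 0 1) =ᶠ[𝓝 y] fun z => inChart x η' z w := by
    filter_upwards [(isOpen_chartDomain x hU).mem_nhds hyU] with z hz using h1 z hz
  rw [h3.fderiv_eq, fderiv_apply_one_eq_deriv] at hswap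
  rw [hswap]
  have h4 : (fun t => fderiv ℝ (fun z => f (t, z)) y (v i)) = fun t => fderiv ℝ f (t, y) (0, v i) := by
    funext t
    exact fderiv_slice (p := (t, y)) ((hfs.contDiffAt
      (hopen.mem_nhds (hmem t y hyU))).differentiableAt (by simp)) (v i)
  have h5 : DifferentiableAt ℝ (fun t => fderiv ℝ (fun z => f (t, z)) y (v i)) 0 := by
    rw [h4]
    have h6 := ((hfa.fderiv_right (m := ∞) (by simp)).differentiableAt (by simp)).comp (0 : ℝ)
      (f := fun t : ℝ => (t, y)) (by fun_prop)
    exact h6.clm_apply (differentiableAt_const _)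
  exact h5.hasDerivAt

/-! ### Derivatives of the pointwise operations -/

theorem hasDerivAt_pairAt (g : Model n →L[ℝ] Model n →L[ℝ] ℝ) (b : V →L[ℝ] W →L[ℝ] X)
    {α : ℝ → Model n [⋀^Fin k]→L[ℝ] V} {α' : Model n [⋀^Fin k]→L[ℝ] V}
    {β : ℝ → Model n [⋀^Fin k]→L[ℝ] W} {β' : Model n [⋀^Fin k]→L[ℝ] W}
    (hα : ∀ v, HasDerivAt (fun t => α t v) (α' v) 0) (hβ : ∀ v, HasDerivAt (fun t => β t v) (β' v) 0) :
    HasDerivAt (fun t => pairAt g b (α t) (β t)) (pairAt g b α' (β 0) + pairAt g b (α 0) β') 0 := by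
  simp only [pairAt, ← smul_add, ← Finset.sum_add_distrib]
  refine HasDerivAt.const_smul _ (HasDerivAt.fun_sum fun I _ => ?_)
  exact (b.hasFDerivAt.comp_hasDerivAt (0 : ℝ) (hα _)).clm_apply (hβ _)

theorem hasDerivAt_primAt (g : Model n →L[ℝ] Model n →L[ℝ] ℝ) (w : Model n [⋀^Fin 2]→L[ℝ] ℝ)
    {α : ℝ → Model n [⋀^Fin 2]→L[ℝ] V} {α' : Model n [⋀^Fin 2]→L[ℝ] V}
    (hα : ∀ v, HasDerivAt (fun t => α t v) (α' v) 0) (v : Fin 2 → Model n) :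
    HasDerivAt (fun t => primAt g w (α t) v) (primAt g w α' v) 0 := by
  simp only [primAt, ContinuousAlternatingMap.sub_apply, tensor_apply]
  have h := hasDerivAt_pairAt g (ContinuousLinearMap.lsmul ℝ ℝ) (α := fun _ => w) (α' := 0)
    (β := α) (β' := α') (fun v => hasDerivAt_const _ _) hα
  have h0 : pairAt g (ContinuousLinearMap.lsmul ℝ ℝ) (0 : Model n [⋀^Fin 2]→L[ℝ] ℝ) (α 0) = 0 := by
    simp [pairAt]
  rw [h0, zero_add] at h
  exact (hα v).sub ((h.const_smul _).const_smul _)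

theorem hasDerivAt_wedgeOne_left (b : V →L[ℝ] W →L[ℝ] X) {a : ℝ → Model n →L[ℝ] V}
    {a' : Model n →L[ℝ] V} (ha : ∀ u, HasDerivAt (fun t => a t u) (a' u) 0)
    (γ : Model n [⋀^Fin k]→L[ℝ] W) (v : Fin (k + 1) → Model n) :
    HasDerivAt (fun t => wedgeOne b (a t) γ v) (wedgeOne b a' γ v) 0 := by
  simp only [wedgeOne_apply]
  refine HasDerivAt.fun_sum fun i _ => HasDerivAt.const_smul _ ?_
  have h := (b.hasFDerivAt.comp_hasDerivAt (0 : ℝ) (ha (v i))).clm_apply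
    (hasDerivAt_const (0 : ℝ) (γ (i.removeNth v)))
  simpa using! h

end Families

/-! ### The inner product on adjoint-valued forms -/

section AdFamilies
open Filter Topology
open ContinuousAlternatingMap (ofSubsingleton)

variable {n : ℕ} {M : Type*} [TopologicalSpace M] [ChartedSpace (Model n) M]
  [IsManifold (𝓡 (2 * n)) ∞ M]
  {EG : Type*} [NormedAddCommGroup EG] [NormedSpace ℝ EG] [FiniteDimensional ℝ EG]
  {G : Type*} [TopologicalSpace G] [ChartedSpace EG G] [Group G] [LieGroup 𝓘(ℝ, EG) ∞ G]
  {P : PrincipalBundle n M EG G} {k l : ℕ}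

/-- A family `α_t` of forms with values in `Ad P` that is smooth in `(t, x)`. -/
structure IsAdFamily (α : ℝ → P.LocalForms k) : Prop where
  isAdForm : ∀ t, IsAdForm (α t)
  smooth : ∀ i, IsSmoothFamilyOn (P.baseSet i) (fun t => α t i)

theorem IsAdForm.family {α : P.LocalForms k} (hα : IsAdForm α) : IsAdFamily (fun _ : ℝ => α) :=
  ⟨fun _ => hα, fun i => (hα.smooth i).family⟩

variable (S : SymplecticRiemannian n M) (B : AdInvariantInner EG G)

/-- By `Ad`-invariance, the pointwise inner product does not depend on the trivialization. -/
theorem pointInner_gauge {α β : P.LocalForms k} (hα : IsAdForm α) (hβ : IsAdForm β) {i j : P.ι}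
    {x : M} (hx : x ∈ P.baseSet i ∩ P.baseSet j) :
    pointInner S B x (α j x) (β j x) = pointInner S B x (α i x) (β i x) := by
  rw [pointInner_eq, hα.gauge_comp hx, hβ.gauge_comp hx, pairAt_map _ (B.ad_invariant _),
    pointInner_eq]

theorem pointInner_comm (x : M) (α β : Model n [⋀^Fin k]→L[ℝ] EG) :
    pointInner S B x α β = pointInner S B x β α := by
  rw [pointInner_eq, pairAt_flip (isInner_metricAt _ _), pointInner_eq]
  congr 1
  ext u v
  exact B.symm _ _

/-- The pointwise inner product is smooth, although the trivialization used at a point (`P.indexAt`) need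
not vary continuously. -/
theorem IsAdFamily.contDiffOn_pointInner {α β : ℝ → P.LocalForms k} (hα : IsAdFamily α)
    (hβ : IsAdFamily β) (c : M) :
    ContDiffOn ℝ ∞ (fun p : ℝ × Model n => pointInner S B ((chartE n c).symm p.2)
      (α p.1 (P.indexAt ((chartE n c).symm p.2)) ((chartE n c).symm p.2))
      (β p.1 (P.indexAt ((chartE n c).symm p.2)) ((chartE n c).symm p.2)))
      (Set.univ ×ˢ (chartE n c).target) := by
  intro p hp
  set i := P.indexAt ((chartE n c).symm p.2) with hi
  have hmem : p ∈ (Set.univ : Set ℝ) ×ˢ chartDomain (n := n) c (P.baseSet i) :=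
    ⟨trivial, hp.2, P.mem_baseSet_at _⟩
  have hnhds := (isOpen_univ_prod_chartDomain (n := n) c (P.isOpen_baseSet i)).mem_nhds hmem
  have h1 : ContDiffOn ℝ ∞ (fun q : ℝ × Model n => pairAt (metricIn S.metric c q.2) B.form
      (inChart c (α q.1 i) q.2) (inChart c (β q.1 i) q.2))
      (Set.univ ×ˢ chartDomain c (P.baseSet i)) :=
    contDiffOn_pairAt ((contDiffOn_metricIn S.metric c).comp contDiff_snd.contDiffOn
      fun q hq => hq.2.1) (fun q hq => isInner_metricIn S.metric hq.2.1) _ (hα.smooth i c)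
      (hβ.smooth i c)
  refine ((h1.contDiffAt hnhds).congr_of_eventuallyEq ?_).contDiffWithinAt
  filter_upwards [hnhds] with q hq
  rw [pointInner_gauge S B (hα.isAdForm q.1) (hβ.isAdForm q.1) ⟨hq.2.2, P.mem_baseSet_at _⟩,
    pointInner_eq]
  exact pairAt_eq_inChart S.metric B.form (α q.1 i) (β q.1 i) hq.2.1

theorem continuous_pointInner {α β : P.LocalForms k} (hα : IsAdForm α) (hβ : IsAdForm β) :
    Continuous fun x => pointInner S B x (α (P.indexAt x) x) (β (P.indexAt x) x) :=
  continuous_of_charts (n := n) fun c =>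
    (hα.family.contDiffOn_pointInner S B hβ.family c).continuousOn.comp
      (f := fun y => ((0 : ℝ), y)) (by fun_prop) fun _ hy => ⟨trivial, hy⟩

section Integrals
variable [T2Space M] [CompactSpace M]

theorem innerL2_comm (α β : P.LocalForms k) : innerL2 S B α β = innerL2 S B β α := by
  simp only [innerL2, pointInner_comm S B _ (α _ _)]

theorem innerL2_add_left {α α' β : P.LocalForms k} (hα : IsAdForm α) (hα' : IsAdForm α')
    (hβ : IsAdForm β) : innerL2 S B (α + α') β = innerL2 S B α β + innerL2 S B α' β := by
  simp only [innerL2]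
  rw [← integral_add_of_continuous _ (continuous_pointInner S B hα hβ) (continuous_pointInner S B hα' hβ)]
  congr 1
  funext x
  exact pairAt_add_left _ _ _ _ _

/-- Nondegeneracy of the `L²` inner product. -/
theorem eq_zero_of_innerL2_self {α : P.LocalForms k} (hα : IsAdForm α)
    (h : innerL2 S B α α = 0) (i : P.ι) {x : M} (hx : x ∈ P.baseSet i) : α i x = 0 := by
  have h1 := eq_zero_of_integral_eq_zero S.metric (continuous_pointInner S B hα hα)
    (fun x => pairAt_self_nonneg (isInner_metricAt _ _) B.pos _) h x
  have h2 : α (P.indexAt x) x = 0 := eq_zero_of_pairAt_self (isInner_metricAt _ _) B.pos h1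
  rw [hα.gauge_comp ⟨P.mem_baseSet_at x, hx⟩, h2]
  ext v
  simp

theorem innerL2_eq_zero_of_left {α β : P.LocalForms k} (h : ∀ i, ∀ x ∈ P.baseSet i, α i x = 0) :
    innerL2 S B α β = 0 := by
  have h1 : (fun x => pointInner S B x (α (P.indexAt x) x) (β (P.indexAt x) x)) =
      fun x => 0 * pointInner S B x (α (P.indexAt x) x) (β (P.indexAt x) x) := by
    funext x
    rw [h _ x (P.mem_baseSet_at x), zero_mul, pointInner_eq]
    simp [pairAt]
  rw [innerL2, h1, integral_const_mul_left, zero_mul]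

/-- Differentiation of the `L²` inner product of two smooth families. -/
theorem IsAdFamily.hasDerivAt_innerL2 {α β : ℝ → P.LocalForms k} {α' β' : P.LocalForms k}
    (hα : IsAdFamily α) (hβ : IsAdFamily β) (hα' : IsAdForm α') (hβ' : IsAdForm β')
    (hdα : ∀ i, ∀ x ∈ P.baseSet i, ∀ v, HasDerivAt (fun t => α t i x v) (α' i x v) 0)
    (hdβ : ∀ i, ∀ x ∈ P.baseSet i, ∀ v, HasDerivAt (fun t => β t i x v) (β' i x v) 0) :
    HasDerivAt (fun t => innerL2 S B (α t) (β t))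
      (innerL2 S B α' (β 0) + innerL2 S B (α 0) β') 0 := by
  rw [innerL2, innerL2, ← integral_add_of_continuous _ (continuous_pointInner S B hα' (hβ.isAdForm 0))
    (continuous_pointInner S B (hα.isAdForm 0) hβ')]
  exact hasDerivAt_integral S.metric (hα.contDiffOn_pointInner S B hβ) fun x =>
    hasDerivAt_pairAt _ _ (hdα _ x (P.mem_baseSet_at x)) (hdβ _ x (P.mem_baseSet_at x))

/-- Integration by parts: `d_A^*` is the formal adjoint of `d_A`. -/
theorem innerL2_covDer (h : 1 + 1 + l = 2 * n) (A : Connection P) {ζ : P.LocalForms 1}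
    {β : P.LocalForms 2} (hζ : IsAdForm ζ) (hβ : IsAdForm β) :
    innerL2 S B (covDer A ζ) β = innerL2 S B ζ (covCoder S h A β) := by
  have h' : l + 1 + 1 = 2 * n := by omega
  have h₂ : 2 + l = 2 * n := h
  -- the form `⟨ζ ∧ *β⟩` is globally defined, by `Ad`-invariance
  let ν : P.ι → M → Model n [⋀^Fin (l + 1)]→L[ℝ] ℝ := fun i =>
    wedgeForm B.form (ζ i) fun z => hodgeStar S h₂ z (β i z)
  let μ : M → Model n [⋀^Fin (l + 1)]→L[ℝ] ℝ := fun x => ν (P.indexAt x) x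
  have hμν : ∀ i, ∀ x ∈ P.baseSet i, μ x = ν i x := by
    intro i x hx
    have h1 := hζ.gauge_comp (i := i) (j := P.indexAt x) ⟨hx, P.mem_baseSet_at x⟩
    have h2 := (hβ.star S h₂).gauge_comp (i := i) (j := P.indexAt x) ⟨hx, P.mem_baseSet_at x⟩
    simp only [PYM.star] at h2
    simp only [μ, ν, wedgeForm]
    rw [h1, h2]
    exact wedgeOne_map (R := Ad (P.transition i (P.indexAt x) x)⁻¹) (B.ad_invariant _)
      ((ofSubsingleton ℝ (Model n) EG (0 : Fin 1)).symm (ζ i x)) (hodgeStar S h₂ x (β i x))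
  have hνs : ∀ i, IsSmoothFormOn (P.baseSet i) (ν i) := fun i =>
    (hζ.smooth i).wedgeForm B.form ((hβ.smooth i).hodgeStar S h₂)
  have hev : ∀ (c : M) (y : Model n), y ∈ (chartE n c).target →
      inChart c μ =ᶠ[𝓝 y] inChart c (ν (P.indexAt ((chartE n c).symm y))) := by
    intro c y hy
    filter_upwards [(isOpen_chartDomain c (P.isOpen_baseSet
      (P.indexAt ((chartE n c).symm y)))).mem_nhds ⟨hy, P.mem_baseSet_at _⟩] with z hz
    rw [inChart_eq, inChart_eq, hμν _ _ hz.2]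
  have hμs : IsSmoothFormOn Set.univ μ := by
    intro c y hy
    refine (((hνs _).contDiffAt (P.isOpen_baseSet _) (c := c) (y := y)
      ⟨hy.1, P.mem_baseSet_at _⟩).congr_of_eventuallyEq (hev c y hy.1)).contDiffWithinAt
  have hdiv : ∀ x, divergence S h' μ x =
      pointInner S B x (covDer A ζ (P.indexAt x) x) (β (P.indexAt x) x) +
        pointInner S B x (ζ (P.indexAt x) x)
          (star S h' (covDer A (star S h₂ β)) (P.indexAt x) x) := by
    intro x
    have h1 := hev x (chartE n x x) (mem_extChartAt_target x)
    have hxx : (chartE n x).symm (chartE n x x) = x := extChartAt_to_inv x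
    rw [hxx] at h1
    have h2 : extDer μ x = extDer (ν (P.indexAt x)) x := by
      rw [extDer, extDer, extDeriv, extDeriv, h1.fderiv_eq]
    have h3 : volForm S x frame ≠ 0 := by
      have h4 := volAt_frame_mul_coframe (isInner_metricAt S.metric x) (S.orientation.ne_zero x)
      exact left_ne_zero_of_mul (h4.trans_ne one_ne_zero)
    rw [divergence, h2, extDer_wedgeForm_hodgeStar S B (P.isOpen_baseSet _) h₂ h' (hζ.smooth _)
      (hβ.smooth _) (P.mem_baseSet_at x) (A.form (P.indexAt x) x), map_comp_castForm]
    have h5 : (frame ∘ Fin.cast h') ∘ Fin.cast h'.symm = (frame : Fin (2 * n) → Model n) := rfl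
    rw [h5, mul_div_cancel_left₀ _ h3]
    rfl
  have hsplit : innerL2 S B (covDer A ζ) β +
      innerL2 S B ζ (star S h' (covDer A (star S h₂ β))) = 0 := by
    have h1 := integral_divergence S h' hμs
    rw [funext hdiv, integral_add_of_continuous _ (continuous_pointInner S B (hζ.covDer A) hβ)
      (continuous_pointInner S B hζ (((hβ.star S h₂).covDer A).star S h'))] at h1
    exact h1
  have hneg : innerL2 S B ζ (covCoder S h A β) = -innerL2 S B ζ (star S h' (covDer A (star S h₂ β))) := by
    rw [innerL2, innerL2, ← neg_one_mul (integral _ _), ← integral_const_mul_left]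
    congr 1
    funext x
    rw [pointInner_eq, pointInner_eq, ← smul_eq_mul, ← pairAt_smul_right, neg_one_smul]
    rfl
  rw [hneg, ← eq_neg_iff_add_eq_zero.2 hsplit]

end Integrals
end AdFamilies

/-! ### First and second variation -/

section Variations
open Filter Topology
open ContinuousAlternatingMap (ofSubsingleton)

variable {n : ℕ} {M : Type*} [TopologicalSpace M] [ChartedSpace (Model n) M]
  [IsManifold (𝓡 (2 * n)) ∞ M]
  {EG : Type*} [NormedAddCommGroup EG] [NormedSpace ℝ EG] [FiniteDimensional ℝ EG]
  {G : Type*} [TopologicalSpace G] [ChartedSpace EG G] [Group G] [LieGroup 𝓘(ℝ, EG) ∞ G]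
  {P : PrincipalBundle n M EG G} {k l : ℕ}

variable (S : SymplecticRiemannian n M) (B : AdInvariantInner EG G)

theorem isSmoothPath_translate (A : Connection P) (η : AdForm P 1) :
    IsSmoothPath fun t => A.translate (η.scale t) := fun i =>
  (A.smooth i).family.add (η.isAdForm.smooth i).smul_family

theorem isAdFamily_primitiveCurvature (hn : 2 ≤ n) {𝒜 : ℝ → Connection P} (h𝒜 : IsSmoothPath 𝒜) :
    IsAdFamily fun t => primitiveCurvature S (𝒜 t) where
  isAdForm t := isAdForm_primitiveCurvature S hn (𝒜 t)
  smooth i := by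
    have h1 : IsSmoothFamilyOn (P.baseSet i) fun t => (𝒜 t).form i := h𝒜 i
    exact ((h1.extDer (P.isOpen_baseSet i)).add
      ((h1.wedgeForm (bracket G) h1).const_smul (2 : ℝ)⁻¹)).primitivePart S hn

theorem isAdFamily_partialPlus (hn : 2 ≤ n) {𝒜 : ℝ → Connection P} (h𝒜 : IsSmoothPath 𝒜)
    {ζ : P.LocalForms 1} (hζ : IsAdForm ζ) : IsAdFamily fun t => partialPlus S (𝒜 t) ζ where
  isAdForm t := hζ.partialPlus S hn (𝒜 t)
  smooth i := by
    have h1 : IsSmoothFamilyOn (P.baseSet i) fun t => (𝒜 t).form i := h𝒜 i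
    have h2 : IsSmoothFamilyOn (P.baseSet i) fun _ => ζ i := (hζ.smooth i).family
    exact ((h2.extDer (P.isOpen_baseSet i)).add (h1.wedgeForm (bracket G) h2)).primitivePart S hn

/-- `η` is the velocity at `t = 0` of the path of connections `𝒜_t`, in the pointwise sense. -/
def HasVelocity (𝒜 : ℝ → Connection P) (η : P.LocalForms 1) : Prop :=
  ∀ i, ∀ x ∈ P.baseSet i, ∀ v, HasDerivAt (fun t => (𝒜 t).form i x v) (η i x v) 0

theorem hasVelocity_translate (A : Connection P) (η : AdForm P 1) :
    HasVelocity (fun t => A.translate (η.scale t)) η.form := by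
  intro i x _ v
  have h := ((hasDerivAt_id (0 : ℝ)).smul_const (η.form i x v)).const_add (A.form i x v)
  rw [one_smul] at h
  exact h

theorem hasDerivAt_bilinear {V W X : Type*} [NormedAddCommGroup V] [NormedSpace ℝ V]
    [NormedAddCommGroup W] [NormedSpace ℝ W] [NormedAddCommGroup X] [NormedSpace ℝ X]
    (b : V →L[ℝ] W →L[ℝ] X) {f : ℝ → V} {f' : V} {g : ℝ → W} {g' : W} {t : ℝ}
    (hf : HasDerivAt f f' t) (hg : HasDerivAt g g' t) :
    HasDerivAt (fun s => b (f s) (g s)) (b f' (g t) + b (f t) g') t :=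
  (b.hasFDerivAt.comp_hasDerivAt t hf).clm_apply hg

/-- The variation of the curvature is `d_A η`. -/
theorem HasVelocity.hasDerivAt_curvature {𝒜 : ℝ → Connection P} (h𝒜 : IsSmoothPath 𝒜) {η : P.LocalForms 1}
    (hη : IsAdForm η) (hd : HasVelocity 𝒜 η) {i : P.ι} {x : M} (hx : x ∈ P.baseSet i)
    (v : Fin 2 → Model n) : HasDerivAt (fun t => curvature (𝒜 t) i x v) (covDer (𝒜 0) η i x v) 0 := by
  have hv : v = ![v 0, v 1] := by
    funext i
    fin_cases i <;> rfl
  rw [hv]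
  have h1 := hasDerivAt_extDer (P.isOpen_baseSet i) (η := fun t => (𝒜 t).form i) (h𝒜 i) (hη.smooth i) (hd i) hx ![v 0, v 1]
  have hval : ∀ u, HasDerivAt (fun t => (ofSubsingleton ℝ (Model n) EG (0 : Fin 1)).symm
      ((𝒜 t).form i x) u) ((ofSubsingleton ℝ (Model n) EG (0 : Fin 1)).symm (η i x) u) 0 :=
    fun u => hd i x hx fun _ => u
  have h2 := hasDerivAt_bilinear (bracket G) (hval (v 0)) (hval (v 1))
  have hF : (fun t => curvature (𝒜 t) i x ![v 0, v 1]) = fun t =>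
      extDer ((𝒜 t).form i) x ![v 0, v 1] +
        bracket G ((ofSubsingleton ℝ (Model n) EG (0 : Fin 1)).symm ((𝒜 t).form i x) (v 0))
          ((ofSubsingleton ℝ (Model n) EG (0 : Fin 1)).symm ((𝒜 t).form i x) (v 1)) := by
    funext t
    rw [curvature, ContinuousAlternatingMap.add_apply, half_wedgeBracket_self_apply]
  have hD : covDer (𝒜 0) η i x ![v 0, v 1] = extDer (η i) x ![v 0, v 1] +
      (bracket G ((ofSubsingleton ℝ (Model n) EG (0 : Fin 1)).symm (η i x) (v 0))
          ((ofSubsingleton ℝ (Model n) EG (0 : Fin 1)).symm ((𝒜 0).form i x) (v 1)) +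
        bracket G ((ofSubsingleton ℝ (Model n) EG (0 : Fin 1)).symm ((𝒜 0).form i x) (v 0))
          ((ofSubsingleton ℝ (Model n) EG (0 : Fin 1)).symm (η i x) (v 1))) := by
    rw [covDer, ContinuousAlternatingMap.add_apply, wedgeBracket_one_apply, bracketTwo_apply,
      bracketTwo_apply,
      bracket_skew ((ofSubsingleton ℝ (Model n) EG (0 : Fin 1)).symm ((𝒜 0).form i x) (v 1)),
      sub_neg_eq_add, add_comm (bracket G _ _)]
  rw [hF, hD]
  exact h1.add h2

/-- The variation of the primitive curvature is `∂₊η`. -/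
theorem HasVelocity.hasDerivAt_primitiveCurvature {𝒜 : ℝ → Connection P} (h𝒜 : IsSmoothPath 𝒜)
    {η : P.LocalForms 1} (hη : IsAdForm η) (hd : HasVelocity 𝒜 η) {i : P.ι} {x : M}
    (hx : x ∈ P.baseSet i) (v : Fin 2 → Model n) :
    HasDerivAt (fun t => primitiveCurvature S (𝒜 t) i x v) (partialPlus S (𝒜 0) η i x v) 0 := by
  simp only [primitiveCurvature, partialPlus, primitive, primitivePart_eq]
  exact hasDerivAt_primAt _ _ (fun v => hd.hasDerivAt_curvature h𝒜 hη hx v) v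

/-- The variation of `∂_{+A} ζ` is `Π[η ∧ ζ]`. -/
theorem HasVelocity.hasDerivAt_partialPlus {𝒜 : ℝ → Connection P} {η : P.LocalForms 1}
    (hd : HasVelocity 𝒜 η) (ζ : P.LocalForms 1) {i : P.ι} {x : M}
    (hx : x ∈ P.baseSet i) (v : Fin 2 → Model n) :
    HasDerivAt (fun t => partialPlus S (𝒜 t) ζ i x v)
      (primitivePart S x (wedgeBracket G (η i x) (ζ i x)) v) 0 := by
  simp only [partialPlus, primitive, primitivePart_eq]
  refine hasDerivAt_primAt _ _ (fun v => ?_) v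
  have h := (hasDerivAt_wedgeOne_left (bracket G)
    (a := fun t => (ofSubsingleton ℝ (Model n) EG (0 : Fin 1)).symm ((𝒜 t).form i x))
    (a' := (ofSubsingleton ℝ (Model n) EG (0 : Fin 1)).symm (η i x))
    (fun u => hd i x hx fun _ => u) (ζ i x) v).const_add (extDer (ζ i) x v)
  exact h

/-- The projection `Π` is orthogonal. -/
theorem pointInner_primitivePart_right (hn : 2 ≤ n) (x : M) (α β : Model n [⋀^Fin 2]→L[ℝ] EG) :
    pointInner S B x (primitivePart S x α) (primitivePart S x β) =
      pointInner S B x (primitivePart S x α) β := by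
  rw [pointInner_eq, pointInner_eq, primitivePart_eq, primitivePart_eq]
  exact pairAt_primAt_right (isInner_metricAt _ _) (S.symp.toForm_ne_zero hn x) _ _ _

variable [T2Space M] [CompactSpace M]

/-- The derivative `2⟨F_p, ∂₊η⟩` of the functional along a path of connections with velocity `η`. -/
theorem HasVelocity.hasDerivAt_functional (hn : 2 ≤ n) {𝒜 : ℝ → Connection P} (h𝒜 : IsSmoothPath 𝒜)
    {η : P.LocalForms 1} (hη : IsAdForm η) (hd : HasVelocity 𝒜 η) :
    HasDerivAt (fun t => functional S B (𝒜 t))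
      (2 * innerL2 S B (primitiveCurvature S (𝒜 0)) (partialPlus S (𝒜 0) η)) 0 := by
  have hF := isAdFamily_primitiveCurvature S hn h𝒜
  have hη' := hη.partialPlus S hn (𝒜 0)
  refine (hF.hasDerivAt_innerL2 S B hF hη' hη' (fun i x hx => hd.hasDerivAt_primitiveCurvature S h𝒜 hη hx)
    (fun i x hx => hd.hasDerivAt_primitiveCurvature S h𝒜 hη hx)).congr_deriv ?_
  rw [innerL2_comm S B (partialPlus S (𝒜 0) η), two_mul]

theorem Connection.translate_zero (A : Connection P) (η : AdForm P 1) :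
    A.translate (η.scale 0) = A := by
  cases A
  simp [Connection.translate, AdForm.scale]

/-- The first variation formula `dS(A)ζ = 2⟨F_p, ∂₊ζ⟩`. -/
theorem hasFirstVariation (hn : 2 ≤ n) (A : Connection P) (ζ : AdForm P 1) :
    HasFirstVariation S B A ζ
      (2 * innerL2 S B (primitiveCurvature S A) (partialPlus S A ζ.form)) := by
  have h := (hasVelocity_translate A ζ).hasDerivAt_functional S B hn (isSmoothPath_translate A ζ) ζ.isAdForm
  simp only [A.translate_zero] at h
  exact h

/-- `⟨∂₊η, ∂₊ζ⟩ + ⟨F_p, Π[η ∧ ζ]⟩ = ⟨L_p η, ζ⟩`. -/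
theorem innerL2_Lp (hn : 2 ≤ n) (A : Connection P) {η ζ : P.LocalForms 1} (hη : IsAdForm η)
    (hζ : IsAdForm ζ) :
    innerL2 S B (partialPlus S A η) (partialPlus S A ζ) +
      innerL2 S B (primitiveCurvature S A)
        (primitive S fun i x => wedgeBracket G (η i x) (ζ i x)) =
      innerL2 S B (Lp S hn A η) ζ := by
  have h1 : innerL2 S B (partialPlus S A η) (partialPlus S A ζ) =
      innerL2 S B (covDer A ζ) (partialPlus S A η) := by
    rw [innerL2_comm S B (covDer A ζ)]
    exact congrArg (integral S.metric) (funext fun x => pointInner_primitivePart_right S B hn x _ _)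
  have h2 : innerL2 S B (primitiveCurvature S A)
        (primitive S fun i x => wedgeBracket G (η i x) (ζ i x)) =
      innerL2 S B (star S (show 2 * n - 2 + 1 + 1 = 2 * n by omega) (fun i x =>
        wedgeBracketRight G (star S (show 2 + (2 * n - 2) = 2 * n by omega)
          (primitiveCurvature S A) i x) (η i x))) ζ := by
    refine congrArg (integral S.metric) (funext fun x => ?_)
    refine (pointInner_primitivePart_right S B hn x _ _).trans ?_
    rw [pointInner_comm]
    exact pointInner_wedgeBracket S B hn x _ _ _ _ _
  have hF := isAdForm_primitiveCurvature S hn A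
  rw [h1, h2, innerL2_covDer S B (show 1 + 1 + (2 * n - 2) = 2 * n by omega) A hζ
    (hη.partialPlus S hn A), innerL2_comm S B ζ]
  exact (innerL2_add_left S B ((((hη.partialPlus S hn A).star S _).covDer A).star S _).neg
      (IsAdForm.star S _ ((hη.wedgeBracket (hF.star S _)).smul _)) hζ).symm

/-- The derivative of the first variation along a path depends on the path only through its velocity. -/
theorem HasVelocity.hasDerivAt_firstVariation (hn : 2 ≤ n) {𝒜 : ℝ → Connection P} (h𝒜 : IsSmoothPath 𝒜)
    {η ζ : P.LocalForms 1} (hη : IsAdForm η) (hd : HasVelocity 𝒜 η) (hζ : IsAdForm ζ) :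
    HasDerivAt (fun t => 2 * innerL2 S B (primitiveCurvature S (𝒜 t)) (partialPlus S (𝒜 t) ζ))
      (2 * innerL2 S B (Lp S hn (𝒜 0) η) ζ) 0 := by
  rw [← innerL2_Lp S B hn (𝒜 0) hη hζ]
  exact ((isAdFamily_primitiveCurvature S hn h𝒜).hasDerivAt_innerL2 S B
    (isAdFamily_partialPlus S hn h𝒜 hζ) (hη.partialPlus S hn (𝒜 0))
    ((hη.wedgeBracket hζ).primitive S hn)
    (fun i x hx => hd.hasDerivAt_primitiveCurvature S h𝒜 hη hx)
    (fun i x hx => hd.hasDerivAt_partialPlus S ζ hx)).const_mul 2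

end Variations

end PYM

end

theorem mainTheorem8 (n : ℕ) (hn : 2 ≤ n)
    {M : Type*} [TopologicalSpace M] [ChartedSpace (PYM.Model n) M]
    [IsManifold (𝓡 (2 * n)) ∞ M] [T2Space M] [CompactSpace M]
    {EG : Type*} [NormedAddCommGroup EG] [NormedSpace ℝ EG] [FiniteDimensional ℝ EG]
    {G : Type*} [TopologicalSpace G] [ChartedSpace EG G] [Group G] [LieGroup 𝓘(ℝ, EG) ∞ G]
    (S : PYM.SymplecticRiemannian n M) (B : PYM.AdInvariantInner EG G)
    (P : PYM.PrincipalBundle n M EG G) (A : PYM.Connection P)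
    (hA : PYM.IsPrimitiveYangMills S B A) :
    (∀ η : PYM.AdForm P 1, PYM.IsAdForm (PYM.Lp S hn A η.form)) ∧
    (∀ η ζ : PYM.AdForm P 1, PYM.HasSecondVariation S B A η ζ
      (2 * PYM.innerL2 S B (PYM.Lp S hn A η.form) ζ.form)) ∧
    (∀ η : PYM.AdForm P 1, PYM.IsTangent S B A η ↔
      ∀ i, ∀ x ∈ P.baseSet i, PYM.Lp S hn A η.form i x = 0) := by
  have hsecond : ∀ η ζ : PYM.AdForm P 1, HasDerivAt (fun t : ℝ =>
      2 * PYM.innerL2 S B (PYM.primitiveCurvature S (A.translate (η.scale t)))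
        (PYM.partialPlus S (A.translate (η.scale t)) ζ.form))
      (2 * PYM.innerL2 S B (PYM.Lp S hn A η.form) ζ.form) 0 := by
    intro η ζ
    have h := (PYM.hasVelocity_translate A η).hasDerivAt_firstVariation S B hn
      (PYM.isSmoothPath_translate A η) η.isAdForm ζ.isAdForm
    simp only [A.translate_zero] at h
    exact h
  refine ⟨fun η => η.isAdForm.Lp S hn A, fun η ζ => ⟨_, fun t => PYM.hasFirstVariation S B hn _ ζ,
    hsecond η ζ⟩, fun η => ⟨?_, fun hL => ?_⟩⟩
  · rintro ⟨𝒜, h𝒜, h0, hd, hf⟩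
    have hvel : PYM.HasVelocity 𝒜 η.form := by
      intro i x hx v
      have h1 := (hd i x hx).hasFDerivAt.continuousAlternatingMap_apply_const v
      simpa using! h1.hasDerivAt
    have hLp := η.isAdForm.Lp S hn A
    -- test the first variation in the direction `ζ = L_p η`
    obtain ⟨f, hf1, hf2⟩ := hf ⟨_, hLp⟩
    have hder := hvel.hasDerivAt_firstVariation S B hn h𝒜 η.isAdForm hLp
    have hfeq : (fun t => 2 * PYM.innerL2 S B (PYM.primitiveCurvature S (𝒜 t))
        (PYM.partialPlus S (𝒜 t) (PYM.Lp S hn A η.form))) = f :=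
      funext fun t => (PYM.hasFirstVariation S B hn (𝒜 t) ⟨_, hLp⟩).unique (hf1 t)
    rw [hfeq, h0] at hder
    -- `f t = o(t)` says that `f` and its derivative vanish at `0`
    have hf0 : f 0 = 0 := by
      obtain ⟨V, hV⟩ := (hf2.isBigO.eq_zero_imp).exists_mem
      exact hV.2 0 (mem_of_mem_nhds hV.1) rfl
    have hder0 : HasDerivAt f 0 0 := by
      rw [hasDerivAt_iff_isLittleO]
      simpa [hf0] using hf2
    have h2 := hder.unique hder0
    exact fun i x hx => PYM.eq_zero_of_innerL2_self S B hLp (by linarith) i hx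
  -- the straight path is tangent to `η`; its first variations have value and derivative `0` at `t = 0`
  · refine ⟨fun t => A.translate (η.scale t), PYM.isSmoothPath_translate A η, A.translate_zero η,
      fun i x _ => ?_, fun ζ => ⟨_, fun t => PYM.hasFirstVariation S B hn _ ζ, ?_⟩⟩
    · have h := ((hasDerivAt_id (0 : ℝ)).smul_const (η.form i x)).const_add (A.form i x)
      rw [one_smul] at h
      exact h
    · have h := hsecond η ζ
      have h0 : 2 * PYM.innerL2 S B (PYM.primitiveCurvature S A)
          (PYM.partialPlus S A ζ.form) = 0 :=
        (PYM.hasFirstVariation S B hn A ζ).unique (hA ζ)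
      rw [PYM.innerL2_eq_zero_of_left S B hL, mul_zero, hasDerivAt_iff_isLittleO] at h
      simpa [A.translate_zero, h0] using h
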